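/- Let $p$ be a prime, fix $\pi$ algebraic over $\mathbb{Q}_p$ with $\pi^{p-1}=-p$, and put $E_\pi(t)=\exp(\pi(t-t^p))=\sum_j c_jt^j$. Let $\Gamma_p$ be Morita's $p$-adic gamma function and $\{x\}=x-\lfloor x\rfloor$. Let $\alpha_1,\beta_1\in\mathbb{Z}_{(p)}\cap[0,1)$ with $\alpha_1\ne\beta_1$, and let $\alpha_1',\beta_1'\in[0,1)$ be rational numbers with $a:=p\alpha_1-\alpha_1'\in\mathbb{Z}$ and $b:=p\beta_1-\beta_1'\in\mathbb{Z}$. Put $\delta=\alpha_1-\beta_1+1$, $\delta'=\alpha_1'-\beta_1'+1$, $\mu=p(\alpha_1-\beta_1)-(\alpha_1'-\beta_1')=a-b$, $T=p\delta-\delta'=\mu+p-1$, and $$\gamma=\pi^{\mu}\,\Gamma_p(\{\alpha'_1-\beta'_1\})\times\begin{cases}\frac1{\alpha_1-\beta_1}&\alpha_1>\beta_1\\ p&\alpha_1<\beta_1\end{cases}\times\begin{cases}\alpha'_1-\beta'_1&\alpha'_1>\beta'_1\\-1&\alpha'_1<\beta'_1.\end{cases}$$ Setting. For $x,y\in\mathbb{C}_p$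 let $M_\delta(x,y)$ be the quotient of the space of power series in $X$ over $\mathbb{C}_p$ with radius of convergence greater than $1$ by the image of $X\frac{d}{dX}+\delta+\pi(x+y)X$; this is the fibre at $(x,y)$ of the (overconvergent) GKZ system whose solutions are the functions $\Phi(x,y)=x^{-\alpha_1}y^{\beta_1-1}f(-y/x)$, with $f$ a solution of the hypergeometric equation $z(D+\alpha_1)f-(D+\beta_1-1)f=0$, $D=z\frac{d}{dz}$; the class of $1$ corresponds to $\Phi$. Dwork's Frobenius map $M_\delta(x^p,y^p)\to M_{\delta'}(x,y)$ is $$f(X)\mapsto X^{T}\exp(-h)f(X^p),\qquad h=\pi(xX-(xX)^p)+\pi(yX-(yX)^p).$$ The *matrix of Dwork's intertwiner at $(x,y)$* is the scalar by which the inverse transpose of this map (an isomorphism between the dual spaces, i.e. between the fibres of the connections of solutions) acts in the bases dual to the class of $1$. Then: 1. $\alpha_1'\ne\beta_1'$, $T\ge0$, and $\gamma$ is Dwork's symbol $\gamma_p(\alpha_1'-\beta_1'+1,\alpha_1-\beta_1+1)$, that is $\gamma=\sum_{i\in\mathbb{Z}}c_{pi+T}\,(\delta)_i/(-\pi)^i$.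 2. If $|x|,|y|\le1$ and $|x+y|=1$, then $M_\delta(x^p,y^p)$ and $M_{\delta'}(x,y)$ are one-dimensional with basis the class of $1$. 3. At $(x,y)=(1,0)$, Dwork's Frobenius map is a well-defined isomorphism, and the matrix of Dwork's intertwiner is $\gamma$. 4. Let $\sigma(z)=-(-z)^p$ (which is $z^p$ for odd $p$). There are $\eta\in(0,1)$ and an invertible rigid analytic function $F$ over $\mathbb{Q}_p(\pi)$ on $V=\{\eta<|z|<\eta^{-1},\ |z-1|>\eta\}$ such that - $F$ is a Frobenius intertwiner with respect to $\sigma$ from the connection of the hypergeometric equation with parameters $\alpha_1;\beta_1$ to that with parameters $\alpha'_1;\beta'_1$: with $N(z)=\frac{z\alpha_1-\beta_1+1}{z-1}$ and $N'(z)=\frac{z\alpha_1'-\beta_1'+1}{z-1}$, one has $N'F-pF\,\sigma(N)+D(F)=0$; - $F$ is the intertwiner constructed by Dwork: whenever $|x|=|y|=|x+y|=1$, Dwork's Frobenius map is a well-defined isomorphism and the matrix of Dwork's intertwiner at $(x,y)$ is $x^{a}y^{p-1-b}F(-y/x)$; - in the bases of local solutions $(-z)^{1-\beta_1}{}_1F_0(\delta\,|\,z)$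 and $(-z)^{1-\beta'_1}{}_1F_0(\delta'\,|\,z)$ at $z=0$, $F$ is multiplication by $\gamma$: for $\eta<|z|<1$, $$F(z)\;{}_1F_0(\delta\,|\,\sigma(z))=\gamma\,(-z)^{p(\beta_1-1)-(\beta_1'-1)}\;{}_1F_0(\delta'\,|\,z),\qquad {}_1F_0(\delta\,|\,z)=\sum_{k\ge0}\frac{(\delta)_k}{k!}z^k .$$ -/

import Mathlib

open Filter Topology PowerSeries

noncomputable section

/-! ### The `p`-adic gamma function and Dwork's exponential -/

/-- Morita's `p`-adic gamma function `Γ_p : ℤ_p → ℤ_p`: the continuous extension of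
`n ↦ (-1)^n ∏_{0 < k < n, p ∤ k} k` from the dense subset `ℕ` of `ℤ_p`. -/
def moritaGamma (p : ℕ) [Fact p.Prime] (x : ℤ_[p]) : ℤ_[p] :=
  limUnder (comap (Nat.cast : ℕ → ℤ_[p]) (𝓝 x))
    (fun n : ℕ => (-1 : ℤ_[p]) ^ n * ∏ k ∈ (Finset.range n).filter (fun k => ¬ p ∣ k), (k : ℤ_[p]))

/-- The element of `ℤ_p` given by a `p`-integral rational number (`0` on other rationals). -/
def ratToPadicInt (p : ℕ) [Fact p.Prime] (x : ℚ) : ℤ_[p] :=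
  if h : ‖(x : ℚ_[p])‖ ≤ 1 then ⟨(x : ℚ_[p]), h⟩ else 0

/-- Dwork's exponential series `E_ϖ(t) = exp(ϖ (t - t ^ p)) = exp(ϖ t) exp(-ϖ t ^ p)`. -/
def dworkExp (p : ℕ) [hp : Fact p.Prime] (ϖ : ℂ_[p]) : PowerSeries ℂ_[p] :=
  rescale ϖ (PowerSeries.exp ℂ_[p]) *
    expand p hp.out.ne_zero (rescale (-ϖ) (PowerSeries.exp ℂ_[p]))

/-- The coefficient `c_j` of `t ^ j` in a power series, for `j` an integer (`0` if `j < 0`). -/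
def intCoeff {R : Type*} [Semiring R] (f : PowerSeries R) (j : ℤ) : R :=
  if 0 ≤ j then coeff j.toNat f else 0

/-- The Pochhammer symbol `(b)_i = Γ(b + i) / Γ(b)` for `i` an integer: `b (b+1) ⋯ (b+i-1)` for
`i ≥ 0`, and `1 / ((b-1) (b-2) ⋯ (b-|i|))` for `i < 0`. -/
def intPochhammer {R : Type*} [Field R] (b : R) : ℤ → R
  | Int.ofNat n => ∏ k ∈ Finset.range n, (b + (k : R))
  | Int.negSucc n => (∏ k ∈ Finset.range (n + 1), (b - ((k : R) + 1)))⁻¹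

/-- The `i`-th term `c_{p i + μ} (b)_i / (-ϖ) ^ i` of the series defining Dwork's symbol
`γ_p(a, b) = ∑_{i ∈ ℤ} c_{p i + μ} (b)_i / (-ϖ) ^ i`, where `μ = p b - a` is an integer. -/
def dworkGammaTerm (p : ℕ) [Fact p.Prime] (ϖ : ℂ_[p]) (μ : ℤ) (b : ℂ_[p]) (i : ℤ) : ℂ_[p] :=
  intCoeff (dworkExp p ϖ) (p * i + μ) * intPochhammer b i / (-ϖ) ^ i

/-! ### Rigid analytic functions near the good-reduction locus of `ℙ¹ ∖ {0, 1, ∞}` -/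

/-- The subspace of `ℙ¹` obtained by removing the closed discs of radius `η` around `0`, `1`, `∞`
(for `0 < η < 1` these lie in the open unit discs around these points). -/
def openV (p : ℕ) [Fact p.Prime] (η : ℝ) : Set ℂ_[p] :=
  {z | η < ‖z‖ ∧ ‖z‖ < η⁻¹ ∧ η < ‖z - 1‖}

/-- The affinoid subspace of `ℙ¹` obtained by removing the open discs of radius `r` around
`0`, `1`, `∞`. -/
def closedV (p : ℕ) [Fact p.Prime] (r : ℝ) : Set ℂ_[p] :=
  {z | r ≤ ‖z‖ ∧ ‖z‖ ≤ r⁻¹ ∧ r ≤ ‖z - 1‖}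

/-- `f` is a rigid analytic function on `openV p η` defined over `K`: on each of the affinoids
`closedV p r`, `η < r < 1`, which exhaust it, `f` is a uniform limit of rational functions over `K`
without poles in the affinoid. -/
def IsRigidAnalytic {p : ℕ} [Fact p.Prime] (K : IntermediateField ℚ_[p] ℂ_[p]) (η : ℝ)
    (f : ℂ_[p] → ℂ_[p]) : Prop :=
  ∀ r : ℝ, η < r → r < 1 → ∀ ε : ℝ, 0 < ε → ∃ P Q : Polynomial K,
    ∀ z ∈ closedV p r, Polynomial.aeval z Q ≠ 0 ∧
      ‖f z - Polynomial.aeval z P / Polynomial.aeval z Q‖ ≤ ε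

/-! ### The hypergeometric connection of order one and Frobenius intertwiners -/

/-- With `D = z d/dz`, the hypergeometric equation `z (D + α) y - (D + β - 1) y = 0` of order one,
made monic, reads `D y + N y = 0` with this `N`; the associated connection is `v ↦ N v + D v`. -/
def hypN {R : Type*} [Field R] (α β z : R) : R := (z * α - (β - 1)) / (z - 1)

theorem hypN_spec {R : Type*} [Field R] (α β z y Dy : R) (hz : z ≠ 1) :
    z * (Dy + α * y) - (Dy + (β - 1) * y) = (z - 1) * (Dy + hypN α β z * y) := by
  have : z - 1 ≠ 0 := sub_ne_zero.mpr hz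
  unfold hypN
  field_simp
  ring

/-- `F`, on `V = openV p η`, is a Frobenius intertwiner over `K` with respect to `σ`, from the
rank-one connection `v ↦ N v + D v` to the rank-one connection `v ↦ N' v + D v` on
`ℙ¹ ∖ {0, 1, ∞}`: `F` is an invertible element of `𝒪(V)` with
`N' F - c_σ F σ(N) + D(F) = 0`, where `D = z d/dz` and `c_σ = D(σ(z)) / σ(z)`. -/
structure IsFrobeniusIntertwiner {p : ℕ} [Fact p.Prime] (K : IntermediateField ℚ_[p] ℂ_[p])
    (σ N N' : ℂ_[p] → ℂ_[p]) (η : ℝ) (F : ℂ_[p] → ℂ_[p]) : Prop where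
  analytic : IsRigidAnalytic K η F
  invertible : ∃ G : ℂ_[p] → ℂ_[p], IsRigidAnalytic K η G ∧ ∀ z ∈ openV p η, F z * G z = 1
  mapsTo : ∀ z ∈ openV p η, σ z ≠ 0 ∧ σ z ≠ 1
  horizontal : ∀ z ∈ openV p η, ∃ F' : ℂ_[p], HasDerivAt F F' z ∧
    N' z * F z - (z * deriv σ z / σ z) * F z * N (σ z) + z * F' = 0

/-- The Frobenius lift on the `z`-line induced, through `z = -y / x`, by `x ↦ x ^ p`, `y ↦ y ^ p`.
For odd `p` it is the standard lift `z ↦ z ^ p`. -/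
def frobLift (p : ℕ) [Fact p.Prime] (z : ℂ_[p]) : ℂ_[p] := -(-z) ^ p

theorem frobLift_of_ne_two (p : ℕ) [hp : Fact p.Prime] (h : p ≠ 2) (z : ℂ_[p]) :
    frobLift p z = z ^ p := by
  unfold frobLift
  rw [Odd.neg_pow (hp.out.odd_of_ne_two h), neg_neg]

/-! ### Dwork's exponential module

For `m = n = 1` the GKZ system attached to `α; β` is `A = (1 1)` with parameter `δ = α - β + 1`: the
function `Φ(x, y) = x ^ (-α) * y ^ (β - 1) * f (-y / x)` is a solution if and only if `f` solves the
hypergeometric equation.  Here `R_A[x, y] = K[X][x, y]`, `g_A = ϖ (x + y) X`, and the GKZ module is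
`R_A[x, y] / D_δ R_A[x, y]` with `D_δ = X d/dX + δ + ϖ (x + y) X`; the class of `1` corresponds to
`Φ`.  We form its overconvergent completion, fibre by fibre in `(x, y)`.  This module is dual to the
connection whose horizontal sections are the solutions. -/

/-- Overconvergent power series in `X`: those converging on a disc of radius greater than `1`. -/
def dagger (p : ℕ) [Fact p.Prime] : Submodule ℂ_[p] (PowerSeries ℂ_[p]) where
  carrier := {f | ∃ ρ : ℝ, 1 < ρ ∧ ∃ C : ℝ, ∀ k : ℕ, ‖coeff k f‖ * ρ ^ k ≤ C}
  zero_mem' := ⟨2, by norm_num, 0, by simp⟩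
  add_mem' := by
    rintro f g ⟨ρ, hρ, C, hC⟩ ⟨ρ', hρ', C', hC'⟩
    refine ⟨min ρ ρ', lt_min hρ hρ', C + C', fun k => ?_⟩
    have h0 : (0 : ℝ) ≤ min ρ ρ' := le_of_lt (lt_trans one_pos (lt_min hρ hρ'))
    have h1 : min ρ ρ' ^ k ≤ ρ ^ k := pow_le_pow_left₀ h0 (min_le_left _ _) k
    have h2 : min ρ ρ' ^ k ≤ ρ' ^ k := pow_le_pow_left₀ h0 (min_le_right _ _) k
    have h3 : ‖coeff k (f + g)‖ ≤ ‖coeff k f‖ + ‖coeff k g‖ := by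
      rw [map_add]; exact norm_add_le _ _
    calc ‖coeff k (f + g)‖ * min ρ ρ' ^ k
        ≤ (‖coeff k f‖ + ‖coeff k g‖) * min ρ ρ' ^ k := by gcongr
      _ = ‖coeff k f‖ * min ρ ρ' ^ k + ‖coeff k g‖ * min ρ ρ' ^ k := by ring
      _ ≤ ‖coeff k f‖ * ρ ^ k + ‖coeff k g‖ * ρ' ^ k := by gcongr
      _ ≤ C + C' := add_le_add (hC k) (hC' k)
  smul_mem' := by
    rintro c f ⟨ρ, hρ, C, hC⟩
    refine ⟨ρ, hρ, ‖c‖ * C, fun k => ?_⟩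
    have h : ‖coeff k (c • f)‖ = ‖c‖ * ‖coeff k f‖ := by
      rw [map_smul, norm_smul]
    rw [h, mul_assoc]
    exact mul_le_mul_of_nonneg_left (hC k) (norm_nonneg c)

theorem one_mem_dagger (p : ℕ) [Fact p.Prime] : (1 : PowerSeries ℂ_[p]) ∈ dagger p := by
  refine ⟨2, by norm_num, 1, fun k => ?_⟩
  rw [coeff_one]
  split_ifs with h
  · simp [h]
  · simp

/-- The operator `D_δ = X d/dX + δ + ϖ s X`, where `s = x + y`. -/
def dworkOp {p : ℕ} [Fact p.Prime] (ϖ δ s : ℂ_[p]) :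
    PowerSeries ℂ_[p] →ₗ[ℂ_[p]] PowerSeries ℂ_[p] :=
  LinearMap.mulLeft ℂ_[p] (X : PowerSeries ℂ_[p]) ∘ₗ
      (PowerSeries.derivative ℂ_[p] : PowerSeries ℂ_[p] →ₗ[ℂ_[p]] PowerSeries ℂ_[p])
    + δ • LinearMap.id + (ϖ * s) • LinearMap.mulLeft ℂ_[p] (X : PowerSeries ℂ_[p])

/-- The fibre, at a point `(x, y)` with `x + y = s`, of the overconvergent GKZ module: overconvergent
series modulo the image of `D_δ` on overconvergent series. -/
abbrev DworkFibre {p : ℕ} [Fact p.Prime] (ϖ δ s : ℂ_[p]) : Type :=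
  ↥(dagger p) ⧸ ((dagger p).map (dworkOp ϖ δ s)).comap (dagger p).subtype

/-- The class in `DworkFibre ϖ δ s` of an overconvergent series. -/
def DworkFibre.mk {p : ℕ} [Fact p.Prime] (ϖ δ s : ℂ_[p]) (f : ↥(dagger p)) : DworkFibre ϖ δ s :=
  Submodule.Quotient.mk f

/-- The class of `1`. -/
def DworkFibre.one {p : ℕ} [Fact p.Prime] (ϖ δ s : ℂ_[p]) : DworkFibre ϖ δ s :=
  DworkFibre.mk ϖ δ s ⟨1, one_mem_dagger p⟩

/-- Dwork's Frobenius `f(X) ↦ X ^ T * exp(-h) * f(X ^ p)` at the point `(x, y)`, where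
`h = ϖ (x X - (x X) ^ p) + ϖ (y X - (y X) ^ p)`, followed by the shift by `X ^ T`. -/
def dworkFrob {p : ℕ} [hp : Fact p.Prime] (ϖ x y : ℂ_[p]) (T : ℕ) (f : PowerSeries ℂ_[p]) :
    PowerSeries ℂ_[p] :=
  X ^ T * (rescale x (dworkExp p (-ϖ)) * rescale y (dworkExp p (-ϖ))) *
    expand p hp.out.ne_zero f

/-- `c` is the matrix at `(x, y)` of the Frobenius intertwiner constructed by Dwork.  That is, Dwork's
Frobenius preserves overconvergent series and induces an isomorphism `Φ` from the fibre at
`(x ^ p, y ^ p)` of the GKZ module with parameter `δ` to the fibre at `(x, y)` of the GKZ module with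
parameter `δ'`; and the resulting isomorphism `(Φ⁻¹)ᵀ` of the dual spaces (the fibres of the
connections of solutions) is multiplication by `c` in the coordinates `ℓ ↦ ℓ(1)`. -/
def IsDworkMatrix {p : ℕ} [Fact p.Prime] (ϖ δ δ' : ℂ_[p]) (T : ℕ) (x y c : ℂ_[p]) : Prop :=
  ∃ Φ : DworkFibre ϖ δ (x ^ p + y ^ p) ≃ₗ[ℂ_[p]] DworkFibre ϖ δ' (x + y),
    (∀ f : ↥(dagger p), ∃ hf : dworkFrob ϖ x y T (f : PowerSeries ℂ_[p]) ∈ dagger p,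
      Φ (DworkFibre.mk ϖ δ (x ^ p + y ^ p) f)
        = DworkFibre.mk ϖ δ' (x + y) ⟨dworkFrob ϖ x y T (f : PowerSeries ℂ_[p]), hf⟩) ∧
    ∀ ℓ : Module.Dual ℂ_[p] (DworkFibre ϖ δ (x ^ p + y ^ p)),
      Φ.symm.dualMap ℓ (DworkFibre.one ϖ δ' (x + y))
        = c * ℓ (DworkFibre.one ϖ δ (x ^ p + y ^ p))

/-- The class of `1` is a basis of the fibre. -/
def OneIsBasis {p : ℕ} [Fact p.Prime] (ϖ δ s : ℂ_[p]) : Prop :=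
  ∀ v : DworkFibre ϖ δ s, ∃! c : ℂ_[p], v = c • DworkFibre.one ϖ δ s

/-! ### Local solutions at `0`, and the explicit scalar -/

/-- The `k`-th term of the hypergeometric series `₁F₀(δ | z) = ∑ (δ)_k z ^ k / k!`. For
`δ = α - β + 1`, the solutions at `0` of the hypergeometric equation with parameters `α; β` are the
multiples of `z ^ (1 - β) * ₁F₀(δ | z)`. -/
def hypTerm {R : Type*} [Field R] (δ z : R) (k : ℕ) : R :=
  (∏ i ∈ Finset.range k, (δ + (i : R))) / (k.factorial : R) * z ^ k

/-- The scalar `ϖ ^ μ * Γ_p({α' - β'}) * (1 / (α - β) or p) * (α' - β' or -1)`. -/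
def rankOneScalar (p : ℕ) [Fact p.Prime] (ϖ : ℂ_[p]) (α β α' β' : ℚ) (μ : ℤ) : ℂ_[p] :=
  ϖ ^ μ
    * algebraMap ℚ_[p] ℂ_[p] (moritaGamma p (ratToPadicInt p (Int.fract (α' - β'))) : ℚ_[p])
    * (if β < α then 1 / ((α : ℂ_[p]) - (β : ℂ_[p])) else (p : ℂ_[p]))
    * (if β' < α' then (α' : ℂ_[p]) - (β' : ℂ_[p]) else -1)

end

noncomputable section

/-! ### Norms of factorials and rising factorials -/

section Basics

variable {p : ℕ} [hp : Fact p.Prime]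

/-! Write `s = x + y`, `s' = x ^ p + y ^ p`, and let `E` be `dworkExp p ϖ`. For `‖s‖ = 1` the
functional on overconvergent series with weights `(δ)_k / (-ϖ s) ^ k` converges, because these
weights grow at most linearly. Its kernel is exactly the image of `D_δ`, and it sends `1` to `1`.
Hence the fibre is a line spanned by the class of `1` (`exists_dworkOp_eq`, `oneIsBasis`), and
Dwork's Frobenius is determined by the image of `1`.

At `(1, 0)` that image is `X ^ T / E`. Conjugating `D_δ'` by `E` turns it into `X d/dX + δ' + p ϖ X
^ p`, whose image is killed by the functional with weights `(δ)_i / (-ϖ) ^ i` at the exponents `p i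
+ T`. This functional sends `X ^ T` to `1` and `E` to Dwork's symbol `γ`, so `X ^ T / E` has class
`γ⁻¹`, and the inverse transpose is `γ` (`exists_dworkOp_eq_X_pow_mul`). At a general point,
`exp(-h) = E(sX)⁻¹ exp(ϖ (s' - s ^ p) X ^ p)`. The last factor is a series in `X ^ p`, whose
contribution is the binomial series `(s' / s ^ p) ^ (-δ)`. This gives the matrix `γ s ^ T (s' / s ^
p) ^ δ` (`isDworkMatrix`).

Putting `z = -y / x` yields `F = γ (-z) ^ (b + 1 - p) (1 - z) ^ T ((1 + (-z) ^ p) / (1 - z) ^ p) ^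
δ`. The base of the last power is close to `1` on `V`, since numerator and denominator agree modulo
`p`. So `F` is rigid analytic there, horizontality is an identity of logarithmic derivatives, and
the formula at `0` follows from `₁F₀(δ | z) = (1 - z) ^ (-δ)`.

Two classical inputs remain. Overconvergence of `E` comes from Dwork's integrality lemma for the
Artin-Hasse exponential (`exists_coeffBound_dworkExp`). The value of `γ` comes from Dwork's formula
`Γ_p(p d - μ) ϖ ^ μ = ∑ c_{p i + μ} (d)_i / (-ϖ) ^ i` for `0 ≤ μ < p` (`moritaGamma_mul_pow`): both
sides obey the same recursion on natural numbers, and the right side is continuous in `d`. -/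

theorem PadicComplex.norm_algebraMap (x : ℚ_[p]) : ‖algebraMap ℚ_[p] ℂ_[p] x‖ = ‖x‖ := by simp

theorem PadicComplex.norm_natCast (n : ℕ) : ‖(n : ℂ_[p])‖ = ‖(n : ℚ_[p])‖ := by
  rw [← PadicComplex.norm_algebraMap, map_natCast]

theorem PadicComplex.norm_p : ‖(p : ℂ_[p])‖ = (p : ℝ)⁻¹ := by
  rw [PadicComplex.norm_natCast, Padic.norm_p]

theorem PadicComplex.norm_natCast_le_one (n : ℕ) : ‖(n : ℂ_[p])‖ ≤ 1 := by
  rw [PadicComplex.norm_natCast]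
  exact_mod_cast Padic.norm_int_le_one (n : ℤ)

/-- The embedding of `ℤ_p` in `ℂ_p`. -/
def padicIntCast (p : ℕ) [Fact p.Prime] : ℤ_[p] →+* ℂ_[p] :=
  (algebraMap ℚ_[p] ℂ_[p]).comp PadicInt.Coe.ringHom

theorem padicIntCast_apply (d : ℤ_[p]) :
    padicIntCast p d = algebraMap ℚ_[p] ℂ_[p] (d : ℚ_[p]) := rfl

theorem norm_padicIntCast (d : ℤ_[p]) : ‖padicIntCast p d‖ = ‖d‖ := by
  rw [padicIntCast_apply, PadicComplex.norm_algebraMap, PadicInt.norm_def]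

theorem norm_padicIntCast_le_one (d : ℤ_[p]) : ‖padicIntCast p d‖ ≤ 1 := by
  rw [norm_padicIntCast]; exact d.norm_le_one

theorem continuous_padicIntCast : Continuous (padicIntCast p) := by
  refine (AddMonoidHomClass.isometry_of_norm (padicIntCast p) fun d => ?_).continuous
  exact norm_padicIntCast d

/-- The rising factorial `d (d + 1) ⋯ (d + n - 1)`. -/
def risingFactorial {R : Type*} [CommRing R] (d : R) (n : ℕ) : R :=
  ∏ k ∈ Finset.range n, (d + (k : R))

theorem risingFactorial_zero {R : Type*} [CommRing R] (d : R) : risingFactorial d 0 = 1 := by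
  simp [risingFactorial]

theorem risingFactorial_succ {R : Type*} [CommRing R] (d : R) (n : ℕ) :
    risingFactorial d (n + 1) = risingFactorial d n * (d + n) := by
  simp [risingFactorial, Finset.prod_range_succ]

theorem risingFactorial_succ' {R : Type*} [CommRing R] (d : R) (n : ℕ) :
    risingFactorial d (n + 1) = d * risingFactorial (d + 1) n := by
  unfold risingFactorial
  rw [Finset.prod_range_succ', mul_comm]
  simp [add_assoc, add_comm (1 : R)]

theorem map_risingFactorial {R S : Type*} [CommRing R] [CommRing S] (f : R →+* S) (d : R) (n : ℕ) :
    f (risingFactorial d n) = risingFactorial (f d) n := by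
  simp [risingFactorial, map_prod]

theorem risingFactorial_eq_multichoose (d : ℤ_[p]) (n : ℕ) :
    risingFactorial d n = n.factorial * Ring.multichoose d n := by
  rw [← nsmul_eq_mul, Ring.factorial_nsmul_multichoose_eq_ascPochhammer,
    ← Polynomial.ascPochhammer_smeval_cast ℤ_[p], ← Polynomial.eval_eq_smeval]
  induction n with
  | zero => simp [risingFactorial]
  | succ n ih => rw [risingFactorial_succ, ih, ascPochhammer_succ_eval]

/-- The quotient by `n!` is a binomial coefficient in `d`, hence a `p`-adic integer. -/
theorem norm_risingFactorial_le (d : ℤ_[p]) (n : ℕ) :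
    ‖risingFactorial (padicIntCast p d) n‖ ≤ ‖(n.factorial : ℂ_[p])‖ := by
  rw [← map_risingFactorial, risingFactorial_eq_multichoose, map_mul, map_natCast, norm_mul]
  exact mul_le_of_le_one_right (norm_nonneg _) (norm_padicIntCast_le_one _)

variable {ϖ : ℂ_[p]}

theorem norm_unif_pow (hϖ : ϖ ^ (p - 1) = -(p : ℂ_[p])) : ‖ϖ‖ ^ (p - 1) = (p : ℝ)⁻¹ := by
  rw [← norm_pow, hϖ, norm_neg, PadicComplex.norm_p]

theorem norm_unif_pos (hϖ : ϖ ^ (p - 1) = -(p : ℂ_[p])) : 0 < ‖ϖ‖ := by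
  rw [norm_pos_iff]
  rintro rfl
  rw [zero_pow (Nat.sub_ne_zero_of_lt hp.out.one_lt), eq_comm, neg_eq_zero] at hϖ
  exact hp.out.ne_zero (by exact_mod_cast hϖ)

theorem unif_ne_zero (hϖ : ϖ ^ (p - 1) = -(p : ℂ_[p])) : ϖ ≠ 0 :=
  norm_pos_iff.mp (norm_unif_pos hϖ)

theorem norm_unif_lt_one (hϖ : ϖ ^ (p - 1) = -(p : ℂ_[p])) : ‖ϖ‖ < 1 := by
  by_contra! h
  have h1 := one_le_pow₀ (n := p - 1) h
  rw [norm_unif_pow hϖ] at h1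
  have : (1 : ℝ) < p := by exact_mod_cast hp.out.one_lt
  exact absurd h1 (not_le.mpr (inv_lt_one_of_one_lt₀ this))

/-- Legendre's formula `(p - 1) v(n!) = n - (digit sum of n)`, rewritten with `‖ϖ‖ ^ (p - 1) = 1 /
p`. -/
theorem norm_factorial_mul (hϖ : ϖ ^ (p - 1) = -(p : ℂ_[p])) (n : ℕ) :
    ‖(n.factorial : ℂ_[p])‖ * ‖ϖ‖ ^ (p.digits n).sum = ‖ϖ‖ ^ n := by
  have h1 : ‖(n.factorial : ℂ_[p])‖ = ‖ϖ‖ ^ (n - (p.digits n).sum) := by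
    rw [← sub_one_mul_padicValNat_factorial, pow_mul, norm_unif_pow hϖ, PadicComplex.norm_natCast,
      Padic.norm_eq_zpow_neg_valuation (by exact_mod_cast n.factorial_ne_zero),
      Padic.valuation_natCast, zpow_neg, zpow_natCast, inv_pow]
  rw [h1, ← pow_add, Nat.sub_add_cancel (Nat.digit_sum_le p n)]

theorem norm_unif_pow_le_norm_factorial (hϖ : ϖ ^ (p - 1) = -(p : ℂ_[p])) (n : ℕ) :
    ‖ϖ‖ ^ n ≤ ‖(n.factorial : ℂ_[p])‖ := by
  rw [← norm_factorial_mul hϖ n]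
  exact mul_le_of_le_one_right (norm_nonneg _)
    (pow_le_one₀ (norm_nonneg _) (norm_unif_lt_one hϖ).le)

/-- The digit sum is at most `p - 1` times the number `l` of digits, and `p ^ l ≤ p n` for `n > 0`.
So `n!` exceeds `‖ϖ‖ ^ n` by a linear factor only; this is what makes the dual functionals converge
on every overconvergent series. -/
theorem norm_factorial_le (hϖ : ϖ ^ (p - 1) = -(p : ℂ_[p])) (n : ℕ) :
    ‖(n.factorial : ℂ_[p])‖ ≤ p * (n + 1) * ‖ϖ‖ ^ n := by
  have hp1 : (1 : ℝ) < p := by exact_mod_cast hp.out.one_lt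
  set l := (p.digits n).length
  have h1 : (p.digits n).sum ≤ (p - 1) * l := by
    have := List.sum_le_card_nsmul (p.digits n) (p - 1) fun d hd =>
      Nat.le_sub_one_of_lt (Nat.digits_lt_base hp.out.one_lt hd)
    rwa [smul_eq_mul, mul_comm] at this
  have h2 : ((p : ℝ)⁻¹) ^ l ≤ ‖ϖ‖ ^ (p.digits n).sum := by
    rw [← norm_unif_pow hϖ, ← pow_mul]
    exact pow_le_pow_of_le_one (norm_nonneg _) (norm_unif_lt_one hϖ).le h1
  have h3 : (p : ℝ) ^ l ≤ p * (n + 1) := by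
    rcases Nat.eq_zero_or_pos n with h | h
    · have : l = 0 := by simp [l, h]
      rw [this, h]; simpa using hp1.le
    · have : p ^ l ≤ p * n := Nat.base_pow_length_digits_le p n (by have := hp.out.two_le; omega) h.ne'
      have : (p : ℝ) ^ l ≤ p * n := by exact_mod_cast this
      nlinarith
  have h4 : ‖(n.factorial : ℂ_[p])‖ * ((p : ℝ)⁻¹) ^ l ≤ ‖ϖ‖ ^ n := by
    rw [← norm_factorial_mul hϖ n]; gcongr
  rw [inv_pow, ← div_eq_mul_inv, div_le_iff₀ (by positivity)] at h4
  calc _ ≤ _ := h4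
    _ ≤ ‖ϖ‖ ^ n * (p * (n + 1)) := by gcongr
    _ = _ := by ring

theorem norm_risingFactorial_div_le (hϖ : ϖ ^ (p - 1) = -(p : ℂ_[p])) (d : ℤ_[p]) (n : ℕ) :
    ‖risingFactorial (padicIntCast p d) n‖ / ‖ϖ‖ ^ n ≤ p * (n + 1) := by
  rw [div_le_iff₀ (pow_pos (norm_unif_pos hϖ) n)]
  exact (norm_risingFactorial_le d n).trans (norm_factorial_le hϖ n)

theorem exists_linear_le_pow {ρ : ℝ} (hρ : 1 < ρ) : ∃ C : ℝ, 0 < C ∧ ∀ n : ℕ, (n : ℝ) + 1 ≤ C * ρ ^ n := by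
  have h0 : 0 < ρ - 1 := by linarith
  refine ⟨1 + (ρ - 1)⁻¹, by positivity, fun n => ?_⟩
  have h1 := one_add_mul_le_pow (a := ρ - 1) (by linarith) n
  rw [add_sub_cancel] at h1
  have h2 : (n : ℝ) ≤ (ρ - 1)⁻¹ * ρ ^ n := by
    rw [← div_eq_inv_mul, le_div_iff₀ h0]; linarith
  have h3 : 1 ≤ ρ ^ n := one_le_pow₀ hρ.le
  linarith

end Basics

/-! ### Power series with geometrically bounded coefficients -/

section Growth

variable {p : ℕ} [hp : Fact p.Prime]

/-- The coefficients `f_k` satisfy `‖f_k‖ r ^ k ≤ C`. -/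
def CoeffBound (f : PowerSeries ℂ_[p]) (r C : ℝ) : Prop :=
  ∀ k : ℕ, ‖coeff k f‖ * r ^ k ≤ C

theorem CoeffBound.nonneg {f : PowerSeries ℂ_[p]} {r C : ℝ} (h : CoeffBound f r C) : 0 ≤ C := by
  have := h 0
  rw [pow_zero, mul_one] at this
  exact (norm_nonneg _).trans this

theorem CoeffBound.mono {f : PowerSeries ℂ_[p]} {r r' C : ℝ} (h : CoeffBound f r C) (h0 : 0 ≤ r')
    (hr : r' ≤ r) : CoeffBound f r' C := fun k =>
  (mul_le_mul_of_nonneg_left (pow_le_pow_left₀ h0 hr k) (norm_nonneg _)).trans (h k)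

theorem CoeffBound.mul {f g : PowerSeries ℂ_[p]} {r C D : ℝ} (hr : 0 ≤ r) (hf : CoeffBound f r C)
    (hg : CoeffBound g r D) : CoeffBound (f * g) r (C * D) := by
  intro n
  rw [coeff_mul]
  obtain ⟨⟨i, j⟩, hij, hle⟩ := IsUltrametricDist.exists_norm_finsetSum_le
    (Finset.HasAntidiagonal.antidiagonal n) (fun x : ℕ × ℕ => coeff x.1 f * coeff x.2 g)
  have hij' : i + j = n := by
    simpa using hij ⟨(0, n), by simp⟩
  subst hij'
  calc _ ≤ ‖coeff i f * coeff j g‖ * r ^ (i + j) := by gcongr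
    _ = (‖coeff i f‖ * r ^ i) * (‖coeff j g‖ * r ^ j) := by rw [norm_mul, pow_add]; ring
    _ ≤ C * D := mul_le_mul (hf i) (hg j) (by positivity) hf.nonneg

theorem CoeffBound.one {r : ℝ} : CoeffBound (1 : PowerSeries ℂ_[p]) r 1 := by
  intro k
  rw [coeff_one]
  split_ifs with h
  · simp [h]
  · simp

theorem CoeffBound.prod {ι : Type*} {s : Finset ι} {f : ι → PowerSeries ℂ_[p]} {r : ℝ} (hr : 0 ≤ r)
    (hf : ∀ i ∈ s, CoeffBound (f i) r 1) : CoeffBound (∏ i ∈ s, f i) r 1 := by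
  classical
  induction s using Finset.induction_on with
  | empty => simpa using CoeffBound.one
  | insert i s hi ih =>
    rw [Finset.prod_insert hi, ← one_mul (1 : ℝ)]
    exact (hf i (by simp)).mul hr (ih fun j hj => hf j (by simp [hj]))

theorem CoeffBound.rescale {f : PowerSeries ℂ_[p]} {r C : ℝ} {a : ℂ_[p]}
    (hf : CoeffBound f (‖a‖ * r) C) : CoeffBound (rescale a f) r C := by
  intro k
  have := hf k
  rwa [coeff_rescale, norm_mul, norm_pow, mul_comm (‖a‖ ^ k), mul_assoc, ← mul_pow]

theorem CoeffBound.expand {f : PowerSeries ℂ_[p]} {r C : ℝ} {n : ℕ} (hn : n ≠ 0)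
    (hf : CoeffBound f (r ^ n) C) : CoeffBound (expand n hn f) r C := by
  intro k
  rw [coeff_expand]
  split_ifs with h
  · obtain ⟨m, rfl⟩ := h
    rw [Nat.mul_div_cancel_left _ (Nat.pos_of_ne_zero hn), pow_mul]
    exact hf m
  · simpa using hf.nonneg

theorem mul_mem_dagger {f g : PowerSeries ℂ_[p]} (hf : f ∈ dagger p) (hg : g ∈ dagger p) :
    f * g ∈ dagger p := by
  obtain ⟨ρ, hρ, C, hC⟩ := hf
  obtain ⟨σ, hσ, D, hD⟩ := hg
  have h0 : 0 ≤ min ρ σ := le_min (by linarith) (by linarith)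
  exact ⟨min ρ σ, lt_min hρ hσ, C * D,
    (CoeffBound.mono hC h0 (min_le_left _ _)).mul h0 (CoeffBound.mono hD h0 (min_le_right _ _))⟩

theorem rescale_mem_dagger {f : PowerSeries ℂ_[p]} (hf : f ∈ dagger p) {a : ℂ_[p]} (ha : ‖a‖ ≤ 1) :
    rescale a f ∈ dagger p := by
  obtain ⟨ρ, hρ, C, hC⟩ := hf
  exact ⟨ρ, hρ, C, CoeffBound.rescale (CoeffBound.mono hC (by positivity)
    (mul_le_of_le_one_left (by positivity) ha))⟩

theorem expand_mem_dagger {f : PowerSeries ℂ_[p]} (hf : f ∈ dagger p) {n : ℕ} (hn : n ≠ 0) :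
    expand n hn f ∈ dagger p := by
  obtain ⟨ρ, hρ, C, hC⟩ := hf
  have h0 : 0 ≤ ρ := by linarith
  refine ⟨ρ ^ (n : ℝ)⁻¹, Real.one_lt_rpow hρ (by positivity), C, CoeffBound.expand hn ?_⟩
  rwa [Real.rpow_inv_natCast_pow h0 hn]

theorem X_pow_mem_dagger (n : ℕ) : (X ^ n : PowerSeries ℂ_[p]) ∈ dagger p := by
  refine ⟨2, by norm_num, 2 ^ n, fun k => ?_⟩
  rw [coeff_X_pow]
  split_ifs with h
  · simp [h]
  · simp

/-- Terms `w_n f_n` with `f` overconvergent and `w` of linear growth are summable. -/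
theorem summable_mul_coeff {f : PowerSeries ℂ_[p]} (hf : f ∈ dagger p) {w : ℕ → ℂ_[p]} {C : ℝ}
    (hw : ∀ n, ‖w n‖ ≤ C * (n + 1)) : Summable fun n => w n * coeff n f := by
  obtain ⟨ρ, hρ, D, hD⟩ := hf
  have hD' : CoeffBound f ρ D := hD
  have h0 : 0 < ρ := by linarith
  have hC : 0 ≤ C := by simpa using (norm_nonneg _).trans (hw 0)
  -- Split `ρ = σ ^ 2`: one factor `σ` absorbs the linear growth of the weights, the other leaves a
  -- geometric series.
  set σ := Real.sqrt ρ
  have hσ : 1 < σ := by simpa using Real.sqrt_lt_sqrt zero_le_one hρ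
  have hσρ : σ * σ = ρ := Real.mul_self_sqrt h0.le
  obtain ⟨A, hA0, hA⟩ := exists_linear_le_pow hσ
  refine Summable.of_norm_bounded (g := fun n => (C * A * D) * (σ⁻¹) ^ n)
    ((summable_geometric_of_lt_one (by positivity) (inv_lt_one_of_one_lt₀ hσ)).mul_left _) fun n => ?_
  have h1 : ‖coeff n f‖ ≤ D * (σ⁻¹) ^ n * (σ⁻¹) ^ n := by
    have := hD n
    rw [← le_div_iff₀ (by positivity), ← hσρ, mul_pow] at this
    rw [inv_pow]
    calc _ ≤ _ := this
      _ = _ := by field_simp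
  calc ‖w n * coeff n f‖ ≤ (C * (A * σ ^ n)) * (D * (σ⁻¹) ^ n * (σ⁻¹) ^ n) := by
        rw [norm_mul]
        exact mul_le_mul ((hw n).trans (by gcongr; exact hA n)) h1 (norm_nonneg _) (by positivity)
    _ = (C * A * D) * (σ⁻¹) ^ n * (σ * σ⁻¹) ^ n := by rw [mul_pow]; ring
    _ = _ := by rw [mul_inv_cancel₀ (by positivity)]; simp

end Growth
end

noncomputable section

/-! ### Overconvergence of Dwork's exponential -/

/-! ### Dwork's integrality lemma and the Artin-Hasse exponential -/

section DworkLemma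

variable {p : ℕ} [hp : Fact p.Prime]

/-- Over the prime field, raising to the power `p` is the substitution `X ↦ X ^ p`. -/
theorem norm_coeff_pow_sub_expand_le (P : Polynomial ℤ_[p]) (n : ℕ) :
    ‖(P ^ p - Polynomial.expand ℤ_[p] p P).coeff n‖ ≤ (p : ℝ)⁻¹ := by
  have h : (P ^ p - Polynomial.expand ℤ_[p] p P).coeff n ∈ IsLocalRing.maximalIdeal ℤ_[p] := by
    rw [← PadicInt.ker_toZMod, RingHom.mem_ker, ← Polynomial.coeff_map, Polynomial.map_sub,
      Polynomial.map_pow, Polynomial.map_expand, ZMod.expand_card, sub_self, Polynomial.coeff_zero]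
  rw [PadicInt.maximalIdeal_eq_span_p, ← pow_one (p : ℤ_[p]),
    ← PadicInt.norm_le_pow_iff_mem_span_pow] at h
  simpa using h

theorem norm_coeff_mul_le_of_forall_le {f g : PowerSeries ℚ_[p]} {n : ℕ} {c : ℝ} (hc : 0 ≤ c)
    (h : ∀ i j, i + j = n → ‖coeff i f‖ * ‖coeff j g‖ ≤ c) : ‖coeff n (f * g)‖ ≤ c := by
  rw [coeff_mul]
  refine IsUltrametricDist.norm_sum_le_of_forall_le_of_nonneg hc fun x hx => ?_
  rw [norm_mul]
  exact h _ _ (by simpa using hx)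

/-- Dwork's lemma, for the coefficients of degree less than `N`. -/
theorem norm_coeff_le_one_of_expand_eq {f h : PowerSeries ℚ_[p]} {N : ℕ}
    (hf0 : coeff 0 f = 1) (hh0 : coeff 0 h = 1)
    (hh : ∀ n, 0 < n → n < N → ‖coeff n h‖ ≤ (p : ℝ)⁻¹)
    (he : expand p hp.out.ne_zero f = f ^ p * h) :
    ∀ n < N, ‖coeff n f‖ ≤ 1 := by
  intro n
  induction n using Nat.strong_induction_on with
  | _ n ih =>
  intro hn
  rcases Nat.eq_zero_or_pos n with rfl | hn0
  · simp [hf0]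
  have hp0 : (0 : ℝ) < (p : ℝ)⁻¹ := inv_pos.mpr (by exact_mod_cast hp.out.pos)
  classical
  let lift : ℕ → ℤ_[p] := fun i => if hi : ‖coeff i f‖ ≤ 1 then ⟨coeff i f, hi⟩ else 0
  have hlift : ∀ i < n, ((lift i : ℤ_[p]) : ℚ_[p]) = coeff i f := fun i hi => by
    have h1 : ‖coeff i f‖ ≤ 1 := ih i hi (hi.trans hn)
    have h2 : lift i = ⟨coeff i f, h1⟩ := dif_pos h1
    rw [h2]
  -- `P` is the truncation of `f` below degree `n`, integral by induction; `F` is its image over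
  -- `ℚ_p`.
  let P : Polynomial ℤ_[p] := ∑ i ∈ Finset.range n, Polynomial.monomial i (lift i)
  have hP : ∀ i, P.coeff i = if i < n then lift i else 0 := fun i => by
    simp [P, Polynomial.finsetSum_coeff, Polynomial.coeff_monomial]
  let φ : ℤ_[p] →+* ℚ_[p] := PadicInt.Coe.ringHom
  let F : PowerSeries ℚ_[p] := ((P.map φ : Polynomial ℚ_[p]) : PowerSeries ℚ_[p])
  have hF : ∀ i, coeff i F = if i < n then coeff i f else 0 := fun i => by
    simp only [F, Polynomial.coeff_coe, Polynomial.coeff_map, hP]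
    split_ifs with h
    · exact hlift i h
    · simp
  obtain ⟨g, hg⟩ : X ^ n ∣ f - F := X_pow_dvd_iff.mpr fun m hm => by simp [hF, hm]
  have hg' : f = F + X ^ n * g := by rw [← hg]; ring
  have hg0 : coeff 0 g = coeff n f := by
    have := congrArg (coeff n) hg
    rw [map_sub, hF, if_neg (lt_irrefl n), sub_zero] at this
    rw [this]
    simpa using (coeff_X_pow_mul g n 0).symm
  obtain ⟨k, hk⟩ := Polynomial.powAddExpansion F (X ^ n * g) p
  have hF0 : coeff 0 F = 1 := by rw [hF, if_pos hn0, hf0]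
  have hFp : F ^ p = ((((P ^ p).map φ : Polynomial ℚ_[p])) : PowerSeries ℚ_[p]) := by
    simp [F, Polynomial.coe_pow]
  have hcoeff : ∀ i, coeff i (F ^ p) = ((P ^ p).coeff i : ℚ_[p]) := fun i => by
    rw [hFp, Polynomial.coeff_coe, Polynomial.coeff_map]; rfl
  -- Compare coefficients of degree `n` in `f(X ^ p) = f ^ p h` with `f = F + X ^ n g`. The unknown
  -- coefficient enters the right side only through `p F ^ (p - 1) X ^ n g`, as the quadratic
  -- remainder is divisible by `X ^ (2 n)` and `n ≥ 1`. It thus remains to see that everything else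
  -- is divisible by `p`.
  have key : (p : ℚ_[p]) * coeff n f
      = coeff n (expand p hp.out.ne_zero f) - coeff n (F ^ p) - coeff n (F ^ p * (h - 1)) := by
    rw [he]
    have e1 : f ^ p * h = F ^ p + F ^ p * (h - 1) + X ^ n * ((p : PowerSeries ℚ_[p]) * F ^ (p - 1) * g * h)
        + X ^ (n + 1) * (X ^ (n - 1) * k * g ^ 2 * h) := by
      have e2 : X ^ (n + 1) * X ^ (n - 1) = (X ^ n * X ^ n : PowerSeries ℚ_[p]) := by
        rw [← pow_add, ← pow_add]; congr 1; omega
      have e3 : X ^ (n + 1) * (X ^ (n - 1) * k * g ^ 2 * h) = X ^ n * X ^ n * (k * g ^ 2 * h) := by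
        rw [← e2]; ring
      rw [e3]
      conv_lhs => rw [hg', hk]
      ring
    have e4 : coeff n (X ^ (n + 1) * (X ^ (n - 1) * k * g ^ 2 * h)) = 0 :=
      X_pow_dvd_iff.mp (dvd_mul_right _ _) n (Nat.lt_succ_self n)
    have e5 : coeff n (X ^ n * ((p : PowerSeries ℚ_[p]) * F ^ (p - 1) * g * h)) = (p : ℚ_[p]) * coeff n f := by
      have := coeff_X_pow_mul ((p : PowerSeries ℚ_[p]) * F ^ (p - 1) * g * h) n 0
      rw [zero_add] at this
      rw [this, ← hg0]
      have c1 : constantCoeff F = 1 := by simpa using hF0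
      have c2 : constantCoeff h = 1 := by simpa using hh0
      simp [c1, c2]
    rw [e1, map_add, map_add, map_add, e4, e5]
    ring
  have b1 : ‖coeff n (expand p hp.out.ne_zero f) - coeff n (F ^ p)‖ ≤ (p : ℝ)⁻¹ := by
    have : coeff n (expand p hp.out.ne_zero f) - coeff n (F ^ p)
        = -(((P ^ p - Polynomial.expand ℤ_[p] p P).coeff n : ℤ_[p]) : ℚ_[p]) := by
      rw [hcoeff, Polynomial.coeff_sub, PadicInt.coe_sub, neg_sub, coeff_expand,
        Polynomial.coeff_expand hp.out.pos]
      congr 1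
      split_ifs with hd
      · have hlt : n / p < n := Nat.div_lt_self hn0 hp.out.one_lt
        rw [hP, if_pos hlt, hlift _ hlt]
      · simp
    rw [this, norm_neg, ← PadicInt.norm_def]
    exact norm_coeff_pow_sub_expand_le P n
  have b2 : ‖coeff n (F ^ p * (h - 1))‖ ≤ (p : ℝ)⁻¹ := by
    refine norm_coeff_mul_le_of_forall_le hp0.le fun i j hij => ?_
    rcases Nat.eq_zero_or_pos j with rfl | hj
    · rw [map_sub, hh0]; simp
    · have : coeff j (h - 1) = coeff j h := by
        rw [map_sub, coeff_one, if_neg hj.ne', sub_zero]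
      rw [this, hcoeff, ← PadicInt.norm_def, ← one_mul (p : ℝ)⁻¹]
      exact mul_le_mul (PadicInt.norm_le_one _) (hh j hj (by omega)) (norm_nonneg _) zero_le_one
  have b3 : ‖(p : ℚ_[p]) * coeff n f‖ ≤ (p : ℝ)⁻¹ := by
    rw [key, sub_eq_add_neg _ (coeff n (F ^ p * (h - 1)))]
    refine (IsUltrametricDist.norm_add_le_max _ _).trans (max_le b1 ?_)
    rwa [norm_neg]
  rw [norm_mul, Padic.norm_p] at b3
  exact le_of_mul_le_mul_left (by simpa using b3) hp0

theorem expand_rescale {R : Type*} [CommRing R] {m : ℕ} (hm : m ≠ 0) (a : R) (f : PowerSeries R) :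
    rescale a (expand m hm f) = expand m hm (rescale (a ^ m) f) := by
  ext n
  rw [coeff_rescale, coeff_expand, coeff_expand]
  split_ifs with h
  · obtain ⟨k, rfl⟩ := h
    rw [Nat.mul_div_cancel_left _ (Nat.pos_of_ne_zero hm), coeff_rescale, pow_mul]
  · simp

theorem rescale_exp_zero (R : Type*) [CommRing R] [Algebra ℚ R] :
    rescale (0 : R) (PowerSeries.exp R) = 1 := by simp

theorem rescale_exp_mul_neg {R : Type*} [CommRing R] [Algebra ℚ R] (a : R) :
    rescale a (PowerSeries.exp R) * rescale (-a) (PowerSeries.exp R) = 1 := by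
  rw [exp_mul_exp_eq_exp_add, add_neg_cancel, rescale_exp_zero]

/-- The factor `exp(X ^ (p ^ i) / p ^ i)` of the Artin-Hasse exponential. -/
def artinHasseFactor (p : ℕ) [hp : Fact p.Prime] (K : Type*) [Field K] [Algebra ℚ K] (i : ℕ) :
    PowerSeries K :=
  expand (p ^ i) (pow_ne_zero i hp.out.ne_zero) (rescale ((p : K) ^ i)⁻¹ (PowerSeries.exp K))

/-- The partial product `exp(X + X ^ p / p + ⋯ + X ^ (p ^ (k - 1)) / p ^ (k - 1))` of the Artin-Hasse
exponential. -/
def artinHassePartial (p : ℕ) [hp : Fact p.Prime] (K : Type*) [Field K] [Algebra ℚ K] (k : ℕ) :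
    PowerSeries K :=
  ∏ i ∈ Finset.range k, artinHasseFactor p K i

theorem constantCoeff_artinHasseFactor (K : Type*) [Field K] [Algebra ℚ K] (i : ℕ) :
    constantCoeff (artinHasseFactor p K i) = 1 := by
  rw [artinHasseFactor, constantCoeff_expand, ← coeff_zero_eq_constantCoeff_apply, coeff_rescale]
  simp

theorem coeff_zero_artinHassePartial (K : Type*) [Field K] [Algebra ℚ K] (k : ℕ) :
    coeff 0 (artinHassePartial p K k) = 1 := by
  simp [artinHassePartial, map_prod, constantCoeff_artinHasseFactor]

theorem expand_artinHasseFactor (i : ℕ) :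
    expand p hp.out.ne_zero (artinHasseFactor p ℚ_[p] i) = artinHasseFactor p ℚ_[p] (i + 1) ^ p := by
  have hp0 : (p : ℚ_[p]) ≠ 0 := by exact_mod_cast hp.out.ne_zero
  simp only [artinHasseFactor, ← map_pow, exp_pow_eq_rescale_exp, rescale_rescale]
  rw [← expand_mul]
  have : ((p : ℚ_[p]) ^ i)⁻¹ = p * ((p : ℚ_[p]) ^ (i + 1))⁻¹ := by
    field_simp; ring
  rw [this]
  congr 2
  · ring

/-- Substituting `X ^ p` turns each factor into the `p`-th power of the next one, so the product
telescopes and only the two end factors survive. -/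
theorem expand_artinHassePartial (k : ℕ) :
    expand p hp.out.ne_zero (artinHassePartial p ℚ_[p] (k + 1)) =
      artinHassePartial p ℚ_[p] (k + 1) ^ p *
        (rescale (-(p : ℚ_[p])) (PowerSeries.exp ℚ_[p]) * artinHasseFactor p ℚ_[p] (k + 1) ^ p) := by
  have h0 : artinHasseFactor p ℚ_[p] 0 ^ p * rescale (-(p : ℚ_[p])) (PowerSeries.exp ℚ_[p]) = 1 := by
    simp only [artinHasseFactor, ← map_pow, exp_pow_eq_rescale_exp, rescale_rescale]
    simp only [pow_zero, inv_one, mul_one]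
    rw [expand_one_apply, rescale_exp_mul_neg]
  have h1 : artinHassePartial p ℚ_[p] (k + 1) ^ p = (∏ i ∈ Finset.range k,
      artinHasseFactor p ℚ_[p] (i + 1) ^ p) * artinHasseFactor p ℚ_[p] 0 ^ p := by
    rw [artinHassePartial, ← Finset.prod_pow, Finset.prod_range_succ']
  rw [h1, artinHassePartial, map_prod]
  simp only [expand_artinHasseFactor]
  rw [Finset.prod_range_succ]
  calc _ = (∏ i ∈ Finset.range k, artinHasseFactor p ℚ_[p] (i + 1) ^ p) *
        artinHasseFactor p ℚ_[p] (k + 1) ^ p * (artinHasseFactor p ℚ_[p] 0 ^ p *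
        rescale (-(p : ℚ_[p])) (PowerSeries.exp ℚ_[p])) := by rw [h0, mul_one]
    _ = _ := by ring

theorem padicValNat_factorial_lt {n : ℕ} (hn : 0 < n) : padicValNat p n.factorial < n := by
  have h1 := sub_one_mul_padicValNat_factorial (p := p) n
  have h2 : (p.digits n).sum ≠ 0 := by
    intro h
    have h3 : ∀ d ∈ p.digits n, d = 0 := fun d hd =>
      Nat.eq_zero_of_le_zero (h ▸ List.single_le_sum (by simp) d hd)
    have h4 := Nat.getLast_digit_ne_zero p hn.ne'
    exact h4 (h3 _ (List.getLast_mem _))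
  have h5 : 1 ≤ p - 1 := Nat.le_sub_one_of_lt hp.out.one_lt
  have h6 : padicValNat p n.factorial ≤ (p - 1) * padicValNat p n.factorial :=
    Nat.le_mul_of_pos_left _ h5
  omega

/-- For `n > 0` the digit sum is positive, so `v(n!) < n` and `p ^ n / n!` is divisible by `p`. -/
theorem norm_coeff_rescale_exp_le {n : ℕ} (hn : 0 < n) :
    ‖coeff n (rescale (-(p : ℚ_[p])) (PowerSeries.exp ℚ_[p]))‖ ≤ (p : ℝ)⁻¹ := by
  have hp0 : (p : ℝ) ≠ 0 := by exact_mod_cast hp.out.ne_zero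
  have hp1 : (1 : ℝ) ≤ p := by exact_mod_cast hp.out.one_lt.le
  rw [coeff_rescale, coeff_exp, norm_mul, norm_pow, norm_neg, Padic.norm_p, map_div₀, norm_div]
  simp only [map_one, norm_one, map_natCast]
  rw [Padic.norm_eq_zpow_neg_valuation (by exact_mod_cast n.factorial_ne_zero),
    Padic.valuation_natCast, ← zpow_natCast, inv_zpow', one_div, ← zpow_neg, ← zpow_add₀ hp0,
    ← zpow_neg_one]
  apply zpow_le_zpow_right₀ hp1
  have := padicValNat_factorial_lt (p := p) hn
  omega

/-- Dwork's lemma applies below degree `p ^ (k + 1)` because the surviving last factor is a series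
in `X ^ (p ^ (k + 1))`, hence equals `1` in that range. Working with finite products avoids the
infinite Artin-Hasse product. -/
theorem norm_coeff_artinHassePartial_le_one {k n : ℕ} (hn : n < p ^ (k + 1)) :
    ‖coeff n (artinHassePartial p ℚ_[p] (k + 1))‖ ≤ 1 := by
  have hB : ∀ j, 0 < j → j < p ^ (k + 1) → coeff j (artinHasseFactor p ℚ_[p] (k + 1) ^ p) = 0 := by
    intro j hj hjn
    rw [artinHasseFactor, ← map_pow]
    exact coeff_expand_of_not_dvd _ _ _ (Nat.not_dvd_of_pos_of_lt hj hjn)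
  have hB0 : coeff 0 (artinHasseFactor p ℚ_[p] (k + 1) ^ p) = 1 := by
    simp [constantCoeff_artinHasseFactor]
  refine norm_coeff_le_one_of_expand_eq (coeff_zero_artinHassePartial _ _) ?_ ?_
    (expand_artinHassePartial k) n hn
  · rw [coeff_zero_eq_constantCoeff_apply, map_mul, map_pow, constantCoeff_artinHasseFactor,
      ← coeff_zero_eq_constantCoeff_apply, coeff_rescale]
    simp
  · intro m hm hmN
    refine norm_coeff_mul_le_of_forall_le (inv_nonneg.mpr (Nat.cast_nonneg p)) fun i j hij => ?_
    rcases Nat.eq_zero_or_pos j with rfl | hj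
    · rw [hB0, norm_one, mul_one]
      exact norm_coeff_rescale_exp_le (by omega)
    · rw [hB j hj (by omega)]; simp

end DworkLemma

/-! ### Radius of convergence of Dwork's exponential -/

section Overconvergence

variable {p : ℕ} [hp : Fact p.Prime] {ϖ : ℂ_[p]}

theorem coeffBound_rescale_exp (hϖ : ϖ ^ (p - 1) = -(p : ℂ_[p])) {a : ℂ_[p]} {r : ℝ} (hr : 0 ≤ r)
    (ha : ‖a‖ * r ≤ ‖ϖ‖) : CoeffBound (rescale a (PowerSeries.exp ℂ_[p])) r 1 := by
  intro n
  have h1 : coeff n (rescale a (PowerSeries.exp ℂ_[p])) = a ^ n / (n.factorial : ℂ_[p]) := by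
    rw [coeff_rescale, coeff_exp]; simp [div_eq_mul_inv]
  have h2 : (0 : ℝ) < ‖(n.factorial : ℂ_[p])‖ :=
    norm_pos_iff.mpr (by exact_mod_cast n.factorial_ne_zero)
  rw [h1, norm_div, norm_pow, div_mul_eq_mul_div, div_le_one h2, ← mul_pow]
  exact (pow_le_pow_left₀ (by positivity) ha n).trans (norm_unif_pow_le_norm_factorial hϖ n)

/-- The recursion for the coefficients of an inverse series preserves the bound, by the ultrametric
inequality. -/
theorem CoeffBound.inverse {f g : PowerSeries ℂ_[p]} {r : ℝ} (hr : 0 ≤ r) (hf : CoeffBound f r 1)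
    (hf0 : coeff 0 f = 1) (hfg : f * g = 1) : CoeffBound g r 1 := by
  have h0 : coeff 0 g = 1 := by
    have := congrArg (coeff 0) hfg
    rw [coeff_zero_eq_constantCoeff_apply, map_mul, ← coeff_zero_eq_constantCoeff_apply,
      ← coeff_zero_eq_constantCoeff_apply, hf0, one_mul, coeff_zero_one] at this
    exact this
  intro n
  induction n using Nat.strong_induction_on with
  | _ n ih =>
  rcases Nat.eq_zero_or_pos n with rfl | hn
  · simp [h0]
  have h1 := congrArg (coeff n) hfg
  rw [coeff_mul, coeff_one, if_neg hn.ne', Finset.Nat.sum_antidiagonal_eq_sum_range_succ_mk,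
    Finset.sum_range_succ'] at h1
  simp only [hf0, one_mul, Nat.sub_zero] at h1
  rw [eq_neg_of_add_eq_zero_right h1, norm_neg]
  obtain ⟨i, hi, hle⟩ := IsUltrametricDist.exists_norm_finsetSum_le
    (Finset.range n) (fun i : ℕ => coeff (i + 1) f * coeff (n - (i + 1)) g)
  have hi' : i < n := by simpa using hi (by simp [hn.ne'])
  have hin : (i + 1) + (n - (i + 1)) = n := by omega
  calc _ ≤ ‖coeff (i + 1) f * coeff (n - (i + 1)) g‖ * r ^ n := by gcongr
    _ = (‖coeff (i + 1) f‖ * r ^ (i + 1)) * (‖coeff (n - (i + 1)) g‖ * r ^ (n - (i + 1))) := by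
        conv_lhs => rw [← hin, norm_mul, pow_add, hin]
        ring
    _ ≤ 1 * 1 := mul_le_mul (hf _) (ih _ (by omega)) (by positivity) zero_le_one
    _ = 1 := one_mul 1

theorem map_artinHasseFactor {K L : Type*} [Field K] [Algebra ℚ K] [Field L] [Algebra ℚ L]
    (f : K →+* L) (i : ℕ) :
    PowerSeries.map f (artinHasseFactor p K i) = artinHasseFactor p L i := by
  rw [artinHasseFactor, artinHasseFactor, map_expand, ← rescale_map, map_exp]
  simp

theorem norm_coeff_artinHassePartial_le_one' {k n : ℕ} (hn : n < p ^ (k + 1)) :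
    ‖coeff n (artinHassePartial p ℂ_[p] (k + 1))‖ ≤ 1 := by
  have : artinHassePartial p ℂ_[p] (k + 1) =
      PowerSeries.map (algebraMap ℚ_[p] ℂ_[p]) (artinHassePartial p ℚ_[p] (k + 1)) := by
    simp only [artinHassePartial, map_prod, map_artinHasseFactor]
  rw [this, coeff_map, PadicComplex.norm_algebraMap]
  exact norm_coeff_artinHassePartial_le_one hn

/-- This is the condition for the Artin-Hasse factor of index `i + 2` to be bounded by `1` at radius
`r`. Once it holds at index `2`, taking `p`-th powers propagates it. -/
theorem pow_prime_pow_le (hϖ : ϖ ^ (p - 1) = -(p : ℂ_[p])) {r : ℝ} (hr : 0 ≤ r)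
    (h : r ^ p ^ 2 = ((p : ℝ)⁻¹) ^ 2 * ‖ϖ‖) (i : ℕ) :
    r ^ p ^ (i + 2) ≤ ((p : ℝ)⁻¹) ^ (i + 2) * ‖ϖ‖ := by
  have hp1 : (p : ℝ)⁻¹ ≤ 1 := inv_le_one_of_one_le₀ (by exact_mod_cast hp.out.one_lt.le)
  have hp0 : 0 ≤ (p : ℝ)⁻¹ := by positivity
  induction i with
  | zero => exact h.le
  | succ i ih =>
    calc r ^ p ^ (i + 1 + 2) = (r ^ p ^ (i + 2)) ^ p := by rw [← pow_mul]; ring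
      _ ≤ (((p : ℝ)⁻¹) ^ (i + 2) * ‖ϖ‖) ^ p := by gcongr
      _ = ((p : ℝ)⁻¹) ^ ((i + 2) * p) * ‖ϖ‖ ^ p := by rw [mul_pow, ← pow_mul]
      _ ≤ ((p : ℝ)⁻¹) ^ (i + 1 + 2) * ‖ϖ‖ ^ 1 := by
          apply mul_le_mul
          · apply pow_le_pow_of_le_one hp0 hp1
            have := hp.out.two_le
            nlinarith
          · exact pow_le_pow_of_le_one (norm_nonneg _) (norm_unif_lt_one hϖ).le hp.out.one_lt.le
          · positivity
          · positivity
      _ = _ := by rw [pow_one]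

/-- The two-factor product is a longer partial product, with integral coefficients in low degrees,
times the inverses of the extra factors. Each inverse is bounded by `1` at radius `r`. -/
theorem coeffBound_artinHassePartial_two (hϖ : ϖ ^ (p - 1) = -(p : ℂ_[p])) {r : ℝ} (hr : 0 ≤ r)
    (h : r ^ p ^ 2 = ((p : ℝ)⁻¹) ^ 2 * ‖ϖ‖) :
    CoeffBound (artinHassePartial p ℂ_[p] 2) r 1 := by
  have hr1 : r ≤ 1 := by
    by_contra! hc
    have h1 := one_le_pow₀ (n := p ^ 2) hc.le
    have h2 : ((p : ℝ)⁻¹) ^ 2 * ‖ϖ‖ < 1 := by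
      have hp1 : (p : ℝ)⁻¹ ≤ 1 := inv_le_one_of_one_le₀ (by exact_mod_cast hp.out.one_lt.le)
      calc _ ≤ 1 * ‖ϖ‖ := by gcongr; exact pow_le_one₀ (by positivity) hp1
        _ < 1 := by rw [one_mul]; exact norm_unif_lt_one hϖ
    linarith
  set I : ℕ → PowerSeries ℂ_[p] := fun i =>
    expand (p ^ i) (pow_ne_zero i hp.out.ne_zero)
      (rescale (-((p : ℂ_[p]) ^ i)⁻¹) (PowerSeries.exp ℂ_[p])) with hI
  have hI1 : ∀ i, artinHasseFactor p ℂ_[p] i * I i = 1 := fun i => by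
    rw [artinHasseFactor, hI, ← map_mul, rescale_exp_mul_neg, map_one]
  have hIb : ∀ i, CoeffBound (I (i + 2)) r 1 := fun i => by
    refine CoeffBound.expand _ (coeffBound_rescale_exp hϖ (by positivity) ?_)
    rw [norm_neg, norm_inv, norm_pow, PadicComplex.norm_p]
    have hp0 : (0 : ℝ) < p := by exact_mod_cast hp.out.pos
    calc _ ≤ (((p : ℝ)⁻¹) ^ (i + 2))⁻¹ * (((p : ℝ)⁻¹) ^ (i + 2) * ‖ϖ‖) := by
          gcongr; exact pow_prime_pow_le hϖ hr h i
      _ = _ := by field_simp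
  intro j
  -- The number of factors grows with `j`, so that every degree `a ≤ j` lies in the range of
  -- integrality `a < p ^ (j + 2)`.
  have hprod : artinHassePartial p ℂ_[p] 2 =
      artinHassePartial p ℂ_[p] (j + 1 + 1) * ∏ i ∈ Finset.range j, I (i + 2) := by
    have : artinHassePartial p ℂ_[p] (j + 1 + 1) = artinHassePartial p ℂ_[p] 2 *
        ∏ i ∈ Finset.range j, artinHasseFactor p ℂ_[p] (i + 2) := by
      rw [artinHassePartial, artinHassePartial, show j + 1 + 1 = 2 + j by ring, Finset.prod_range_add]
      simp only [add_comm 2]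
    rw [this, mul_assoc, ← Finset.prod_mul_distrib]
    simp [hI1]
  have hQ := CoeffBound.prod (s := Finset.range j) hr (fun i _ => hIb i)
  rw [hprod, coeff_mul]
  obtain ⟨⟨a, b⟩, hab, hle⟩ := IsUltrametricDist.exists_norm_finsetSum_le
    (Finset.HasAntidiagonal.antidiagonal j) (fun x : ℕ × ℕ =>
      coeff x.1 (artinHassePartial p ℂ_[p] (j + 1 + 1)) *
        coeff x.2 (∏ i ∈ Finset.range j, I (i + 2)))
  have hab' : a + b = j := by simpa using hab ⟨(0, j), by simp⟩
  have ha : a < p ^ (j + 1 + 1) :=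
    lt_of_le_of_lt (by omega : a ≤ j + 1 + 1) (Nat.lt_pow_self hp.out.one_lt)
  calc _ ≤ ‖coeff a (artinHassePartial p ℂ_[p] (j + 1 + 1)) *
        coeff b (∏ i ∈ Finset.range j, I (i + 2))‖ * r ^ j := by gcongr
    _ = (‖coeff a (artinHassePartial p ℂ_[p] (j + 1 + 1))‖ * r ^ a) *
        (‖coeff b (∏ i ∈ Finset.range j, I (i + 2))‖ * r ^ b) := by
        rw [norm_mul, ← hab', pow_add]; ring
    _ ≤ 1 * 1 := by
        refine mul_le_mul ?_ (hQ b) (by positivity) zero_le_one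
        exact mul_le_one₀ (norm_coeff_artinHassePartial_le_one' ha) (by positivity)
          (pow_le_one₀ hr hr1)
    _ = 1 := one_mul 1

/-- The choice of `ϖ` enters through `ϖ ^ p / p = -ϖ`, which turns `X + X ^ p / p` at `ϖ t` into `ϖ
(t - t ^ p)`. -/
theorem rescale_artinHassePartial_two (hϖ : ϖ ^ (p - 1) = -(p : ℂ_[p])) :
    rescale ϖ (artinHassePartial p ℂ_[p] 2) = dworkExp p ϖ := by
  have hp0 : (p : ℂ_[p]) ≠ 0 := by exact_mod_cast hp.out.ne_zero
  have h : ϖ ^ p * ((p : ℂ_[p]))⁻¹ = -ϖ := by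
    have : ϖ ^ p = ϖ ^ (p - 1) * ϖ := by
      rw [← pow_succ, Nat.sub_add_cancel hp.out.one_lt.le]
    rw [this, hϖ]; field_simp
  rw [artinHassePartial, Finset.prod_range_succ, Finset.prod_range_one, map_mul, dworkExp]
  congr 1
  · rw [artinHasseFactor]
    simp only [pow_zero, inv_one]
    rw [expand_one_apply, rescale_one]; rfl
  · rw [artinHasseFactor]
    simp only [pow_one]
    rw [expand_rescale, rescale_rescale, mul_comm, h]

theorem dworkExp_mul_neg (a : ℂ_[p]) : dworkExp p a * dworkExp p (-a) = 1 := by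
  rw [dworkExp, dworkExp, mul_mul_mul_comm, rescale_exp_mul_neg, ← map_mul, rescale_exp_mul_neg]
  simp

theorem coeff_zero_dworkExp (a : ℂ_[p]) : coeff 0 (dworkExp p a) = 1 := by
  rw [dworkExp, coeff_zero_eq_constantCoeff_apply, map_mul, constantCoeff_expand,
    ← coeff_zero_eq_constantCoeff_apply, ← coeff_zero_eq_constantCoeff_apply, coeff_rescale,
    coeff_rescale]
  simp

theorem exists_coeffBound_dworkExp (hϖ : ϖ ^ (p - 1) = -(p : ℂ_[p])) :
    ∃ R : ℝ, 1 < R ∧ CoeffBound (dworkExp p ϖ) R 1 ∧ CoeffBound (dworkExp p (-ϖ)) R 1 := by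
  have hϖ0 := norm_unif_pos hϖ
  have hp0 : (0 : ℝ) < p := by exact_mod_cast hp.out.pos
  have hp1 : (1 : ℝ) < p := by exact_mod_cast hp.out.one_lt
  have hpp : p ^ 2 ≠ 0 := pow_ne_zero 2 hp.out.ne_zero
  set r : ℝ := (((p : ℝ)⁻¹) ^ 2 * ‖ϖ‖) ^ (((p ^ 2 : ℕ) : ℝ)⁻¹) with hr
  have hr0 : 0 ≤ r := by positivity
  have hrp : r ^ p ^ 2 = ((p : ℝ)⁻¹) ^ 2 * ‖ϖ‖ := Real.rpow_inv_natCast_pow (by positivity) hpp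
  -- Since `p ^ 2 = (p - 1)(p + 1) + 1`, one has `‖ϖ‖ ^ (p ^ 2) = p ^ (-(p + 1)) ‖ϖ‖`, which is
  -- below `p ^ (-2) ‖ϖ‖`. So after rescaling by `ϖ` the radius `r / ‖ϖ‖` exceeds `1`.
  have hlt : ‖ϖ‖ < r := by
    refine lt_of_pow_lt_pow_left₀ (p ^ 2) hr0 ?_
    rw [hrp]
    have e : p ^ 2 = (p - 1) * (p + 1) + 1 := by
      have := hp.out.one_lt
      obtain ⟨q, rfl⟩ : ∃ q, p = q + 1 := ⟨p - 1, by omega⟩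
      simp; ring
    rw [e, pow_succ, pow_mul, norm_unif_pow hϖ]
    have : ((p : ℝ)⁻¹) ^ (p + 1) < ((p : ℝ)⁻¹) ^ 2 :=
      pow_lt_pow_right_of_lt_one₀ (by positivity) (inv_lt_one_of_one_lt₀ hp1)
        (by have := hp.out.one_lt; omega)
    gcongr
  have hb : CoeffBound (dworkExp p ϖ) (r / ‖ϖ‖) 1 := by
    rw [← rescale_artinHassePartial_two hϖ]
    refine CoeffBound.rescale ?_
    rw [mul_div_cancel₀ _ hϖ0.ne']
    exact coeffBound_artinHassePartial_two hϖ hr0 hrp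
  exact ⟨r / ‖ϖ‖, (one_lt_div hϖ0).mpr hlt, hb,
    hb.inverse (by positivity) (coeff_zero_dworkExp ϖ) (dworkExp_mul_neg ϖ)⟩

theorem dworkExp_mem_dagger (hϖ : ϖ ^ (p - 1) = -(p : ℂ_[p])) : dworkExp p ϖ ∈ dagger p := by
  obtain ⟨R, hR, h, -⟩ := exists_coeffBound_dworkExp hϖ
  exact ⟨R, hR, 1, h⟩

theorem dworkExp_neg_mem_dagger (hϖ : ϖ ^ (p - 1) = -(p : ℂ_[p])) :
    dworkExp p (-ϖ) ∈ dagger p := by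
  obtain ⟨R, hR, -, h⟩ := exists_coeffBound_dworkExp hϖ
  exact ⟨R, hR, 1, h⟩

end Overconvergence
end

noncomputable section

/-! ### Fibres of the overconvergent GKZ module -/

section Euler

/-- The Euler operator `X d/dX` on power series. -/
def eulerOp {R : Type*} [CommRing R] (f : PowerSeries R) : PowerSeries R :=
  X * PowerSeries.derivative R f

variable {R : Type*} [CommRing R]

theorem coeff_eulerOp (f : PowerSeries R) (n : ℕ) : coeff n (eulerOp f) = n * coeff n f := by
  cases n with
  | zero => simp [eulerOp]
  | succ n => rw [eulerOp, coeff_succ_X_mul, coeff_derivative]; push_cast; ring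

theorem eulerOp_mul (f g : PowerSeries R) :
    eulerOp (f * g) = eulerOp f * g + f * eulerOp g := by
  simp only [eulerOp, Derivation.leibniz, smul_eq_mul]; ring

theorem eulerOp_X_pow (n : ℕ) : eulerOp (X ^ n : PowerSeries R) = (n : PowerSeries R) * X ^ n := by
  ext k
  rw [coeff_eulerOp, ← map_natCast (C (R := R)), coeff_C_mul, coeff_X_pow]
  split_ifs with h
  · rw [h]
  · simp

theorem eulerOp_expand {m : ℕ} (hm : m ≠ 0) (f : PowerSeries R) :
    eulerOp (expand m hm f) = (m : PowerSeries R) * expand m hm (eulerOp f) := by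
  ext k
  rw [coeff_eulerOp, ← map_natCast (C (R := R)), coeff_C_mul, coeff_expand, coeff_expand]
  split_ifs with h
  · obtain ⟨j, rfl⟩ := h
    rw [Nat.mul_div_cancel_left _ (Nat.pos_of_ne_zero hm), coeff_eulerOp]
    push_cast; ring
  · simp

theorem eulerOp_rescale (a : R) (f : PowerSeries R) :
    eulerOp (rescale a f) = rescale a (eulerOp f) := by
  ext k
  simp only [coeff_eulerOp, coeff_rescale]; ring

theorem eulerOp_rescale_exp [Algebra ℚ R] (a : R) :
    eulerOp (rescale a (PowerSeries.exp R)) = C a * X * rescale a (PowerSeries.exp R) := by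
  rw [eulerOp_rescale, eulerOp, derivative_exp, map_mul, rescale_X]

end Euler

variable {p : ℕ} [hp : Fact p.Prime]

theorem eulerOp_dworkExp (a : ℂ_[p]) :
    eulerOp (dworkExp p a) = (C a * X - C (p * a) * X ^ p) * dworkExp p a := by
  rw [dworkExp, eulerOp_mul, eulerOp_expand, eulerOp_rescale_exp, eulerOp_rescale_exp,
    map_mul, map_mul, expand_C, expand_X, map_neg, map_mul, map_natCast]
  ring

theorem dworkOp_apply (ϖ δ s : ℂ_[p]) (f : PowerSeries ℂ_[p]) :
    dworkOp ϖ δ s f = eulerOp f + C δ * f + C (ϖ * s) * (X ^ 1 * f) := by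
  simp only [dworkOp, eulerOp, LinearMap.add_apply, LinearMap.comp_apply, LinearMap.smul_apply,
    LinearMap.mulLeft_apply, LinearMap.id_apply, smul_eq_C_mul, pow_one]
  rfl

/-! ### Functionals on overconvergent series -/

theorem tsum_mul_coeff_X_pow_mul {f : PowerSeries ℂ_[p]} (hf : f ∈ dagger p) {w : ℕ → ℂ_[p]} {C : ℝ}
    (hw : ∀ n, ‖w n‖ ≤ C * (n + 1)) (m : ℕ) :
    ∑' n, w n * coeff n (X ^ m * f) = ∑' n, w (n + m) * coeff n f := by
  rw [← (summable_mul_coeff (mul_mem_dagger (X_pow_mem_dagger m) hf) hw).sum_add_tsum_nat_add m,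
    Finset.sum_eq_zero, zero_add]
  · simp only [coeff_X_pow_mul]
  · intro i hi
    rw [coeff_X_pow_mul', if_neg (by simpa using hi), mul_zero]

theorem norm_shift_le {w : ℕ → ℂ_[p]} {C : ℝ} (hw : ∀ n, ‖w n‖ ≤ C * (n + 1)) (m : ℕ) (n : ℕ) :
    ‖w (n + m)‖ ≤ C * (m + 1) * (n + 1) := by
  have hC : 0 ≤ C := by simpa using (norm_nonneg _).trans (hw 0)
  refine (hw _).trans ?_
  rw [mul_assoc]
  gcongr
  push_cast
  nlinarith [mul_nonneg (Nat.cast_nonneg (α := ℝ) m) (Nat.cast_nonneg (α := ℝ) n)]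

/-- A functional whose weights satisfy the recursion dual to `X d/dX + d + c X ^ m` kills its image. -/
theorem tsum_mul_coeff_eulerOp_eq_zero {f : PowerSeries ℂ_[p]} (hf : f ∈ dagger p)
    {w : ℕ → ℂ_[p]} {B : ℝ} (hw : ∀ n, ‖w n‖ ≤ B * (n + 1)) {d c : ℂ_[p]} {m : ℕ}
    (hrec : ∀ n : ℕ, (n + d) * w n + c * w (n + m) = 0) :
    ∑' n, w n * coeff n (eulerOp f + C d * f + C c * (X ^ m * f)) = 0 := by
  have h1 := (summable_mul_coeff hf (norm_shift_le hw m)).mul_left c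
  have h2 := (summable_mul_coeff (mul_mem_dagger (X_pow_mem_dagger m) hf) hw).mul_left c
  have h3 : ∀ n : ℕ, w n * ((n + d) * coeff n f) = -(c * (w (n + m) * coeff n f)) := fun n => by
    linear_combination coeff n f * hrec n
  have h4 : ∀ n : ℕ, w n * coeff n (eulerOp f + C d * f + C c * (X ^ m * f))
      = -(c * (w (n + m) * coeff n f)) + c * (w n * coeff n (X ^ m * f)) := fun n => by
    rw [← h3, map_add, map_add, coeff_eulerOp, coeff_C_mul, coeff_C_mul]
    ring
  simp_rw [h4]
  rw [h1.neg.tsum_add h2, tsum_neg, tsum_mul_left, tsum_mul_left, tsum_mul_coeff_X_pow_mul hf hw,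
    neg_add_cancel]

theorem tsum_mul_coeff_one (w : ℕ → ℂ_[p]) : ∑' n, w n * coeff n (1 : PowerSeries ℂ_[p]) = w 0 := by
  rw [tsum_eq_single 0]
  · simp
  · intro n hn
    rw [coeff_one, if_neg hn, mul_zero]

/-- The weights `(δ)_k / (-ϖ s) ^ k` of the functional that vanishes on the image of `D_δ`. -/
def dworkWeight (ϖ δ s : ℂ_[p]) (k : ℕ) : ℂ_[p] := risingFactorial δ k / (-(ϖ * s)) ^ k

/-! ### The dual functional and the rank of the fibre -/

section Weights

variable {ϖ s : ℂ_[p]} (hϖ : ϖ ^ (p - 1) = -(p : ℂ_[p])) (hs : ‖s‖ = 1)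

include hs in
theorem norm_ne_zero_of_norm_eq_one : s ≠ 0 := by
  rintro rfl; simp at hs

include hϖ hs

theorem unif_mul_ne_zero : ϖ * s ≠ 0 :=
  mul_ne_zero (unif_ne_zero hϖ) (norm_ne_zero_of_norm_eq_one hs)

theorem norm_dworkWeight_le (d : ℤ_[p]) (n : ℕ) :
    ‖dworkWeight ϖ (padicIntCast p d) s n‖ ≤ p * (n + 1) := by
  rw [dworkWeight, norm_div, norm_pow, norm_neg, norm_mul, hs, mul_one]
  exact norm_risingFactorial_div_le hϖ d n

theorem dworkWeight_rec (δ : ℂ_[p]) (n : ℕ) :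
    (n + δ) * dworkWeight ϖ δ s n + ϖ * s * dworkWeight ϖ δ s (n + 1) = 0 := by
  have h2 : -(ϖ * s) ≠ 0 := neg_ne_zero.mpr (unif_mul_ne_zero hϖ hs)
  rw [dworkWeight, dworkWeight, risingFactorial_succ, pow_succ]
  generalize hc : -(ϖ * s) = c at *
  rw [← neg_neg (ϖ * s), hc]
  field_simp
  ring

theorem tsum_dworkWeight_dworkOp {f : PowerSeries ℂ_[p]} (hf : f ∈ dagger p) (d : ℤ_[p]) :
    ∑' n, dworkWeight ϖ (padicIntCast p d) s n * coeff n (dworkOp ϖ (padicIntCast p d) s f) = 0 := by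
  rw [dworkOp_apply]
  exact tsum_mul_coeff_eulerOp_eq_zero hf (norm_dworkWeight_le hϖ hs d)
    (dworkWeight_rec hϖ hs _)

theorem dworkWeight_succ' (δ : ℂ_[p]) (j : ℕ) :
    dworkWeight ϖ δ s (j + 1) = δ / (-(ϖ * s)) * dworkWeight ϖ (δ + 1) s j := by
  have h2 : -(ϖ * s) ≠ 0 := neg_ne_zero.mpr (unif_mul_ne_zero hϖ hs)
  rw [dworkWeight, dworkWeight, risingFactorial_succ', pow_succ]
  field_simp

/-- The equation `D_δ g = f` is a first-order recursion, solved here from infinity: `g_k` is a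
multiple of a weighted tail sum of `f`. Tail sums decay like `ρ ^ (-k)`, so `g` is overconvergent,
and the only obstruction is the equation in degree `0`, which is the hypothesis. -/
theorem exists_dworkOp_eq {f : PowerSeries ℂ_[p]} (hf : f ∈ dagger p) (d : ℤ_[p])
    (h : ∑' n, dworkWeight ϖ (padicIntCast p d) s n * coeff n f = 0) :
    ∃ g ∈ dagger p, dworkOp ϖ (padicIntCast p d) s g = f := by
  have hne := unif_mul_ne_zero hϖ hs
  obtain ⟨ρ, hρ, D, hD⟩ := id hf
  have hD' : CoeffBound f ρ D := hD
  have hD0 := hD'.nonneg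
  have hρ0 : 0 < ρ := by linarith
  obtain ⟨A, hA0, hA⟩ := exists_linear_le_pow hρ
  set δ := padicIntCast p d with hδ
  have hcast : ∀ k : ℕ, δ + k = padicIntCast p (d + k) := fun k => by
    rw [map_add, map_natCast]
  -- `S k` is the functional for `δ + k` applied to the tail of `f` starting at degree `k`; the
  -- hypothesis says `S 0 = 0`.
  set S : ℕ → ℂ_[p] := fun k => ∑' j, dworkWeight ϖ (δ + k) s j * coeff (k + j) f with hS
  have hle : ∀ k j : ℕ, ‖dworkWeight ϖ (δ + k) s j * coeff (k + j) f‖ ≤ p * A * D * (ρ⁻¹) ^ k := by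
    intro k j
    rw [norm_mul, hcast]
    have h1 : ‖coeff (k + j) f‖ ≤ D / ρ ^ (k + j) := (le_div_iff₀ (by positivity)).mpr (hD _)
    calc _ ≤ (p * (A * ρ ^ j)) * (D / ρ ^ (k + j)) := by
          refine mul_le_mul ((norm_dworkWeight_le hϖ hs _ j).trans ?_) h1 (norm_nonneg _)
            (by positivity)
          gcongr; exact hA j
      _ = _ := by rw [inv_pow, pow_add]; field_simp
  have hSle : ∀ k, ‖S k‖ ≤ p * A * D * (ρ⁻¹) ^ k := fun k =>
    (IsUltrametricDist.norm_tsum_le _).trans (ciSup_le (hle k))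
  have hsum : ∀ k : ℕ, Summable fun j => dworkWeight ϖ (δ + k) s j * coeff (k + j) f := by
    intro k
    have hmem : (mk fun j => coeff (k + j) f) ∈ dagger p := by
      refine ⟨ρ, hρ, D * (ρ⁻¹) ^ k, fun j => ?_⟩
      rw [coeff_mk]
      have h1 : ‖coeff (k + j) f‖ ≤ D / ρ ^ (k + j) := (le_div_iff₀ (by positivity)).mpr (hD _)
      calc _ ≤ D / ρ ^ (k + j) * ρ ^ j := by gcongr
        _ = _ := by rw [inv_pow, pow_add]; field_simp
    rw [hcast]
    simpa using summable_mul_coeff hmem (norm_dworkWeight_le hϖ hs (d + k))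
  have hSrec : ∀ k : ℕ, S k = coeff k f - (δ + k) / (ϖ * s) * S (k + 1) := by
    intro k
    simp only [hS]
    rw [(hsum k).tsum_eq_zero_add, ← tsum_mul_left, sub_eq_add_neg, ← tsum_neg]
    congr 1
    · simp [dworkWeight, risingFactorial]
    · refine tsum_congr fun j => ?_
      rw [dworkWeight_succ' hϖ hs, Nat.cast_succ, ← add_assoc, ← add_assoc, add_right_comm k j 1,
        div_neg]
      ring
  have hS0 : S 0 = 0 := by simpa [hS] using h
  refine ⟨mk fun k => (ϖ * s)⁻¹ * S (k + 1), ?_, ?_⟩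
  · refine ⟨ρ, hρ, ‖(ϖ * s)⁻¹‖ * (p * A * D * ρ⁻¹), fun k => ?_⟩
    rw [coeff_mk, norm_mul, mul_assoc]
    refine mul_le_mul_of_nonneg_left ?_ (norm_nonneg _)
    calc _ ≤ p * A * D * (ρ⁻¹) ^ (k + 1) * ρ ^ k := by gcongr; exact hSle _
      _ = _ := by rw [inv_pow, pow_succ]; field_simp
  · ext k
    rw [dworkOp_apply, map_add, map_add, coeff_eulerOp, coeff_C_mul, coeff_C_mul, pow_one, coeff_mk]
    cases k with
    | zero =>
      have := hSrec 0
      rw [hS0] at this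
      rw [coeff_zero_X_mul]
      simp only [Nat.cast_zero, zero_mul, mul_zero, add_zero, zero_add] at this ⊢
      rw [eq_comm, sub_eq_zero] at this
      rw [this]; field_simp
    | succ k =>
      rw [coeff_succ_X_mul, coeff_mk, hSrec (k + 1), mul_inv_cancel_left₀ hne]
      ring

omit hϖ hs in
theorem DworkFibre.mk_eq_smul_one {δ : ℂ_[p]} {f : ↥(dagger p)} {c : ℂ_[p]} :
    DworkFibre.mk ϖ δ s f = c • DworkFibre.one ϖ δ s ↔
      ∃ g ∈ dagger p, dworkOp ϖ δ s g = (f : PowerSeries ℂ_[p]) - c • 1 := by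
  have : c • DworkFibre.one ϖ δ s = DworkFibre.mk ϖ δ s (c • ⟨1, one_mem_dagger p⟩) := rfl
  rw [this, DworkFibre.mk, DworkFibre.mk, Submodule.Quotient.eq]
  rfl

/-- The functional kills exactly the relations and takes the value `1` on `1`, so it computes the
coordinate in the basis given by the class of `1`. -/
theorem DworkFibre.mk_eq_smul_one_iff {d : ℤ_[p]} {f : ↥(dagger p)} {c : ℂ_[p]} :
    DworkFibre.mk ϖ (padicIntCast p d) s f = c • DworkFibre.one ϖ (padicIntCast p d) s ↔
      ∑' n, dworkWeight ϖ (padicIntCast p d) s n * coeff n (f : PowerSeries ℂ_[p]) = c := by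
  rw [DworkFibre.mk_eq_smul_one]
  have hb := norm_dworkWeight_le hϖ hs d
  have hL : ∑' n, dworkWeight ϖ (padicIntCast p d) s n *
      coeff n ((f : PowerSeries ℂ_[p]) - c • 1) =
      ∑' n, dworkWeight ϖ (padicIntCast p d) s n * coeff n (f : PowerSeries ℂ_[p]) - c := by
    have h1 := summable_mul_coeff f.2 hb
    have h2 := (summable_mul_coeff (one_mem_dagger p) hb).mul_left c
    have h3 : ∀ n, dworkWeight ϖ (padicIntCast p d) s n *
        coeff n ((f : PowerSeries ℂ_[p]) - c • 1) =
        dworkWeight ϖ (padicIntCast p d) s n * coeff n (f : PowerSeries ℂ_[p]) -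
        c * (dworkWeight ϖ (padicIntCast p d) s n * coeff n (1 : PowerSeries ℂ_[p])) := fun n => by
      rw [map_sub, coeff_smul]; ring
    simp_rw [h3]
    rw [h1.tsum_sub h2, tsum_mul_left, tsum_mul_coeff_one]
    simp [dworkWeight, risingFactorial]
  constructor
  · rintro ⟨g, hg, h⟩
    rw [← h, tsum_dworkWeight_dworkOp hϖ hs hg, eq_comm, sub_eq_zero] at hL
    exact hL
  · intro h
    rw [h, sub_self] at hL
    exact exists_dworkOp_eq hϖ hs (Submodule.sub_mem _ f.2
      (Submodule.smul_mem _ _ (one_mem_dagger p))) d hL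

theorem oneIsBasis (d : ℤ_[p]) : OneIsBasis ϖ (padicIntCast p d) s := by
  intro v
  obtain ⟨f, rfl⟩ := Submodule.Quotient.mk_surjective _ v
  refine ⟨_, (DworkFibre.mk_eq_smul_one_iff hϖ hs).mpr rfl, fun c hc => ?_⟩
  exact ((DworkFibre.mk_eq_smul_one_iff hϖ hs).mp hc).symm

end Weights

/-! ### Dwork's Frobenius on the fibres -/

theorem dworkFrob_add (ϖ x y : ℂ_[p]) (T : ℕ) (f g : PowerSeries ℂ_[p]) :
    dworkFrob ϖ x y T (f + g) = dworkFrob ϖ x y T f + dworkFrob ϖ x y T g := by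
  simp only [dworkFrob, map_add]; ring

theorem dworkFrob_smul (ϖ x y c : ℂ_[p]) (T : ℕ) (f : PowerSeries ℂ_[p]) :
    dworkFrob ϖ x y T (c • f) = c • dworkFrob ϖ x y T f := by
  simp only [dworkFrob, map_smul, mul_smul_comm]

theorem eulerOp_rescale_dworkExp (ϖ x : ℂ_[p]) :
    eulerOp (rescale x (dworkExp p (-ϖ))) =
      (C (p * ϖ * x ^ p) * X ^ p - C (ϖ * x) * X) * rescale x (dworkExp p (-ϖ)) := by
  have hC : ∀ c : ℂ_[p], rescale x (C c) = C c := fun c => by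
    ext n; rw [coeff_rescale, coeff_C]; split_ifs with h <;> simp [h]
  rw [eulerOp_rescale, eulerOp_dworkExp, map_mul, map_sub, map_mul, map_mul, map_pow, rescale_X,
    hC, hC]
  simp only [map_mul, map_neg, map_natCast, map_pow]
  ring

/-- Differentiating `exp(-h)` yields `p ϖ (x ^ p + y ^ p) X ^ p - ϖ (x + y) X`. The second term
cancels the one in `D_δ'`; the first, like the derivative of `f(X ^ p)` and `T + δ' = p δ`, carries
a factor `p`. -/
theorem dworkOp_dworkFrob (ϖ x y : ℂ_[p]) {δ δ' : ℂ_[p]} {T : ℕ} (hT : T + δ' = p * δ)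
    (f : PowerSeries ℂ_[p]) :
    dworkOp ϖ δ' (x + y) (dworkFrob ϖ x y T f) =
      (p : ℂ_[p]) • dworkFrob ϖ x y T (dworkOp ϖ δ (x ^ p + y ^ p) f) := by
  have hT' : (T : PowerSeries ℂ_[p]) + C δ' = (p : PowerSeries ℂ_[p]) * C δ := by
    rw [← map_natCast (C (R := ℂ_[p])), ← map_add, hT, map_mul, map_natCast]
  rw [dworkOp_apply, dworkOp_apply, smul_eq_C_mul]
  simp only [dworkFrob, eulerOp_mul, eulerOp_X_pow, eulerOp_expand, eulerOp_rescale_dworkExp,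
    map_add, map_mul, expand_C, expand_X, map_pow, map_natCast, pow_one]
  linear_combination (X ^ T * ((rescale x) (dworkExp p (-ϖ)) * (rescale y) (dworkExp p (-ϖ))) *
    expand p hp.out.ne_zero f) * hT'

section Frobenius

variable {ϖ : ℂ_[p]} (hϖ : ϖ ^ (p - 1) = -(p : ℂ_[p]))
include hϖ

theorem dworkFrob_mem_dagger {x y : ℂ_[p]} (hx : ‖x‖ ≤ 1) (hy : ‖y‖ ≤ 1) (T : ℕ)
    {f : PowerSeries ℂ_[p]} (hf : f ∈ dagger p) : dworkFrob ϖ x y T f ∈ dagger p :=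
  mul_mem_dagger (mul_mem_dagger (X_pow_mem_dagger T)
    (mul_mem_dagger (rescale_mem_dagger (dworkExp_neg_mem_dagger hϖ) hx)
      (rescale_mem_dagger (dworkExp_neg_mem_dagger hϖ) hy))) (expand_mem_dagger hf _)

/-- Dwork's Frobenius as a linear map of fibres of the GKZ modules. -/
theorem exists_linearMap_dworkFrob {x y : ℂ_[p]} (hx : ‖x‖ ≤ 1) (hy : ‖y‖ ≤ 1) {δ δ' : ℂ_[p]}
    {T : ℕ} (hT : T + δ' = p * δ) :
    ∃ Φ : DworkFibre ϖ δ (x ^ p + y ^ p) →ₗ[ℂ_[p]] DworkFibre ϖ δ' (x + y),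
      ∀ f : ↥(dagger p), Φ (DworkFibre.mk ϖ δ (x ^ p + y ^ p) f) = DworkFibre.mk ϖ δ' (x + y)
        ⟨dworkFrob ϖ x y T (f : PowerSeries ℂ_[p]), dworkFrob_mem_dagger hϖ hx hy T f.2⟩ := by
  have hp0 : (p : ℂ_[p]) ≠ 0 := by exact_mod_cast hp.out.ne_zero
  let φ : ↥(dagger p) →ₗ[ℂ_[p]] ↥(dagger p) :=
    { toFun := fun f => ⟨dworkFrob ϖ x y T f, dworkFrob_mem_dagger hϖ hx hy T f.2⟩
      map_add' := fun f g => Subtype.ext (dworkFrob_add ϖ x y T f g)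
      map_smul' := fun c f => Subtype.ext (dworkFrob_smul ϖ x y c T f) }
  refine ⟨Submodule.mapQ _ _ φ ?_, fun f => rfl⟩
  rintro f ⟨g, hg, hgf⟩
  -- Dividing by `p` undoes the factor in the commutation relation.
  refine ⟨(p : ℂ_[p])⁻¹ • dworkFrob ϖ x y T g,
    Submodule.smul_mem _ _ (dworkFrob_mem_dagger hϖ hx hy T hg), ?_⟩
  rw [map_smul, dworkOp_dworkFrob ϖ x y hT, smul_smul, inv_mul_cancel₀ hp0, one_smul, hgf]
  rfl

/-- Between lines with chosen bases, the Frobenius is the scalar `c⁻¹`, so it is invertible and its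
inverse transpose is `c`. -/
theorem isDworkMatrix_of_mk_eq {x y : ℂ_[p]} (hx : ‖x‖ ≤ 1) (hy : ‖y‖ ≤ 1) {δ δ' : ℂ_[p]}
    {T : ℕ} (hT : T + δ' = p * δ) (hb : OneIsBasis ϖ δ (x ^ p + y ^ p))
    (hb' : OneIsBasis ϖ δ' (x + y)) {c : ℂ_[p]} (hc : c ≠ 0)
    (h : DworkFibre.mk ϖ δ' (x + y) ⟨dworkFrob ϖ x y T 1,
      dworkFrob_mem_dagger hϖ hx hy T (one_mem_dagger p)⟩ = c⁻¹ • DworkFibre.one ϖ δ' (x + y)) :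
    IsDworkMatrix ϖ δ δ' T x y c := by
  obtain ⟨Φ, hΦ⟩ := exists_linearMap_dworkFrob hϖ hx hy hT
  have h1 : Φ (DworkFibre.one ϖ δ (x ^ p + y ^ p)) = c⁻¹ • DworkFibre.one ϖ δ' (x + y) := by
    rw [← h]; exact hΦ _
  have hinj : Function.Injective Φ := by
    rw [injective_iff_map_eq_zero]
    intro v hv
    obtain ⟨a, rfl, -⟩ := hb v
    rw [map_smul, h1, smul_smul] at hv
    obtain ⟨b, -, hu⟩ := hb' 0
    have h2 := (hu _ hv.symm).trans (hu 0 (by simp)).symm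
    have : a = 0 := by simpa [hc] using h2
    rw [this, zero_smul]
  have hsurj : Function.Surjective Φ := by
    intro v
    obtain ⟨a, rfl, -⟩ := hb' v
    refine ⟨(a * c) • DworkFibre.one ϖ δ (x ^ p + y ^ p), ?_⟩
    rw [map_smul, h1, smul_smul, mul_assoc, mul_inv_cancel₀ hc, mul_one]
  obtain ⟨Ψ, hΨ⟩ : ∃ Ψ : DworkFibre ϖ δ (x ^ p + y ^ p) ≃ₗ[ℂ_[p]] DworkFibre ϖ δ' (x + y),
      ∀ v, Ψ v = Φ v := ⟨LinearEquiv.ofBijective Φ ⟨hinj, hsurj⟩, fun v => rfl⟩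
  refine ⟨Ψ, fun f => ⟨_, (hΨ _).trans (hΦ f)⟩, fun ℓ => ?_⟩
  have h2 : Ψ.symm (DworkFibre.one ϖ δ' (x + y)) = c • DworkFibre.one ϖ δ (x ^ p + y ^ p) := by
    rw [LinearEquiv.symm_apply_eq, hΨ, map_smul, h1, smul_smul, mul_inv_cancel₀ hc, one_smul]
  rw [LinearEquiv.dualMap_apply, h2, map_smul, smul_eq_mul]

end Frobenius
end

noncomputable section

/-! ### Powers of one-units with `p`-adic integer exponents -/

section PadicPow

variable {p : ℕ} [hp : Fact p.Prime]

/-- The power `u ^ d = ∑ (d choose n) (u - 1) ^ n` for `‖u - 1‖ < 1` and `d ∈ ℤ_p`. -/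
def padicPow (u : ℂ_[p]) (d : ℤ_[p]) : ℂ_[p] :=
  ∑' n, padicIntCast p (Ring.choose d n) * (u - 1) ^ n

theorem norm_padicPow_term_le (t : ℂ_[p]) (d : ℤ_[p]) (n : ℕ) :
    ‖padicIntCast p (Ring.choose d n) * t ^ n‖ ≤ ‖t‖ ^ n := by
  rw [norm_mul, norm_pow]
  exact mul_le_of_le_one_left (by positivity) (norm_padicIntCast_le_one _)

theorem hasSum_padicPow {u : ℂ_[p]} (hu : ‖u - 1‖ < 1) (d : ℤ_[p]) :
    HasSum (fun n => padicIntCast p (Ring.choose d n) * (u - 1) ^ n) (padicPow u d) :=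
  (Summable.of_norm_bounded (summable_geometric_of_lt_one (norm_nonneg _) hu)
    (norm_padicPow_term_le _ d)).hasSum

theorem continuous_padicPow {u : ℂ_[p]} (hu : ‖u - 1‖ < 1) : Continuous (padicPow u) := by
  refine continuous_tsum (fun n => ?_) (summable_geometric_of_lt_one (norm_nonneg _) hu)
    fun n d => norm_padicPow_term_le _ d n
  exact (continuous_padicIntCast.comp (PadicInt.continuous_choose n)).mul continuous_const

theorem padicPow_natCast (u : ℂ_[p]) (m : ℕ) : padicPow u (m : ℤ_[p]) = u ^ m := by
  rw [padicPow, tsum_eq_sum (s := Finset.range (m + 1))]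
  · conv_rhs => rw [← sub_add_cancel u 1, add_pow]
    refine Finset.sum_congr rfl fun n _ => ?_
    rw [Ring.choose_natCast, map_natCast, one_pow]
    ring
  · intro n hn
    rw [Ring.choose_natCast, Nat.choose_eq_zero_of_lt (by simpa using hn)]
    simp

theorem padicPow_zero (u : ℂ_[p]) : padicPow u 0 = 1 := by
  simpa using padicPow_natCast u 0

theorem norm_eq_one_of_norm_sub_one_lt {u : ℂ_[p]} (hu : ‖u - 1‖ < 1) : ‖u‖ = 1 := by
  have := IsUltrametricDist.norm_add_eq_max_of_norm_ne_norm (x := u - 1) (y := 1)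
    (by rw [norm_one]; exact hu.ne)
  rwa [sub_add_cancel, norm_one, max_eq_right hu.le] at this

theorem norm_mul_sub_one_lt {u v : ℂ_[p]} (hu : ‖u - 1‖ < 1) (hv : ‖v - 1‖ < 1) :
    ‖u * v - 1‖ < 1 := by
  have : u * v - 1 = u * (v - 1) + (u - 1) := by ring
  rw [this]
  refine (IsUltrametricDist.norm_add_le_max _ _).trans_lt (max_lt ?_ hu)
  rwa [norm_mul, norm_eq_one_of_norm_sub_one_lt hu, one_mul]

theorem norm_pow_sub_one_lt {u : ℂ_[p]} (hu : ‖u - 1‖ < 1) (n : ℕ) : ‖u ^ n - 1‖ < 1 := by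
  induction n with
  | zero => simp
  | succ n ih => rw [pow_succ]; exact norm_mul_sub_one_lt ih hu

theorem norm_div_sub_one_lt {u v : ℂ_[p]} (hu : ‖u - 1‖ < 1) (hv : ‖v - 1‖ < 1) :
    ‖v / u - 1‖ < 1 := by
  have h1 := norm_eq_one_of_norm_sub_one_lt hu
  have h0 : u ≠ 0 := norm_pos_iff.mp (by rw [h1]; exact one_pos)
  have : v / u - 1 = ((v - 1) + (1 - u)) / u := by field_simp; ring
  rw [this, norm_div, h1, div_one]
  refine (IsUltrametricDist.norm_add_le_max _ _).trans_lt (max_lt hv ?_)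
  rwa [norm_sub_rev]

/-- Both sides are continuous in the exponent and agree on the dense subset `ℕ` of `ℤ_p`. The other
exponent laws are obtained in the same way. -/
theorem mul_padicPow {u v : ℂ_[p]} (hu : ‖u - 1‖ < 1) (hv : ‖v - 1‖ < 1) (d : ℤ_[p]) :
    padicPow (u * v) d = padicPow u d * padicPow v d :=
  congr_fun (PadicInt.denseRange_natCast.equalizer
    (continuous_padicPow (norm_mul_sub_one_lt hu hv))
    ((continuous_padicPow hu).mul (continuous_padicPow hv))
    (funext fun m => by simp only [Function.comp_apply, Pi.mul_apply, padicPow_natCast, mul_pow])) d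

theorem padicPow_add {u : ℂ_[p]} (hu : ‖u - 1‖ < 1) (d e : ℤ_[p]) :
    padicPow u (d + e) = padicPow u d * padicPow u e :=
  congr_fun ((PadicInt.denseRange_natCast.prodMap PadicInt.denseRange_natCast).equalizer
    ((continuous_padicPow hu).comp continuous_add)
    (((continuous_padicPow hu).comp continuous_fst).mul
      ((continuous_padicPow hu).comp continuous_snd))
    (funext fun ⟨m, n⟩ => by
      simp only [Function.comp_apply, Pi.mul_apply, Prod.map, ← Nat.cast_add, padicPow_natCast, pow_add]))
    (d, e)

theorem padicPow_mul_natCast {u : ℂ_[p]} (hu : ‖u - 1‖ < 1) (n : ℕ) (d : ℤ_[p]) :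
    padicPow u (n * d) = padicPow (u ^ n) d :=
  congr_fun (PadicInt.denseRange_natCast.equalizer
    ((continuous_padicPow hu).comp (continuous_const.mul continuous_id))
    (continuous_padicPow (norm_pow_sub_one_lt hu n))
    (funext fun m => by
      simp only [Function.comp_apply, Pi.mul_apply, id, ← Nat.cast_mul, padicPow_natCast, pow_mul])) d

theorem padicPow_mul_neg {u : ℂ_[p]} (hu : ‖u - 1‖ < 1) (d : ℤ_[p]) :
    padicPow u d * padicPow u (-d) = 1 := by
  rw [← padicPow_add hu, add_neg_cancel, padicPow_zero]

theorem padicPow_neg {u : ℂ_[p]} (hu : ‖u - 1‖ < 1) (d : ℤ_[p]) :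
    padicPow u (-d) = (padicPow u d)⁻¹ :=
  eq_inv_of_mul_eq_one_right (padicPow_mul_neg hu d)

theorem padicPow_ne_zero {u : ℂ_[p]} (hu : ‖u - 1‖ < 1) (d : ℤ_[p]) : padicPow u d ≠ 0 :=
  left_ne_zero_of_mul_eq_one (padicPow_mul_neg hu d)

/-- The binomial series of `(1 - z) ^ (-d)`, since `choose (-d) n = (-1) ^ n multichoose d n`. -/
theorem hasSum_hypTerm {z : ℂ_[p]} (hz : ‖z‖ < 1) (d : ℤ_[p]) :
    HasSum (hypTerm (padicIntCast p d) z) (padicPow (1 - z) (-d)) := by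
  have h1 : (1 - z) - 1 = -z := by ring
  have := hasSum_padicPow (u := 1 - z) (by rwa [h1, norm_neg]) (-d)
  refine this.congr_fun fun n => ?_
  have h2 : (n.factorial : ℂ_[p]) ≠ 0 := by exact_mod_cast n.factorial_ne_zero
  have h3 : hypTerm (padicIntCast p d) z n
      = risingFactorial (padicIntCast p d) n / (n.factorial : ℂ_[p]) * z ^ n := rfl
  have h4 : Ring.choose (-d) n = (-1) ^ n * Ring.multichoose d n := by
    rw [Ring.choose_neg, Ring.multichoose_eq, Units.smul_def, zsmul_eq_mul]
    simp
  rw [h3, ← map_risingFactorial, risingFactorial_eq_multichoose, map_mul, map_natCast, h1, h4,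
    map_mul, map_pow, map_neg, map_one, neg_pow z n, mul_div_cancel_left₀ _ h2]
  have h5 : ((-1 : ℂ_[p]) ^ n) * (-1) ^ n = 1 := by rw [← mul_pow]; simp
  linear_combination -(padicIntCast p (Ring.multichoose d n) * z ^ n) * h5

theorem norm_padicPow_sub_le {u : ℂ_[p]} (hu : ‖u - 1‖ < 1) (d : ℤ_[p]) :
    ‖padicPow u d - 1 - padicIntCast p d * (u - 1)‖ ≤ ‖u - 1‖ ^ 2 := by
  have h := (hasSum_padicPow hu d).summable
  rw [padicPow, ← h.sum_add_tsum_nat_add 2, Finset.sum_range_succ, Finset.sum_range_one]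
  simp only [Ring.choose_zero_right, map_one, pow_zero, mul_one, Ring.choose_one_right, pow_one]
  rw [add_sub_right_comm, add_sub_cancel_left, add_sub_cancel_left]
  refine (IsUltrametricDist.norm_tsum_le _).trans (ciSup_le fun n => ?_)
  exact (norm_padicPow_term_le _ d _).trans
    (pow_le_pow_of_le_one (norm_nonneg _) hu.le (by omega))

theorem padicPow_one_left (d : ℤ_[p]) : padicPow (1 : ℂ_[p]) d = 1 := by
  have := mul_padicPow (u := (1 : ℂ_[p])) (v := 1) (by simp) (by simp) d
  rw [mul_one] at this
  exact (mul_eq_left₀ (padicPow_ne_zero (by simp) d)).mp this.symm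

theorem hasDerivAt_padicPow_one (d : ℤ_[p]) :
    HasDerivAt (fun u : ℂ_[p] => padicPow u d) (padicIntCast p d) 1 := by
  rw [hasDerivAt_iff_isLittleO]
  have hO : (fun u : ℂ_[p] => padicPow u d - padicPow 1 d - (u - 1) • padicIntCast p d)
      =O[𝓝 1] fun u => ‖u - 1‖ ^ 2 := by
    refine Asymptotics.IsBigO.of_bound 1 ?_
    filter_upwards [Metric.ball_mem_nhds (1 : ℂ_[p]) one_pos] with u hu
    rw [Metric.mem_ball, dist_eq_norm] at hu
    rw [padicPow_one_left, smul_eq_mul, mul_comm (u - 1), one_mul, norm_pow, norm_norm]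
    exact norm_padicPow_sub_le hu d
  refine hO.trans_isLittleO ?_
  have := Asymptotics.isLittleO_norm_pow_id (E' := ℂ_[p]) one_lt_two
  have h2 : Tendsto (fun u : ℂ_[p] => u - 1) (𝓝 1) (𝓝 0) := by
    have : Continuous fun u : ℂ_[p] => u - 1 := by fun_prop
    simpa using this.tendsto 1
  exact this.comp_tendsto h2

/-- Multiplicativity `v ^ d = u ^ d (v / u) ^ d` reduces to the derivative at `1`, read off the
binomial series. -/
theorem hasDerivAt_padicPow {u : ℂ_[p]} (hu : ‖u - 1‖ < 1) (d : ℤ_[p]) :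
    HasDerivAt (fun v : ℂ_[p] => padicPow v d) (padicIntCast p d * padicPow u d / u) u := by
  have h1 := norm_eq_one_of_norm_sub_one_lt hu
  have h0 : u ≠ 0 := norm_pos_iff.mp (by rw [h1]; exact one_pos)
  have hd : HasDerivAt (fun v : ℂ_[p] => v / u) (1 / u) u := (hasDerivAt_id u).div_const u
  have hc : HasDerivAt (fun v : ℂ_[p] => padicPow (v / u) d) (padicIntCast p d * (1 / u)) u := by
    have h2 : HasDerivAt (fun v : ℂ_[p] => padicPow v d) (padicIntCast p d) (u / u) := by
      rw [div_self h0]; exact hasDerivAt_padicPow_one d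
    exact HasDerivAt.comp (h := fun v : ℂ_[p] => v / u) u h2 hd
  have hm := hc.const_mul (padicPow u d)
  refine (hm.congr_of_eventuallyEq ?_).congr_deriv (by ring)
  filter_upwards [Metric.ball_mem_nhds u one_pos] with v hv
  rw [Metric.mem_ball, dist_eq_norm] at hv
  have hv1 : ‖v - 1‖ < 1 := by
    rw [← sub_add_sub_cancel v u 1]
    exact (IsUltrametricDist.norm_add_le_max _ _).trans_lt (max_lt hv hu)
  rw [← mul_padicPow hu (norm_div_sub_one_lt hu hv1), mul_div_cancel₀ _ h0]

/-- `(x + y) ^ p` is congruent to `x ^ p + y ^ p` modulo `p`. -/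
theorem norm_add_pow_prime_sub_le {x y : ℂ_[p]} {M : ℝ} (hx : ‖x‖ ≤ M) (hy : ‖y‖ ≤ M) :
    ‖x ^ p + y ^ p - (x + y) ^ p‖ ≤ (p : ℝ)⁻¹ * M ^ p := by
  have hM : 0 ≤ M := (norm_nonneg _).trans hx
  rw [norm_sub_rev, add_pow_prime_eq' hp.out, add_sub_cancel_left, norm_mul, PadicComplex.norm_p]
  gcongr
  refine IsUltrametricDist.norm_sum_le_of_forall_le_of_nonneg (by positivity) fun k hk => ?_
  rw [Finset.mem_Ioo] at hk
  rw [norm_mul, norm_mul, norm_pow, norm_pow]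
  calc _ ≤ M ^ k * M ^ (p - k) * 1 := by
        gcongr; exact PadicComplex.norm_natCast_le_one _
    _ = M ^ p := by rw [mul_one, ← pow_add]; congr 1; omega

end PadicPow
end

noncomputable section

/-! ### Dwork's symbol and the matrix of Dwork's Frobenius -/

section Symbol

variable {p : ℕ} [hp : Fact p.Prime]

theorem intPochhammer_natCast {K : Type*} [Field K] (b : K) (n : ℕ) :
    intPochhammer b (n : ℤ) = risingFactorial b n := rfl

/-- For negative `i` the symbol is an inverse product, and the recursion fails only if some factor
`b - m - 1` vanishes. -/
theorem intPochhammer_succ {K : Type*} [Field K] {b : K} (hb : ∀ m : ℕ, b ≠ m + 1) (i : ℤ) :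
    intPochhammer b (i + 1) = intPochhammer b i * (b + i) := by
  rcases i with n | n
  · have : (Int.ofNat n + 1 : ℤ) = ((n + 1 : ℕ) : ℤ) := by simp
    rw [this, intPochhammer_natCast, risingFactorial_succ, Int.ofNat_eq_natCast,
      intPochhammer_natCast, Int.cast_natCast]
  · have hne : ∀ m : ℕ, b - (m + 1) ≠ 0 := fun m => sub_ne_zero.mpr (hb m)
    cases n with
    | zero =>
      have h1 : Int.negSucc 0 + 1 = ((0 : ℕ) : ℤ) := rfl
      have h2 := hne 0
      rw [Nat.cast_zero, zero_add] at h2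
      rw [h1, intPochhammer_natCast]
      simp only [intPochhammer, risingFactorial, Finset.prod_range_zero, Finset.prod_range_one,
        zero_add, Nat.cast_zero, Int.cast_negSucc, Nat.cast_one]
      rw [← sub_eq_add_neg, inv_mul_cancel₀ h2]
    | succ n =>
      have h1 : Int.negSucc (n + 1) + 1 = Int.negSucc n := by
        rw [Int.negSucc_eq, Int.negSucc_eq]; push_cast; ring
      rw [h1]
      simp only [intPochhammer, Int.cast_negSucc]
      rw [Finset.prod_range_succ _ (n + 1), mul_inv]
      have h2 := hne (n + 1)
      push_cast at h2 ⊢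
      have h3 : b + -((n : K) + 1 + 1) = b - (n + 1 + 1) := by ring
      rw [h3, inv_mul_cancel_right₀ h2]

/-- The weights `(δ)_i / (-ϖ) ^ i` placed at the exponents `p i + T`. -/
def symbolWeight (p : ℕ) [Fact p.Prime] (ϖ : ℂ_[p]) (T : ℤ) (δ : ℂ_[p]) (m : ℤ) : ℂ_[p] :=
  if (p : ℤ) ∣ m - T then
    intPochhammer δ ((m - T) / p) / (-ϖ) ^ ((m - T) / p) else 0

theorem symbolWeight_mul_add (ϖ : ℂ_[p]) (T : ℤ) (δ : ℂ_[p]) (i : ℤ) :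
    symbolWeight p ϖ T δ (p * i + T) = intPochhammer δ i / (-ϖ) ^ i := by
  have hp0 : (p : ℤ) ≠ 0 := by exact_mod_cast hp.out.ne_zero
  rw [symbolWeight, add_sub_cancel_right, if_pos (dvd_mul_right _ _), Int.mul_ediv_cancel_left _ hp0]

variable {ϖ : ℂ_[p]} (hϖ : ϖ ^ (p - 1) = -(p : ℂ_[p]))
include hϖ

/-- The recursion dual to `X d/dX + δ' + p ϖ X ^ p`, the conjugate of `D_δ'` at `s = 1` by Dwork's
exponential. -/
theorem symbolWeight_rec {δ δ' : ℂ_[p]} (hδ : ∀ m : ℕ, δ ≠ m + 1) {T : ℤ} (hT : T + δ' = p * δ)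
    (m : ℤ) :
    (m + δ') * symbolWeight p ϖ T δ m + (p * ϖ) * symbolWeight p ϖ T δ (m + p) = 0 := by
  have hϖ0 : -ϖ ≠ 0 := neg_ne_zero.mpr (unif_ne_zero hϖ)
  by_cases h : (p : ℤ) ∣ m - T
  · obtain ⟨i, hi⟩ := h
    obtain rfl : m = p * i + T := by rw [← hi]; ring
    have e : (p : ℤ) * i + T + p = p * (i + 1) + T := by ring
    rw [e, symbolWeight_mul_add, symbolWeight_mul_add, intPochhammer_succ hδ, zpow_add_one₀ hϖ0]
    have h2 : (((p * i + T : ℤ) : ℂ_[p]) + δ') = p * (δ + i) := by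
      push_cast
      linear_combination hT
    rw [h2]
    generalize hc : -ϖ = c at *
    rw [← neg_neg ϖ, hc]
    field_simp
    ring
  · have h' : ¬ (p : ℤ) ∣ m + p - T := by
      rwa [show m + p - T = m - T + p by ring, dvd_add_self_right]
    rw [symbolWeight, symbolWeight, if_neg h, if_neg h']
    simp

theorem exists_norm_symbolWeight_le (T : ℕ) (d : ℤ_[p]) :
    ∃ B : ℝ, ∀ n : ℕ, ‖symbolWeight p ϖ T (padicIntCast p d) n‖ ≤ B * (n + 1) := by
  -- The exponents below `T` correspond to negative indices `i`. They are finitely many, so the sum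
  -- of their norms bounds them.
  set S : ℝ := ∑ k ∈ Finset.range T, ‖symbolWeight p ϖ T (padicIntCast p d) k‖ with hS
  have hS0 : 0 ≤ S := Finset.sum_nonneg fun _ _ => norm_nonneg _
  have hp0 : (0 : ℝ) < p := by exact_mod_cast hp.out.pos
  refine ⟨p + S, fun n => ?_⟩
  have hn0 : (0 : ℝ) ≤ n := Nat.cast_nonneg n
  rcases lt_or_ge n T with h | h
  · have := Finset.single_le_sum (f := fun k : ℕ => ‖symbolWeight p ϖ T (padicIntCast p d) k‖)
      (fun _ _ => norm_nonneg _) (Finset.mem_range.mpr h)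
    calc _ ≤ S := this
      _ ≤ (p + S) * (n + 1) := by nlinarith [mul_nonneg hS0 hn0, mul_nonneg hp0.le hn0]
  · by_cases hd : (p : ℤ) ∣ (n : ℤ) - T
    · obtain ⟨i, hi⟩ := hd
      have hi0 : 0 ≤ i := by
        have : (0 : ℤ) ≤ p * i := by rw [← hi]; omega
        exact nonneg_of_mul_nonneg_right this (by exact_mod_cast hp.out.pos)
      lift i to ℕ using hi0
      have hn : (n : ℤ) = p * i + T := by rw [← hi]; ring
      have hin : (i : ℝ) ≤ n := by
        have : i ≤ n := by
          have : n = p * i + T := by exact_mod_cast hn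
          rw [this]
          exact (Nat.le_mul_of_pos_left i hp.out.pos).trans (Nat.le_add_right _ _)
        exact_mod_cast this
      rw [hn, symbolWeight_mul_add, intPochhammer_natCast, zpow_natCast, norm_div, norm_pow,
        norm_neg]
      calc _ ≤ (p : ℝ) * (i + 1) := norm_risingFactorial_div_le hϖ d i
        _ ≤ (p + S) * (n + 1) := by gcongr; linarith
    · rw [symbolWeight, if_neg hd, norm_zero]
      positivity

/-- A reindexing by `m = p i + T`: the weights vanish off this residue class, and the coefficients
vanish for `m < 0`. -/
theorem hasSum_dworkGammaTerm (T : ℕ) (d : ℤ_[p]) :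
    HasSum (dworkGammaTerm p ϖ T (padicIntCast p d))
      (∑' n : ℕ, symbolWeight p ϖ T (padicIntCast p d) n * coeff n (dworkExp p ϖ)) := by
  obtain ⟨B, hB⟩ := exists_norm_symbolWeight_le hϖ T d
  have h1 := (summable_mul_coeff (dworkExp_mem_dagger hϖ) hB).hasSum
  set G : ℤ → ℂ_[p] := fun m => symbolWeight p ϖ T (padicIntCast p d) m *
    intCoeff (dworkExp p ϖ) m with hG
  have h2 : HasSum G (∑' n : ℕ, symbolWeight p ϖ T (padicIntCast p d) n *
      coeff n (dworkExp p ϖ)) := by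
    rw [← Function.Injective.hasSum_iff (g := (Nat.cast : ℕ → ℤ)) Nat.cast_injective]
    · refine h1.congr_fun fun n => ?_
      simp [hG, intCoeff]
    · intro m hm
      have : ¬ 0 ≤ m := fun h => hm ⟨m.toNat, Int.toNat_of_nonneg h⟩
      simp [hG, intCoeff, this]
  have hp0 : (p : ℤ) ≠ 0 := by exact_mod_cast hp.out.ne_zero
  have hinj : Function.Injective fun i : ℤ => (p : ℤ) * i + T := fun i j hij =>
    mul_left_cancel₀ hp0 (add_right_cancel hij)
  rw [← hinj.hasSum_iff] at h2
  · refine h2.congr_fun fun i => ?_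
    simp only [hG, Function.comp_apply, symbolWeight_mul_add, dworkGammaTerm]
    ring
  · intro m hm
    have : ¬ (p : ℤ) ∣ m - T := by
      rintro ⟨i, hi⟩
      exact hm ⟨i, by simp only [← hi]; ring⟩
    simp only [hG, symbolWeight, if_neg this, zero_mul]

theorem tsum_symbolWeight_eq_zero {d : ℤ_[p]} (hδ : ∀ m : ℕ, padicIntCast p d ≠ m + 1) {δ' : ℂ_[p]}
    {T : ℕ} (hT : T + δ' = p * padicIntCast p d) {g : PowerSeries ℂ_[p]} (hg : g ∈ dagger p) :
    ∑' n : ℕ, symbolWeight p ϖ T (padicIntCast p d) n *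
      coeff n (dworkExp p ϖ * dworkOp ϖ δ' 1 g) = 0 := by
  obtain ⟨B, hB⟩ := exists_norm_symbolWeight_le hϖ T d
  have hk := mul_mem_dagger (dworkExp_mem_dagger hϖ) hg
  have e : dworkExp p ϖ * dworkOp ϖ δ' 1 g = eulerOp (dworkExp p ϖ * g) +
      C δ' * (dworkExp p ϖ * g) + C (p * ϖ) * (X ^ p * (dworkExp p ϖ * g)) := by
    rw [dworkOp_apply, eulerOp_mul, eulerOp_dworkExp, mul_one]
    ring
  rw [e]
  refine tsum_mul_coeff_eulerOp_eq_zero (w := fun n : ℕ => symbolWeight p ϖ T (padicIntCast p d) n)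
    hk hB fun n => ?_
  have := symbolWeight_rec hϖ hδ (T := T) (by exact_mod_cast hT) n
  push_cast at this ⊢
  exact this

/-- At `(x, y) = (1, 0)` Dwork's Frobenius is the inverse of Dwork's symbol. -/
theorem exists_dworkOp_eq_X_pow_mul {d d' : ℤ_[p]} (hδ : ∀ m : ℕ, padicIntCast p d ≠ m + 1) {T : ℕ}
    (hT : T + padicIntCast p d' = p * padicIntCast p d) {γ : ℂ_[p]}
    (hγ : HasSum (dworkGammaTerm p ϖ T (padicIntCast p d)) γ) :
    γ ≠ 0 ∧ ∃ g ∈ dagger p, dworkOp ϖ (padicIntCast p d') 1 g =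
      X ^ T * dworkExp p (-ϖ) - γ⁻¹ • 1 := by
  have hmem : X ^ T * dworkExp p (-ϖ) ∈ dagger p :=
    mul_mem_dagger (X_pow_mem_dagger T) (dworkExp_neg_mem_dagger hϖ)
  obtain ⟨B, hB⟩ := exists_norm_symbolWeight_le hϖ T d
  obtain ⟨c, hc, -⟩ := oneIsBasis hϖ (s := (1 : ℂ_[p])) norm_one d'
    (DworkFibre.mk ϖ _ 1 ⟨_, hmem⟩)
  obtain ⟨g, hg, hgc⟩ := DworkFibre.mk_eq_smul_one.mp hc
  simp only at hgc
  have hγ' := hγ.unique (hasSum_dworkGammaTerm hϖ T d)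
  have h0 := tsum_symbolWeight_eq_zero hϖ hδ hT hg
  -- Multiplying the relation `X ^ T / E - c = D_δ' g` by `E` gives `X ^ T - c E`. The functional
  -- sends this to `1 - c γ` and also kills it, so `γ` is nonzero and `c = γ⁻¹`.
  have h1 : dworkExp p ϖ * dworkOp ϖ (padicIntCast p d') 1 g = X ^ T * 1 - c • dworkExp p ϖ := by
    rw [hgc, mul_sub, mul_left_comm, dworkExp_mul_neg, mul_smul_comm, mul_one,
      mul_one]
  have h2 : ∀ n : ℕ, symbolWeight p ϖ T (padicIntCast p d) n *
      coeff n (X ^ T * 1 - c • dworkExp p ϖ) = symbolWeight p ϖ T (padicIntCast p d) n *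
      coeff n (X ^ T * (1 : PowerSeries ℂ_[p])) -
      c * (symbolWeight p ϖ T (padicIntCast p d) n * coeff n (dworkExp p ϖ)) := fun n => by
    rw [map_sub, coeff_smul]; ring
  have s1 := summable_mul_coeff (mul_mem_dagger (X_pow_mem_dagger T) (one_mem_dagger p)) hB
  have s2 := (summable_mul_coeff (dworkExp_mem_dagger hϖ) hB).mul_left c
  rw [h1] at h0
  simp_rw [h2] at h0
  have h3 : symbolWeight p ϖ T (padicIntCast p d) ((0 + T : ℕ) : ℤ) = 1 := by
    have := symbolWeight_mul_add ϖ T (padicIntCast p d) 0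
    rw [mul_zero] at this
    simp only [Nat.cast_add, Nat.cast_zero]
    rw [this]
    simp [intPochhammer]
  rw [s1.tsum_sub s2, tsum_mul_left, ← hγ', tsum_mul_coeff_X_pow_mul (one_mem_dagger p)
    (w := fun n : ℕ => symbolWeight p ϖ T (padicIntCast p d) n) hB,
    tsum_mul_coeff_one (fun n : ℕ => symbolWeight p ϖ T (padicIntCast p d) ((n + T : ℕ) : ℤ)), h3,
    sub_eq_zero] at h0
  have hγ0 : γ ≠ 0 := right_ne_zero_of_mul_eq_one h0.symm
  refine ⟨hγ0, g, hg, ?_⟩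
  rw [hgc, eq_inv_of_mul_eq_one_left h0.symm]

omit hϖ in
-- The substitution `X ↦ s X` reduces the fibre at `s` to the fibre at `1`.
theorem dworkOp_rescale (ϖ δ s : ℂ_[p]) (g : PowerSeries ℂ_[p]) :
    dworkOp ϖ δ s (rescale s g) = rescale s (dworkOp ϖ δ 1 g) := by
  have hC : ∀ c : ℂ_[p], rescale s (C c) = C c := fun c => by
    ext n; rw [coeff_rescale, coeff_C]; split_ifs with h <;> simp [h]
  rw [dworkOp_apply, dworkOp_apply, eulerOp_rescale]
  simp only [map_add, map_mul, map_pow, rescale_X, hC, map_one]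
  ring

/-- The matrix of Dwork's intertwiner: `γ (x + y) ^ T ((x ^ p + y ^ p) / (x + y) ^ p) ^ δ`. -/
theorem isDworkMatrix {d d' : ℤ_[p]} (hδ : ∀ m : ℕ, padicIntCast p d ≠ m + 1) {T : ℕ}
    (hT : T + padicIntCast p d' = p * padicIntCast p d) {γ : ℂ_[p]}
    (hγ : HasSum (dworkGammaTerm p ϖ T (padicIntCast p d)) γ) {x y : ℂ_[p]} (hx : ‖x‖ ≤ 1)
    (hy : ‖y‖ ≤ 1) (hxy : ‖x + y‖ = 1) :
    IsDworkMatrix ϖ (padicIntCast p d) (padicIntCast p d') T x y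
      (γ * (x + y) ^ T * padicPow ((x ^ p + y ^ p) / (x + y) ^ p) d) := by
  obtain ⟨hγ0, g, hg, hgγ⟩ := exists_dworkOp_eq_X_pow_mul hϖ hδ hT hγ
  set s := x + y with hs
  set s' := x ^ p + y ^ p with hs'
  have hp0 : (p : ℂ_[p]) ≠ 0 := by exact_mod_cast hp.out.ne_zero
  have hp1 : (1 : ℝ) < p := by exact_mod_cast hp.out.one_lt
  have hs0 : s ≠ 0 := norm_ne_zero_of_norm_eq_one hxy
  have hsp : ‖s ^ p‖ = 1 := by rw [norm_pow, hxy, one_pow]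
  have hsp0 : s ^ p ≠ 0 := pow_ne_zero p hs0
  have hdiff : ‖s' - s ^ p‖ ≤ (p : ℝ)⁻¹ := by
    simpa using norm_add_pow_prime_sub_le hx hy
  have hdiff1 : ‖s' - s ^ p‖ < 1 := hdiff.trans_lt (inv_lt_one_of_one_lt₀ hp1)
  have hq : ‖s' / s ^ p - 1‖ < 1 := by
    rw [div_sub_one hsp0, norm_div, hsp, div_one]; exact hdiff1
  have hs'1 : ‖s'‖ = 1 := by
    have := norm_eq_one_of_norm_sub_one_lt hq
    rwa [norm_div, hsp, div_one] at this
  set a : ℂ_[p] := ϖ * (s' - s ^ p) with ha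
  set e : PowerSeries ℂ_[p] := rescale a (PowerSeries.exp ℂ_[p]) with he
  have hemem : e ∈ dagger p := by
    -- Radius `p` is available because `s' - s ^ p` is divisible by `p`, so `‖a‖ p ≤ ‖ϖ‖`.
    refine ⟨p, hp1, 1, coeffBound_rescale_exp hϖ (by positivity) ?_⟩
    rw [ha, norm_mul, mul_assoc]
    refine mul_le_of_le_one_right (norm_nonneg _) ?_
    calc _ ≤ (p : ℝ)⁻¹ * p := by gcongr
      _ = 1 := inv_mul_cancel₀ (by positivity)
  set κ := padicPow (s' / s ^ p) (-d) with hκ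
  -- In the fibre at `s ^ p` the functional turns `e` into `∑ (δ)_n / n! (1 - s' / s ^ p) ^ n`, the
  -- binomial series for `κ`.
  obtain ⟨g₁, hg₁, hg₁e⟩ : ∃ g ∈ dagger p, dworkOp ϖ (padicIntCast p d) (s ^ p) g = e - κ • 1 := by
    have h1 := (DworkFibre.mk_eq_smul_one_iff hϖ hsp (d := d) (f := ⟨e, hemem⟩) (c := κ)).mpr ?_
    · exact DworkFibre.mk_eq_smul_one.mp h1
    · have hz : ‖1 - s' / s ^ p‖ < 1 := by rwa [norm_sub_rev]
      have h2 := hasSum_hypTerm hz d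
      rw [sub_sub_cancel] at h2
      refine (h2.congr_fun fun n => ?_).tsum_eq
      have h3 : (n.factorial : ℂ_[p]) ≠ 0 := by exact_mod_cast n.factorial_ne_zero
      have h4 : hypTerm (padicIntCast p d) (1 - s' / s ^ p) n
        = risingFactorial (padicIntCast p d) n / (n.factorial : ℂ_[p]) * (1 - s' / s ^ p) ^ n := rfl
      have h5 : 1 - s' / s ^ p = a / (-(ϖ * s ^ p)) := by
        have := unif_ne_zero hϖ
        rw [ha, div_neg, mul_div_mul_left _ _ this]
        field_simp
        ring
      have h6 : coeff n e = a ^ n / (n.factorial : ℂ_[p]) := by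
        rw [he, coeff_rescale, coeff_exp]; simp [div_eq_mul_inv]
      simp only
      rw [h4, h5, h6, dworkWeight, div_pow]
      ring
  -- Regroup the exponentials: the part linear in `X` depends only on `s`, and `s ^ p` is exchanged
  -- for `s'` at the cost of `e(X ^ p)`. So Frobenius at `(x, y)` applied to `1` is Frobenius at
  -- `(s, 0)` applied to `e`.
  have hfrob : dworkFrob ϖ x y T 1 = X ^ T * rescale s (dworkExp p (-ϖ)) *
      expand p hp.out.ne_zero e := by
    have hr : ∀ z : ℂ_[p], rescale z (dworkExp p (-ϖ)) =
        rescale (z * (-ϖ)) (PowerSeries.exp ℂ_[p]) *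
        expand p hp.out.ne_zero (rescale (z ^ p * ϖ) (PowerSeries.exp ℂ_[p])) := fun z => by
      rw [dworkExp, map_mul, expand_rescale, rescale_rescale, rescale_rescale, neg_neg,
        mul_comm (-ϖ) z, mul_comm ϖ]
    have h1 : s * (-ϖ) = x * (-ϖ) + y * (-ϖ) := by rw [hs]; ring
    have h2 : x ^ p * ϖ + y ^ p * ϖ = s ^ p * ϖ + a := by rw [ha, hs']; ring
    rw [dworkFrob, map_one, mul_one, mul_assoc]
    congr 1
    rw [hr, hr, hr, mul_mul_mul_comm, exp_mul_exp_eq_exp_add, ← map_mul, exp_mul_exp_eq_exp_add,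
      h1, h2, ← exp_mul_exp_eq_exp_add, ← exp_mul_exp_eq_exp_add, map_mul, he, mul_assoc,
      mul_assoc, mul_assoc]
  have hfrob0 : ∀ f : PowerSeries ℂ_[p], dworkFrob ϖ s 0 T f =
      X ^ T * rescale s (dworkExp p (-ϖ)) * expand p hp.out.ne_zero f := fun f => by
    have : constantCoeff (dworkExp p (-ϖ)) = 1 := by
      rw [← coeff_zero_eq_constantCoeff_apply, coeff_zero_dworkExp]
    rw [dworkFrob, rescale_zero_apply, this, map_one, mul_one]
  have hmain : ∃ G ∈ dagger p, dworkOp ϖ (padicIntCast p d') s G =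
      dworkFrob ϖ x y T 1 - (γ * s ^ T * padicPow (s' / s ^ p) d)⁻¹ • 1 := by
    have hD := dworkOp_dworkFrob ϖ s 0 hT g₁
    rw [add_zero, zero_pow hp.out.ne_zero, add_zero, hg₁e] at hD
    have hD2 := congrArg (rescale s) hgγ
    rw [← dworkOp_rescale, map_sub, map_mul, map_pow, rescale_X, smul_eq_C_mul, mul_one] at hD2
    have hC : rescale s (C γ⁻¹) = C γ⁻¹ := by
      ext n; rw [coeff_rescale, coeff_C]; split_ifs with h <;> simp [h]
    rw [hC] at hD2
    -- Two relations are combined: Frobenius at `(s, 0)` applied to `e ≡ κ`, and the relation at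
    -- `(1, 0)` rescaled by `s`, which gives `X ^ T / E(sX) ≡ s ^ (-T) γ⁻¹`.
    refine ⟨(p : ℂ_[p])⁻¹ • dworkFrob ϖ s 0 T g₁ + (κ * (s ^ T)⁻¹) • rescale s g,
      Submodule.add_mem _ (Submodule.smul_mem _ _
        (dworkFrob_mem_dagger hϖ hxy.le (by simp) T hg₁))
        (Submodule.smul_mem _ _ (rescale_mem_dagger hg hxy.le)), ?_⟩
    have hsT : s ^ T ≠ 0 := pow_ne_zero T hs0
    rw [map_add, map_smul, map_smul, hD, hD2, smul_smul, inv_mul_cancel₀ hp0, one_smul, hfrob0,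
      hfrob, mul_inv, mul_inv, ← padicPow_neg hq, ← hκ, map_sub, map_smul, map_one]
    have hCC : C (s ^ T)⁻¹ * (C s ^ T : PowerSeries ℂ_[p]) = 1 := by
      rw [← map_pow, ← map_mul, inv_mul_cancel₀ hsT, map_one]
    simp only [smul_eq_C_mul, map_mul, mul_pow, mul_one]
    linear_combination (C κ * X ^ T * rescale s (dworkExp p (-ϖ))) * hCC
  refine isDworkMatrix_of_mk_eq hϖ hx hy hT (oneIsBasis hϖ hs'1 d) (oneIsBasis hϖ hxy d')
    (mul_ne_zero (mul_ne_zero hγ0 (pow_ne_zero T hs0)) (padicPow_ne_zero hq d)) ?_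
  exact DworkFibre.mk_eq_smul_one.mpr hmain

end Symbol
end

noncomputable section

/-! ### Morita's gamma function and Dwork's symbol -/

section Gamma

variable {p : ℕ} [hp : Fact p.Prime]

/-- The weights `(δ)_i / (-ϖ) ^ i` placed at the exponents `p i + μ`, for `μ < p`. -/
def residueWeight (p : ℕ) [Fact p.Prime] (ϖ : ℂ_[p]) (μ : ℕ) (δ : ℂ_[p]) (n : ℕ) : ℂ_[p] :=
  if n % p = μ then risingFactorial δ (n / p) / (-ϖ) ^ (n / p) else 0

/-- The sum `∑ c_{p i + μ} (d)_i / (-ϖ) ^ i` over `i ≥ 0`. -/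
def residueSymbol (p : ℕ) [Fact p.Prime] (ϖ : ℂ_[p]) (μ : ℕ) (d : ℤ_[p]) : ℂ_[p] :=
  ∑' n, residueWeight p ϖ μ (padicIntCast p d) n * coeff n (dworkExp p ϖ)

theorem symbolWeight_eq_residueWeight (ϖ δ : ℂ_[p]) {T : ℕ} (hT : T < p) (n : ℕ) :
    symbolWeight p ϖ T δ n = residueWeight p ϖ T δ n := by
  rw [residueWeight]
  split_ifs with h
  · have hn : (n : ℤ) = p * ((n / p : ℕ) : ℤ) + T := by
      have := Nat.div_add_mod n p
      rw [h] at this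
      exact_mod_cast this.symm
    conv_lhs => rw [hn]
    rw [symbolWeight_mul_add, intPochhammer_natCast, zpow_natCast]
  · rw [symbolWeight, if_neg]
    rintro ⟨i, hi⟩
    apply h
    have : ((n : ℤ)) % p = T := by
      rw [show (n : ℤ) = T + p * i by rw [← hi]; ring, Int.add_mul_emod_self_left]
      exact Int.emod_eq_of_lt (by positivity) (by exact_mod_cast hT)
    exact_mod_cast this

/-- Raising the offset by `p` shifts the index to `i - 1`, and `(δ)_{i - 1} = (δ - 1)_i / (δ - 1)`.
-/
theorem symbolWeight_add_prime {ϖ : ℂ_[p]} (hϖ0 : ϖ ≠ 0) {δ : ℂ_[p]} (hδ : δ ≠ 1) {μ : ℕ}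
    (hμ : μ < p) (n : ℕ) :
    symbolWeight p ϖ (μ + p : ℕ) δ n = -ϖ / (δ - 1) * residueWeight p ϖ μ (δ - 1) n := by
  have hδ1 : δ - 1 ≠ 0 := sub_ne_zero.mpr hδ
  have hϖ1 : -ϖ ≠ 0 := neg_ne_zero.mpr hϖ0
  rw [← symbolWeight_eq_residueWeight ϖ _ hμ]
  by_cases h : (p : ℤ) ∣ (n : ℤ) - μ
  · obtain ⟨i, hi⟩ := h
    have hi0 : 0 ≤ i := by
      by_contra! hc
      have : (p : ℤ) * i ≤ p * (-1) := by
        have : (0 : ℤ) ≤ p := by positivity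
        nlinarith
      omega
    lift i to ℕ using hi0
    have e1 : (n : ℤ) = p * i + μ := by rw [← hi]; ring
    have e2 : (n : ℤ) = p * ((i : ℤ) - 1) + (μ + p : ℕ) := by rw [e1]; push_cast; ring
    conv_lhs => rw [e2]
    rw [e1, symbolWeight_mul_add, symbolWeight_mul_add, intPochhammer_natCast, zpow_sub_one₀ hϖ1]
    have h2 : intPochhammer δ ((i : ℤ) - 1) = risingFactorial (δ - 1) i / (δ - 1) := by
      cases i with
      | zero =>
        have : ((0 : ℕ) : ℤ) - 1 = Int.negSucc 0 := rfl
        rw [this, risingFactorial_zero]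
        simp [intPochhammer]
      | succ i =>
        rw [Nat.cast_succ, add_sub_cancel_right, intPochhammer_natCast, risingFactorial_succ',
          sub_add_cancel, mul_div_cancel_left₀ _ hδ1]
    rw [h2]
    field_simp
  · have h' : ¬ (p : ℤ) ∣ (n : ℤ) - (μ + p : ℕ) := by
      push_cast
      rwa [← sub_sub, dvd_sub_self_right]
    rw [symbolWeight, symbolWeight, if_neg h, if_neg h', mul_zero]

variable {ϖ : ℂ_[p]} (hϖ : ϖ ^ (p - 1) = -(p : ℂ_[p]))

theorem residueWeight_rec (hϖ0 : ϖ ≠ 0) (δ : ℂ_[p]) (μ n : ℕ) :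
    (n + (p * δ - μ)) * residueWeight p ϖ μ δ n + (p * ϖ) * residueWeight p ϖ μ δ (n + p) = 0 := by
  have hϖ1 : -ϖ ≠ 0 := neg_ne_zero.mpr hϖ0
  rw [residueWeight, residueWeight, Nat.add_mod_right, Nat.add_div_right _ hp.out.pos]
  split_ifs with h
  · have hn : (n : ℂ_[p]) = p * (n / p : ℕ) + μ := by
      have := Nat.div_add_mod n p
      rw [h] at this
      exact_mod_cast this.symm
    rw [risingFactorial_succ, pow_succ]
    generalize (n / p : ℕ) = i at *
    rw [hn]
    generalize hc : -ϖ = c at *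
    rw [← neg_neg ϖ, hc]
    field_simp
    ring
  · simp

theorem residueWeight_succ {μ : ℕ} (hμ : μ + 1 < p) (δ : ℂ_[p]) (n : ℕ) :
    residueWeight p ϖ (μ + 1) δ (n + 1) = residueWeight p ϖ μ δ n := by
  have h1 := Nat.div_add_mod n p
  have h2 := Nat.mod_lt n hp.out.pos
  rw [residueWeight, residueWeight]
  by_cases h : n % p = μ
  · have h3 : n + 1 = (μ + 1) + p * (n / p) := by omega
    have h4 : (n + 1) % p = μ + 1 := by
      rw [h3, Nat.add_mul_mod_self_left, Nat.mod_eq_of_lt hμ]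
    have h5 : (n + 1) / p = n / p := by
      conv_lhs => rw [h3]
      rw [Nat.add_mul_div_left _ _ hp.out.pos, Nat.div_eq_of_lt hμ, zero_add]
    rw [if_pos h, if_pos h4, h5]
  · rw [if_neg h, if_neg]
    intro h4
    apply h
    have h3 : n + 1 = p * ((n + 1) / p) + (μ + 1) := by rw [← h4]; exact (Nat.div_add_mod _ _).symm
    have h5 : n = μ + p * ((n + 1) / p) := by omega
    rw [h5, Nat.add_mul_mod_self_left, Nat.mod_eq_of_lt (by omega)]

theorem residueWeight_zero_succ (δ : ℂ_[p]) (n : ℕ) :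
    residueWeight p ϖ 0 δ (n + 1) = δ / (-ϖ) * residueWeight p ϖ (p - 1) (δ + 1) n := by
  have h1 := Nat.div_add_mod n p
  have hp1 := hp.out.one_lt
  rw [residueWeight, residueWeight]
  by_cases h : n % p = p - 1
  · have h3 : n + 1 = p * (n / p + 1) := by rw [mul_add]; omega
    have h4 : (n + 1) % p = 0 := by rw [h3, Nat.mul_mod_right]
    have h5 : (n + 1) / p = n / p + 1 := by
      conv_lhs => rw [h3]
      rw [Nat.mul_div_cancel_left _ hp.out.pos]
    rw [if_pos h, if_pos h4, h5, risingFactorial_succ', pow_succ, mul_comm (_ ^ _), mul_div_mul_comm]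
  · rw [if_neg h, if_neg, mul_zero]
    intro h4
    apply h
    obtain ⟨k, hk⟩ := Nat.dvd_of_mod_eq_zero h4
    obtain ⟨j, rfl⟩ : ∃ j, k = j + 1 := ⟨k - 1, by
      have : k ≠ 0 := by rintro rfl; simp at hk
      omega⟩
    have h5 : n = (p - 1) + p * j := by rw [mul_add] at hk; omega
    rw [h5, Nat.add_mul_mod_self_left, Nat.mod_eq_of_lt (by omega)]

include hϖ

theorem norm_residueWeight_le (μ : ℕ) (d : ℤ_[p]) (n : ℕ) :
    ‖residueWeight p ϖ μ (padicIntCast p d) n‖ ≤ p * (n + 1) := by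
  rw [residueWeight]
  split_ifs with h
  · rw [norm_div, norm_pow, norm_neg]
    refine (norm_risingFactorial_div_le hϖ d _).trans ?_
    have : ((n / p : ℕ) : ℝ) ≤ n := by exact_mod_cast Nat.div_le_self n p
    gcongr
  · rw [norm_zero]; positivity

/-- The weights grow at most linearly, uniformly in `d`, and the coefficients of the exponential
decay geometrically, so the series of continuous functions converges uniformly. -/
theorem continuous_residueSymbol (μ : ℕ) : Continuous (residueSymbol p ϖ μ) := by
  obtain ⟨R, hR, hb, -⟩ := exists_coeffBound_dworkExp hϖ
  have hR0 : 0 < R := by linarith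
  have hr : ‖R⁻¹‖ < 1 := by
    rw [Real.norm_of_nonneg (by positivity)]; exact inv_lt_one_of_one_lt₀ hR
  have hs : Summable fun n : ℕ => (p : ℝ) * ((n : ℝ) ^ 1 * R⁻¹ ^ n + R⁻¹ ^ n) :=
    ((summable_pow_mul_geometric_of_norm_lt_one 1 hr).add
      (summable_geometric_of_norm_lt_one hr)).mul_left _
  refine continuous_tsum (fun n => ?_) hs fun n d => ?_
  · refine Continuous.mul ?_ continuous_const
    unfold residueWeight
    split_ifs
    · refine Continuous.div_const ?_ _
      unfold risingFactorial
      exact continuous_finsetProd _ fun i _ => continuous_padicIntCast.add continuous_const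
    · exact continuous_const
  · have h1 : ‖coeff n (dworkExp p ϖ)‖ ≤ R⁻¹ ^ n := by
      rw [inv_pow, ← one_div]
      exact (le_div_iff₀ (by positivity)).mpr (hb n)
    rw [norm_mul]
    calc _ ≤ (p : ℝ) * (n + 1) * R⁻¹ ^ n := by
          gcongr; exact norm_residueWeight_le hϖ μ d n
      _ = _ := by ring

/-- The functional is applied to the exponential itself. Its differential equation cancels the `X ^
p` term of the operator and leaves a shift by one degree, which links the residue `μ` to `μ - 1`. -/
theorem residueSymbol_rec (μ : ℕ) (d : ℤ_[p]) :
    (p * padicIntCast p d - μ) * residueSymbol p ϖ μ d + ϖ *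
      ∑' n, residueWeight p ϖ μ (padicIntCast p d) (n + 1) * coeff n (dworkExp p ϖ) = 0 := by
  have hb := norm_residueWeight_le hϖ μ d
  have hE := dworkExp_mem_dagger hϖ
  have h := tsum_mul_coeff_eulerOp_eq_zero hE hb
    (residueWeight_rec (unif_ne_zero hϖ) (padicIntCast p d) μ)
  have e : eulerOp (dworkExp p ϖ) + C (p * padicIntCast p d - μ) * dworkExp p ϖ +
      C (p * ϖ) * (X ^ p * dworkExp p ϖ) =
      C (p * padicIntCast p d - μ) * dworkExp p ϖ + C ϖ * (X ^ 1 * dworkExp p ϖ) := by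
    rw [eulerOp_dworkExp]; ring
  have s1 := (summable_mul_coeff hE hb).mul_left (p * padicIntCast p d - μ)
  have s2 := (summable_mul_coeff (mul_mem_dagger (X_pow_mem_dagger 1) hE) hb).mul_left ϖ
  have e2 : ∀ n, residueWeight p ϖ μ (padicIntCast p d) n *
      coeff n (C (p * padicIntCast p d - μ) * dworkExp p ϖ + C ϖ * (X ^ 1 * dworkExp p ϖ)) =
      (p * padicIntCast p d - μ) *
        (residueWeight p ϖ μ (padicIntCast p d) n * coeff n (dworkExp p ϖ)) +
      ϖ * (residueWeight p ϖ μ (padicIntCast p d) n * coeff n (X ^ 1 * dworkExp p ϖ)) := fun n => by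
    rw [map_add, coeff_C_mul, coeff_C_mul]; ring
  rw [e] at h
  simp_rw [e2] at h
  rwa [s1.tsum_add s2, tsum_mul_left, tsum_mul_left, tsum_mul_coeff_X_pow_mul hE hb] at h

theorem residueSymbol_pred {μ : ℕ} (hμ : μ + 1 < p) (d : ℤ_[p]) :
    ϖ * residueSymbol p ϖ μ d =
      -(p * padicIntCast p d - (μ + 1 : ℕ)) * residueSymbol p ϖ (μ + 1) d := by
  have h := residueSymbol_rec hϖ (μ + 1) d
  simp_rw [residueWeight_succ hμ] at h
  rw [← residueSymbol] at h
  linear_combination h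

/-- The recursion at `μ = 0` gives this identity multiplied by `d`. Cancelling `d` is legitimate for
`d ≠ 0`, and continuity supplies `d = 0`. -/
theorem residueSymbol_prime_sub_one (d : ℤ_[p]) :
    residueSymbol p ϖ (p - 1) (d + 1) = p * residueSymbol p ϖ 0 d := by
  have hϖ0 := unif_ne_zero hϖ
  have hdense : Dense {d : ℤ_[p] | d ≠ 0} := by
    have : NeBot (𝓝[≠] (0 : ℤ_[p])) := by
      rw [← mem_closure_iff_nhdsWithin_neBot]
      rw [Metric.mem_closure_iff]
      intro ε hε
      obtain ⟨k, hk⟩ := PadicInt.exists_pow_neg_lt p hε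
      refine ⟨(p : ℤ_[p]) ^ k, ?_, ?_⟩
      · exact pow_ne_zero k (by exact_mod_cast hp.out.ne_zero)
      · rwa [dist_comm, dist_zero_right, PadicInt.norm_p_pow]
    exact dense_compl_singleton 0
  have hc1 : Continuous fun d : ℤ_[p] => residueSymbol p ϖ (p - 1) (d + 1) :=
    (continuous_residueSymbol hϖ _).comp (continuous_id.add continuous_const)
  have hc2 : Continuous fun d : ℤ_[p] => p * residueSymbol p ϖ 0 d :=
    continuous_const.mul (continuous_residueSymbol hϖ _)
  refine congr_fun (Continuous.ext_on hdense hc1 hc2 fun d hd => ?_) d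
  have h := residueSymbol_rec hϖ 0 d
  have hd0 : padicIntCast p d ≠ 0 := by
    rw [← norm_pos_iff, norm_padicIntCast]; exact norm_pos_iff.mpr hd
  simp_rw [residueWeight_zero_succ, mul_assoc] at h
  rw [tsum_mul_left, ← map_one (padicIntCast p), ← map_add, ← residueSymbol] at h
  have h2 : padicIntCast p d * (residueSymbol p ϖ (p - 1) (d + 1)) =
      padicIntCast p d * (p * residueSymbol p ϖ 0 d) := by
    have h3 : ϖ * (padicIntCast p d / -ϖ * residueSymbol p ϖ (p - 1) (d + 1)) =
        -(padicIntCast p d * residueSymbol p ϖ (p - 1) (d + 1)) := by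
      rw [div_neg]; field_simp
    rw [h3, Nat.cast_zero, sub_zero] at h
    linear_combination -h
  exact mul_left_cancel₀ hd0 h2

omit hϖ in
theorem residueSymbol_zero_zero : residueSymbol p ϖ 0 0 = 1 := by
  rw [residueSymbol, tsum_eq_single 0]
  · rw [coeff_zero_dworkExp]
    simp [residueWeight, risingFactorial]
  · intro n hn
    rw [residueWeight]
    split_ifs with h
    · have : n / p ≠ 0 := by
        intro h0
        have := Nat.div_add_mod n p
        rw [h, h0] at this
        simp at this
        exact hn this.symm
      obtain ⟨j, hj⟩ := Nat.exists_eq_succ_of_ne_zero this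
      rw [hj, map_zero, Nat.succ_eq_add_one, risingFactorial_succ']
      simp
    · rw [zero_mul]

omit hϖ in
variable (p) in
/-- The function `n ↦ (-1) ^ n ∏_{0 < k < n, p ∤ k} k` interpolated by Morita's gamma function. -/
def moritaFactorial (n : ℕ) : ℤ_[p] :=
  (-1) ^ n * ∏ k ∈ (Finset.range n).filter (fun k => ¬ p ∣ k), (k : ℤ_[p])

omit hϖ in
theorem moritaFactorial_succ_of_dvd {n : ℕ} (h : p ∣ n) :
    moritaFactorial p (n + 1) = -moritaFactorial p n := by
  rw [moritaFactorial, moritaFactorial, Finset.range_add_one, Finset.filter_insert,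
    if_neg (not_not.mpr h), pow_succ]
  ring

omit hϖ in
theorem moritaFactorial_succ_of_not_dvd {n : ℕ} (h : ¬ p ∣ n) :
    moritaFactorial p (n + 1) = -n * moritaFactorial p n := by
  rw [moritaFactorial, moritaFactorial, Finset.range_add_one, Finset.filter_insert, if_pos h,
    Finset.prod_insert (by simp), pow_succ]
  ring

/-- Induction on `n`, with `n = p b - μ`. A step lowers `μ` by one and multiplies both sides alike;
when `p ∣ n` it wraps from `μ = 0` to `p - 1` and raises `b`, and `ϖ ^ (p - 1) = -p` accounts for
the sign. -/
theorem exists_moritaFactorial_mul_eq (n : ℕ) :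
    ∃ μ < p, ∃ b : ℕ, n + μ = p * b ∧
      padicIntCast p (moritaFactorial p n) * ϖ ^ μ = residueSymbol p ϖ μ b := by
  have hϖ0 := unif_ne_zero hϖ
  induction n with
  | zero =>
    refine ⟨0, hp.out.pos, 0, by simp, ?_⟩
    rw [Nat.cast_zero, residueSymbol_zero_zero]
    simp [moritaFactorial]
  | succ n ih =>
    obtain ⟨μ, hμ, b, hb, h⟩ := ih
    cases μ with
    | zero =>
      refine ⟨p - 1, by have := hp.out.pos; omega, b + 1, ?_, ?_⟩
      · have := hp.out.pos
        rw [mul_add]; omega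
      · rw [moritaFactorial_succ_of_dvd ⟨b, by omega⟩, Nat.cast_succ,
          residueSymbol_prime_sub_one hϖ, ← h, hϖ, map_neg]
        ring
    | succ μ =>
      refine ⟨μ, by omega, b, by omega, ?_⟩
      have hn : ¬ p ∣ n := fun hd => by
        have h1 : p ∣ μ + 1 := (Nat.dvd_add_right hd).mp ⟨b, hb⟩
        exact absurd (Nat.le_of_dvd (Nat.succ_pos μ) h1) (not_le.mpr hμ)
      have h2 := residueSymbol_pred hϖ hμ (b : ℤ_[p])
      have h3 : (n : ℂ_[p]) + (μ + 1 : ℕ) = p * b := by exact_mod_cast hb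
      rw [moritaFactorial_succ_of_not_dvd hn, map_mul, map_neg, map_natCast]
      apply mul_left_cancel₀ hϖ0
      rw [h2, ← h, map_natCast]
      linear_combination -(padicIntCast p (moritaFactorial p n) * ϖ ^ (μ + 1)) * h3

/-- Dwork's formula for Morita's gamma function. -/
theorem moritaGamma_mul_pow {μ : ℕ} (hμ : μ < p) (d : ℤ_[p]) :
    padicIntCast p (moritaGamma p (p * d - μ)) * ϖ ^ μ = residueSymbol p ϖ μ d := by
  have hϖ0 := unif_ne_zero hϖ
  have hp0 : (0 : ℝ) < p := by exact_mod_cast hp.out.pos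
  set x : ℤ_[p] := p * d - μ with hx
  set l := comap (Nat.cast : ℕ → ℤ_[p]) (𝓝 x) with hl
  have : l.NeBot := comap_neBot_iff.mpr fun t ht => PadicInt.denseRange_natCast.mem_nhds ht
  have hcast : Tendsto (Nat.cast : ℕ → ℤ_[p]) l (𝓝 x) := tendsto_comap
  -- Natural numbers close to `x` are congruent to `-μ` modulo `p`, which forces the residue
  -- supplied by the induction to be `μ`.
  have hev : ∀ᶠ n : ℕ in l, n + μ = p * ((n + μ) / p) ∧
      padicIntCast p (moritaFactorial p n) * ϖ ^ μ =
        residueSymbol p ϖ μ (((n + μ) / p : ℕ) : ℤ_[p]) := by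
    filter_upwards [hcast (Metric.ball_mem_nhds x one_pos)] with n hn
    rw [Set.mem_preimage, Metric.mem_ball, dist_eq_norm] at hn
    have hdvd : p ∣ n + μ := by
      rw [← PadicInt.norm_natCast_lt_one_iff]
      have : ((n + μ : ℕ) : ℤ_[p]) = (n - x) + p * d := by rw [hx]; push_cast; ring
      rw [this]
      refine PadicInt.norm_lt_one_add hn ?_
      rw [norm_mul, PadicInt.norm_p]
      exact (mul_le_of_le_one_right (by positivity) d.norm_le_one).trans_lt
        (inv_lt_one_of_one_lt₀ (by exact_mod_cast hp.out.one_lt))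
    obtain ⟨ν, hν, b, hb, h⟩ := exists_moritaFactorial_mul_eq hϖ n
    have hνμ : ν = μ := by
      have h1 : n + ν ≡ n + μ [MOD p] := by
        rw [hb]
        exact ((Nat.modEq_zero_iff_dvd).mpr (dvd_mul_right p b)).trans
          ((Nat.modEq_zero_iff_dvd).mpr hdvd).symm
      exact Nat.ModEq.eq_of_lt_of_lt (Nat.ModEq.add_left_cancel' n h1) hν hμ
    subst hνμ
    rw [hb, Nat.mul_div_cancel_left _ hp.out.pos]
    exact ⟨rfl, h⟩
  have hb : Tendsto (fun n : ℕ => (((n + μ) / p : ℕ) : ℤ_[p])) l (𝓝 d) := by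
    rw [tendsto_iff_norm_sub_tendsto_zero]
    have h1 : Tendsto (fun n : ℕ => (p : ℝ) * ‖(n : ℤ_[p]) - x‖) l (𝓝 0) := by
      have := (tendsto_iff_norm_sub_tendsto_zero.mp hcast).const_mul (p : ℝ)
      rwa [mul_zero] at this
    refine h1.congr' ?_
    filter_upwards [hev] with n hn
    have h2 : (n : ℤ_[p]) - x = p * ((((n + μ) / p : ℕ) : ℤ_[p]) - d) := by
      have : ((n + μ : ℕ) : ℤ_[p]) = p * (((n + μ) / p : ℕ) : ℤ_[p]) := by
        exact_mod_cast congrArg (Nat.cast : ℕ → ℤ_[p]) hn.1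
      push_cast at this
      rw [hx, mul_sub]
      linear_combination this
    rw [h2, norm_mul, PadicInt.norm_p, mul_inv_cancel_left₀ hp0.ne']
  have hlim : Tendsto (fun n => padicIntCast p (moritaFactorial p n)) l
      (𝓝 (residueSymbol p ϖ μ d / ϖ ^ μ)) := by
    have h1 := (((continuous_residueSymbol hϖ μ).tendsto d).comp hb).div_const (ϖ ^ μ)
    refine h1.congr' ?_
    filter_upwards [hev] with n hn
    rw [Function.comp_apply, ← hn.2, mul_div_cancel_right₀ _ (pow_ne_zero μ hϖ0)]
  have hiso : Isometry (padicIntCast p) :=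
    AddMonoidHomClass.isometry_of_norm (padicIntCast p) norm_padicIntCast
  -- The limit is a priori in `ℂ_p`; it lies in `ℤ_p` because the isometric image of `ℤ_p` is
  -- closed. This proves that the limit defining `moritaGamma` exists.
  obtain ⟨L, hL⟩ : residueSymbol p ϖ μ d / ϖ ^ μ ∈ Set.range (padicIntCast p) :=
    hiso.isClosedEmbedding.isClosed_range.mem_of_tendsto hlim
      (Eventually.of_forall fun n => ⟨_, rfl⟩)
  rw [← hL] at hlim
  have hlim' : Tendsto (moritaFactorial p) l (𝓝 L) :=
    (hiso.isClosedEmbedding.isInducing.tendsto_nhds_iff).mpr hlim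
  have : moritaGamma p x = L := hlim'.limUnder_eq
  rw [this, hL, div_mul_cancel₀ _ (pow_ne_zero μ hϖ0)]

omit hϖ in
theorem padicIntCast_injective : Function.Injective (padicIntCast p) :=
  (AddMonoidHomClass.isometry_of_norm (padicIntCast p) norm_padicIntCast).injective

/-- The functional equation of `Γ_p` at units, read off from the recursion of the symbols in `μ`;
the argument is a unit because `0 < μ + 1 < p`. -/
theorem moritaGamma_add_one_of_residue {μ : ℕ} (hμ : μ + 1 < p) (d : ℤ_[p]) :
    moritaGamma p (p * d - (μ + 1 : ℕ) + 1) =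
      -(p * d - (μ + 1 : ℕ)) * moritaGamma p (p * d - (μ + 1 : ℕ)) := by
  have hϖ0 := unif_ne_zero hϖ
  apply padicIntCast_injective
  have h1 := moritaGamma_mul_pow hϖ hμ d
  have h2 := moritaGamma_mul_pow hϖ (μ := μ) (by omega) d
  have h3 := residueSymbol_pred hϖ hμ d
  have e : (p * d - (μ + 1 : ℕ) + 1 : ℤ_[p]) = p * d - μ := by push_cast; ring
  rw [← h1, ← h2] at h3
  rw [e]
  apply mul_right_cancel₀ (pow_ne_zero (μ + 1) hϖ0)
  rw [map_mul, map_neg, map_sub, map_mul, map_natCast, map_natCast]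
  linear_combination h3

theorem moritaGamma_add_one_of_mul_prime (d : ℤ_[p]) :
    moritaGamma p (p * d + 1) = -moritaGamma p (p * d) := by
  apply padicIntCast_injective
  have hp0 : (p : ℂ_[p]) ≠ 0 := by exact_mod_cast hp.out.ne_zero
  have h1 := moritaGamma_mul_pow hϖ hp.out.pos d
  have h2 := moritaGamma_mul_pow hϖ (Nat.sub_one_lt hp.out.ne_zero) (d + 1)
  have h3 := residueSymbol_prime_sub_one hϖ d
  rw [Nat.cast_zero, sub_zero, pow_zero, mul_one] at h1
  have e : (p * (d + 1) - (p - 1 : ℕ) : ℤ_[p]) = p * d + 1 := by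
    rw [Nat.cast_sub hp.out.one_lt.le]; push_cast; ring
  rw [e, hϖ] at h2
  rw [map_neg]
  apply mul_right_cancel₀ (neg_ne_zero.mpr hp0)
  rw [h2, h3, ← h1]
  ring

theorem hasSum_dworkGammaTerm_of_lt {T : ℕ} (hT : T < p) (d : ℤ_[p]) :
    HasSum (dworkGammaTerm p ϖ T (padicIntCast p d))
      (padicIntCast p (moritaGamma p (p * d - T)) * ϖ ^ T) := by
  have h := hasSum_dworkGammaTerm hϖ T d
  simp_rw [symbolWeight_eq_residueWeight _ _ hT] at h
  rw [moritaGamma_mul_pow hϖ hT]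
  exact h

theorem hasSum_dworkGammaTerm_of_ge {μ : ℕ} (hμ : μ < p) {d : ℤ_[p]} (hd : padicIntCast p d ≠ 1) :
    HasSum (dworkGammaTerm p ϖ (μ + p : ℕ) (padicIntCast p d))
      (-ϖ / (padicIntCast p d - 1) *
        (padicIntCast p (moritaGamma p (p * d - (μ + p : ℕ))) * ϖ ^ μ)) := by
  have h := hasSum_dworkGammaTerm hϖ (μ + p) d
  simp_rw [symbolWeight_add_prime (unif_ne_zero hϖ) hd hμ, mul_assoc] at h
  have e : (p * d - (μ + p : ℕ) : ℤ_[p]) = p * (d - 1) - μ := by push_cast; ring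
  rw [e, moritaGamma_mul_pow hϖ hμ, residueSymbol, map_sub, map_one]
  rwa [tsum_mul_left] at h

end Gamma
end

noncomputable section

/-! ### The explicit scalar -/

section Scalar

variable {p : ℕ} [hp : Fact p.Prime]

theorem ratToPadicInt_eq {x : ℚ} {z : ℤ_[p]} (h : (x : ℚ_[p]) = z) : ratToPadicInt p x = z := by
  have hx : ‖(x : ℚ_[p])‖ ≤ 1 := by rw [h]; exact z.2
  have h1 : ratToPadicInt p x = ⟨x, hx⟩ := dif_pos hx
  rw [h1]
  exact Subtype.ext h

theorem padicIntCast_eq_ratCast {x : ℚ} {z : ℤ_[p]} : padicIntCast p z = (x : ℂ_[p]) ↔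
    (x : ℚ_[p]) = z := by
  rw [padicIntCast_apply, ← map_ratCast (algebraMap ℚ_[p] ℂ_[p]) x,
    (algebraMap ℚ_[p] ℂ_[p]).injective.eq_iff, eq_comm]

theorem padicIntCast_ratToPadicInt {x : ℚ} (hx : ‖(x : ℚ_[p])‖ ≤ 1) :
    padicIntCast p (ratToPadicInt p x) = x := by
  have h1 : ratToPadicInt p x = ⟨x, hx⟩ := dif_pos hx
  rw [padicIntCast_eq_ratCast, h1]

/-- As `x` is `p`-integral, the integer `p x` is divisible by `p`, so `x` is an integer of absolute
value less than `1`. -/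
theorem eq_zero_of_prime_mul_eq_intCast {x : ℚ} (hx : ‖(x : ℚ_[p])‖ ≤ 1) (h1 : |x| < 1) {m : ℤ}
    (hm : (p : ℚ) * x = m) : x = 0 := by
  have hp0 : (p : ℚ) ≠ 0 := by exact_mod_cast hp.out.ne_zero
  have h2 : ‖(m : ℚ_[p])‖ < 1 := by
    have : (m : ℚ_[p]) = p * (x : ℚ_[p]) := by exact_mod_cast congrArg (Rat.cast : ℚ → ℚ_[p]) hm.symm
    rw [this, norm_mul, Padic.norm_p]
    exact (mul_le_of_le_one_right (by positivity) hx).trans_lt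
      (inv_lt_one_of_one_lt₀ (by exact_mod_cast hp.out.one_lt))
  obtain ⟨k, rfl⟩ := Padic.norm_intCast_lt_one_iff.mp h2
  have h3 : x = k := by
    push_cast at hm
    exact mul_left_cancel₀ hp0 hm
  rw [h3] at h1 ⊢
  have h4 : |k| < 1 := by exact_mod_cast h1
  rw [Int.abs_lt_one_iff.mp h4, Int.cast_zero]

/-- The evaluation of Dwork's symbol in terms of Morita's gamma function. -/
theorem hasSum_rankOneScalar {ϖ : ℂ_[p]} (hϖ : ϖ ^ (p - 1) = -(p : ℂ_[p])) {α β α' β' : ℚ}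
    (hα' : 0 ≤ α' ∧ α' < 1) (hβ' : 0 ≤ β' ∧ β' < 1) (hne : α ≠ β) (hne' : α' ≠ β') {d : ℤ_[p]}
    (hd : padicIntCast p d = (α : ℂ_[p]) - (β : ℂ_[p]) + 1) {n : ℕ} {μ : ℤ} (hn : n + 1 < 2 * p)
    (hnμ : (n : ℤ) = μ + (p - 1)) (hμ : (μ : ℚ) = p * (α - β) - (α' - β')) :
    HasSum (dworkGammaTerm p ϖ n (padicIntCast p d)) (rankOneScalar p ϖ α β α' β' μ) := by
  have hϖ0 := unif_ne_zero hϖ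
  have hp1 := hp.out.one_lt
  have hpq : (1 : ℚ) < p := by exact_mod_cast hp1
  have hαβ : (α : ℂ_[p]) - β ≠ 0 := sub_ne_zero.mpr (by exact_mod_cast hne)
  have hμC : (μ : ℂ_[p]) = p * ((α : ℂ_[p]) - β) - ((α' : ℂ_[p]) - β') := by
    exact_mod_cast congrArg (Rat.cast : ℚ → ℂ_[p]) hμ
  have hnC : (n : ℂ_[p]) = μ + (p - 1) := by exact_mod_cast congrArg (Int.cast : ℤ → ℂ_[p]) hnμ
  have hpow : ϖ ^ n = -(p : ℂ_[p]) * ϖ ^ μ := by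
    rw [← zpow_natCast, hnμ, zpow_add₀ hϖ0, ← hϖ, mul_comm, ← zpow_natCast ϖ (p - 1),
      Nat.cast_sub hp1.le, Nat.cast_one]
  have hd' : padicIntCast p (p * d - n) = (α' : ℂ_[p]) - β' + 1 := by
    rw [map_sub, map_mul, map_natCast, map_natCast, hd, hnC, hμC]; ring
  have hfract_lt : α' < β' → ratToPadicInt p (Int.fract (α' - β')) = p * d - n := by
    intro h
    have : Int.fract (α' - β') = α' - β' + 1 := by
      rw [← Int.fract_add_one]
      exact Int.fract_eq_self.mpr ⟨by linarith, by linarith⟩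
    rw [this]
    refine ratToPadicInt_eq (padicIntCast_eq_ratCast.mp ?_)
    rw [hd']; push_cast; ring
  have hfract_gt : β' < α' → ratToPadicInt p (Int.fract (α' - β')) = p * d - n - 1 := by
    intro h
    have : Int.fract (α' - β') = α' - β' := Int.fract_eq_self.mpr ⟨by linarith, by linarith⟩
    rw [this]
    refine ratToPadicInt_eq (padicIntCast_eq_ratCast.mp ?_)
    rw [map_sub, hd', map_one]; push_cast; ring
  rw [rankOneScalar, ← padicIntCast_apply]
  -- For `n < p` Dwork's formula applies directly and gives `-p ϖ ^ μ Γ_p(α' - β' + 1)`. For `n ≥ p`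
  -- the index must be shifted first. In both cases the functional equation moves the argument to
  -- the fractional part.
  rcases lt_or_ge n p with hnp | hnp
  · have h := hasSum_dworkGammaTerm_of_lt hϖ hnp d
    convert h using 1
    rw [hpow]
    rcases lt_or_gt_of_ne hne with hlt | hgt
    · rw [if_neg hlt.not_gt]
      rcases lt_or_gt_of_ne hne' with hlt' | hgt'
      · rw [if_neg hlt'.not_gt, hfract_lt hlt']
        ring
      · rw [if_pos hgt', hfract_gt hgt']
        have hμ0 : μ < 0 := by
          have : (μ : ℚ) < 0 := by rw [hμ]; nlinarith
          exact_mod_cast this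
        have hn1 : n + 1 < p := by omega
        have h2 := moritaGamma_add_one_of_residue hϖ hn1 d
        have e1 : (p * d - n - 1 : ℤ_[p]) = p * d - (n + 1 : ℕ) := by push_cast; ring
        have e2 : (p * d - n : ℤ_[p]) = p * d - (n + 1 : ℕ) + 1 := by push_cast; ring
        have e3 : padicIntCast p (p * d - (n + 1 : ℕ)) = (α' : ℂ_[p]) - β' := by
          rw [← e1, map_sub, hd', map_one]; ring
        rw [e1, e2, h2, map_mul, map_neg, e3]
        ring
    -- Here `μ > -1` because `α > β`, while `n < p` means `μ ≤ 0`. Hence `α' - β' = p (α - β)`, and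
    -- the functional equation is the one at multiples of `p`.
    · have hμ0 : μ = 0 := by
        have h1 : (-1 : ℚ) < μ := by rw [hμ]; nlinarith
        have h2 : (-1 : ℤ) < μ := by exact_mod_cast h1
        omega
      have hgt' : β' < α' := by
        rw [hμ0, Int.cast_zero] at hμ
        nlinarith
      rw [if_pos hgt, if_pos hgt', hfract_gt hgt']
      have h2 := moritaGamma_add_one_of_mul_prime hϖ (d - 1)
      have hnp' : n = p - 1 := by omega
      have e1 : (p * d - n - 1 : ℤ_[p]) = p * (d - 1) := by
        rw [hnp', Nat.cast_sub hp1.le]; push_cast; ring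
      have e2 : (p * d - n : ℤ_[p]) = p * (d - 1) + 1 := by rw [← e1]; ring
      have e3 : (α' : ℂ_[p]) - β' = p * ((α : ℂ_[p]) - β) := by
        rw [hμ0, Int.cast_zero] at hμC
        linear_combination hμC
      rw [e1, e2, h2, map_neg, e3]
      field_simp
  · obtain ⟨m, rfl⟩ : ∃ m, n = m + p := ⟨n - p, by omega⟩
    -- Now `μ ≥ 1`, which excludes `α ≤ β`; this is where the factor `1 / (α - β)` comes from.
    have hμm : μ = m + 1 := by push_cast at hnμ; omega
    have hgt : β < α := by
      by_contra! hle
      have h1 : (μ : ℚ) < 1 := by rw [hμ]; nlinarith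
      have h2 : μ < 1 := by exact_mod_cast h1
      omega
    have hd1 : padicIntCast p d ≠ 1 := by
      rw [hd]
      intro h
      exact hαβ (by linear_combination h)
    have h := hasSum_dworkGammaTerm_of_ge hϖ (μ := m) (by omega) hd1
    convert h using 1
    have hpow2 : ϖ ^ μ = ϖ ^ m * ϖ := by
      rw [hμm, zpow_add₀ hϖ0, zpow_natCast, zpow_one]
    have hd2 : padicIntCast p d - 1 = (α : ℂ_[p]) - β := by rw [hd]; ring
    rw [if_pos hgt, hpow2, hd2]
    rcases lt_or_gt_of_ne hne' with hlt' | hgt'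
    · rw [if_neg hlt'.not_gt, hfract_lt hlt']
      field_simp
    · rw [if_pos hgt', hfract_gt hgt']
      have hm1 : m + 1 < p := by omega
      have h2 := moritaGamma_add_one_of_residue hϖ hm1 (d - 1)
      have e1 : (p * d - (m + p : ℕ) - 1 : ℤ_[p]) = p * (d - 1) - (m + 1 : ℕ) := by push_cast; ring
      have e2 : (p * d - (m + p : ℕ) : ℤ_[p]) = p * (d - 1) - (m + 1 : ℕ) + 1 := by push_cast; ring
      have e3 : padicIntCast p (p * (d - 1) - (m + 1 : ℕ)) = (α' : ℂ_[p]) - β' := by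
        rw [← e1, map_sub, hd', map_one]; ring
      rw [e1, e2, h2, map_mul, map_neg, e3]
      field_simp

theorem rankOneScalar_mem (ϖ : ℂ_[p]) (α β α' β' : ℚ) (μ : ℤ) :
    rankOneScalar p ϖ α β α' β' μ ∈ IntermediateField.adjoin ℚ_[p] {ϖ} := by
  have hr : ∀ x : ℚ, (x : ℂ_[p]) ∈ IntermediateField.adjoin ℚ_[p] {ϖ} := fun x =>
    SubfieldClass.ratCast_mem _ x
  rw [rankOneScalar]
  refine mul_mem (mul_mem (mul_mem (zpow_mem (IntermediateField.mem_adjoin_simple_self _ _) _)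
    (IntermediateField.algebraMap_mem _ _)) ?_) ?_
  · split_ifs
    · exact div_mem (one_mem _) (sub_mem (hr _) (hr _))
    · exact natCast_mem _ _
  · split_ifs
    · exact sub_mem (hr _) (hr _)
    · exact neg_mem (one_mem _)

end Scalar

/-! ### Rational functions on subsets of `ℂ_p` -/

section Rational

variable {p : ℕ} [hp : Fact p.Prime] {K : IntermediateField ℚ_[p] ℂ_[p]} {S : Set ℂ_[p]}

/-- `f` agrees on `S` with a rational function over `K` without poles in `S`. -/
def IsRationalOn (K : IntermediateField ℚ_[p] ℂ_[p]) (S : Set ℂ_[p]) (f : ℂ_[p] → ℂ_[p]) : Prop :=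
  ∃ P Q : Polynomial K, ∀ z ∈ S, Polynomial.aeval z Q ≠ 0 ∧
    f z = Polynomial.aeval z P / Polynomial.aeval z Q

theorem IsRationalOn.const {c : ℂ_[p]} (hc : c ∈ K) : IsRationalOn K S fun _ => c :=
  ⟨Polynomial.C ⟨c, hc⟩, 1, fun z _ => by
    rw [map_one, Polynomial.aeval_C, div_one]; exact ⟨one_ne_zero, rfl⟩⟩

theorem IsRationalOn.id : IsRationalOn K S fun z => z :=
  ⟨Polynomial.X, 1, fun z _ => by simp⟩

theorem IsRationalOn.add {f g : ℂ_[p] → ℂ_[p]} (hf : IsRationalOn K S f) (hg : IsRationalOn K S g) :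
    IsRationalOn K S fun z => f z + g z := by
  obtain ⟨P, Q, h⟩ := hf
  obtain ⟨P', Q', h'⟩ := hg
  refine ⟨P * Q' + Q * P', Q * Q', fun z hz => ?_⟩
  obtain ⟨h1, h2⟩ := h z hz
  obtain ⟨h3, h4⟩ := h' z hz
  beta_reduce
  rw [h2, h4, div_add_div _ _ h1 h3]
  simp only [map_mul, map_add]
  exact ⟨mul_ne_zero h1 h3, trivial⟩

theorem IsRationalOn.mul {f g : ℂ_[p] → ℂ_[p]} (hf : IsRationalOn K S f) (hg : IsRationalOn K S g) :
    IsRationalOn K S fun z => f z * g z := by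
  obtain ⟨P, Q, h⟩ := hf
  obtain ⟨P', Q', h'⟩ := hg
  refine ⟨P * P', Q * Q', fun z hz => ?_⟩
  obtain ⟨h1, h2⟩ := h z hz
  obtain ⟨h3, h4⟩ := h' z hz
  beta_reduce
  rw [h2, h4, div_mul_div_comm]
  simp only [map_mul]
  exact ⟨mul_ne_zero h1 h3, trivial⟩

theorem IsRationalOn.inv {f : ℂ_[p] → ℂ_[p]} (hf : IsRationalOn K S f) (h0 : ∀ z ∈ S, f z ≠ 0) :
    IsRationalOn K S fun z => (f z)⁻¹ := by
  obtain ⟨P, Q, h⟩ := hf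
  refine ⟨Q, P, fun z hz => ?_⟩
  obtain ⟨h1, h2⟩ := h z hz
  refine ⟨fun hP => h0 z hz (by rw [h2, hP, zero_div]), ?_⟩
  beta_reduce
  rw [h2, inv_div]

theorem IsRationalOn.pow {f : ℂ_[p] → ℂ_[p]} (hf : IsRationalOn K S f) (n : ℕ) :
    IsRationalOn K S fun z => f z ^ n := by
  induction n with
  | zero => simpa using IsRationalOn.const (one_mem K)
  | succ n ih => simpa only [pow_succ] using ih.mul hf

theorem IsRationalOn.zpow {f : ℂ_[p] → ℂ_[p]} (hf : IsRationalOn K S f) (h0 : ∀ z ∈ S, f z ≠ 0)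
    (n : ℤ) : IsRationalOn K S fun z => f z ^ n := by
  rcases n with n | n
  · simpa using hf.pow n
  · simpa only [zpow_negSucc] using (hf.pow (n + 1)).inv fun z hz => pow_ne_zero _ (h0 z hz)

theorem IsRationalOn.sum {ι : Type*} (s : Finset ι) {f : ι → ℂ_[p] → ℂ_[p]}
    (hf : ∀ i ∈ s, IsRationalOn K S (f i)) : IsRationalOn K S fun z => ∑ i ∈ s, f i z := by
  classical
  induction s using Finset.induction_on with
  | empty => simpa using IsRationalOn.const (zero_mem K)
  | insert i s hi ih =>
    simp only [Finset.sum_insert hi]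
    exact (hf i (by simp)).add (ih fun j hj => hf j (by simp [hj]))

end Rational

/-! ### The Frobenius intertwiner -/

section Intertwiner

variable {p : ℕ} [hp : Fact p.Prime]

/-- The one-unit `(1 + (-z) ^ p) / (1 - z) ^ p` measuring the failure of the Frobenius lift to be the
`p`-th power of `1 - z`. -/
def frobQuotient (p : ℕ) [Fact p.Prime] (z : ℂ_[p]) : ℂ_[p] := (1 + (-z) ^ p) / (1 - z) ^ p

theorem one_sub_frobLift (z : ℂ_[p]) : 1 - frobLift p z = 1 + (-z) ^ p := by
  rw [frobLift, sub_neg_eq_add]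

/-- The function `c (-z) ^ i (1 - z) ^ j ((1 + (-z) ^ p) / (1 - z) ^ p) ^ d`. -/
def rankOneFun (c : ℂ_[p]) (i j : ℤ) (d : ℤ_[p]) (z : ℂ_[p]) : ℂ_[p] :=
  c * (-z) ^ i * (1 - z) ^ j * padicPow (frobQuotient p z) d

/-- Numerator and denominator differ by `p` times mixed terms of size at most `r ^ (-p)`, and the
denominator has norm at least `r ^ p`. -/
theorem norm_frobQuotient_sub_one_le {z : ℂ_[p]} {r : ℝ} (hr0 : 0 < r) (hr1 : r ≤ 1)
    (hz : ‖z‖ ≤ r⁻¹) (hz1 : r ≤ ‖z - 1‖) :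
    ‖frobQuotient p z - 1‖ ≤ (p : ℝ)⁻¹ * r⁻¹ ^ (2 * p) := by
  rw [norm_sub_rev] at hz1
  have hne : (1 - z) ^ p ≠ 0 := pow_ne_zero p (norm_pos_iff.mp (hr0.trans_le hz1))
  have h1 := norm_add_pow_prime_sub_le (p := p) (x := 1) (y := -z) (M := r⁻¹)
    (by rw [norm_one]; exact (one_le_inv₀ hr0).mpr hr1) (by rwa [norm_neg])
  rw [one_pow, ← sub_eq_add_neg 1 z] at h1
  rw [frobQuotient, div_sub_one hne, norm_div, norm_pow, two_mul, pow_add, ← mul_assoc, inv_pow r p,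
    ← div_eq_mul_inv _ (r ^ p), ← inv_pow]
  gcongr

theorem norm_zpow_le {u : ℂ_[p]} {r : ℝ} (hr0 : 0 < r) (h1 : r ≤ ‖u‖) (h2 : ‖u‖ ≤ r⁻¹) (i : ℤ) :
    ‖u ^ i‖ ≤ r⁻¹ ^ i.natAbs := by
  have hu : 0 < ‖u‖ := hr0.trans_le h1
  rcases Int.natAbs_eq i with h | h
  · conv_lhs => rw [h]
    rw [zpow_natCast, norm_pow]
    gcongr
  · conv_lhs => rw [h]
    rw [zpow_neg, zpow_natCast, norm_inv, norm_pow, ← inv_pow]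
    gcongr

theorem norm_padicPow_sub_sum_le {u : ℂ_[p]} (hu : ‖u - 1‖ < 1) (d : ℤ_[p]) (N : ℕ) :
    ‖padicPow u d - ∑ k ∈ Finset.range N, padicIntCast p (Ring.choose d k) * (u - 1) ^ k‖
      ≤ ‖u - 1‖ ^ N := by
  have h := (hasSum_padicPow hu d).summable
  rw [padicPow, ← h.sum_add_tsum_nat_add N, add_sub_cancel_left]
  refine (IsUltrametricDist.norm_tsum_le _).trans (ciSup_le fun n => ?_)
  exact (norm_padicPow_term_le _ d _).trans
    (pow_le_pow_of_le_one (norm_nonneg _) hu.le (Nat.le_add_left N n))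

/-- Truncating the binomial series of the one-unit power gives rational functions over `K`, its
coefficients being in `ℤ_p`. The error is at most `M τ ^ N` uniformly on the affinoid, with `τ < 1`.
-/
theorem isRigidAnalytic_rankOneFun {K : IntermediateField ℚ_[p] ℂ_[p]} {η : ℝ} (hη0 : 0 < η)
    (hη : (p : ℝ)⁻¹ * η⁻¹ ^ (2 * p) < 1) {c : ℂ_[p]} (hc : c ∈ K) (i j : ℤ) (d : ℤ_[p]) :
    IsRigidAnalytic K η (rankOneFun c i j d) := by
  intro r hηr hr1 ε hε
  have hr0 : 0 < r := hη0.trans hηr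
  have hp0 : (0 : ℝ) < p := by exact_mod_cast hp.out.pos
  set τ : ℝ := (p : ℝ)⁻¹ * r⁻¹ ^ (2 * p) with hτ
  have hτ0 : 0 ≤ τ := by positivity
  have hτ1 : τ < 1 := by
    refine lt_of_le_of_lt ?_ hη
    rw [hτ]; gcongr
  set M : ℝ := ‖c‖ * r⁻¹ ^ i.natAbs * r⁻¹ ^ j.natAbs with hM
  have hM0 : 0 ≤ M := by positivity
  obtain ⟨N, hN⟩ := exists_pow_lt_of_lt_one (div_pos hε (show 0 < M + 1 by linarith)) hτ1
  have hz0 : ∀ z ∈ closedV p r, -z ≠ 0 := fun z hz =>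
    neg_ne_zero.mpr (norm_pos_iff.mp (hr0.trans_le hz.1))
  have hz1 : ∀ z ∈ closedV p r, 1 - z ≠ 0 := fun z hz => by
    rw [← norm_pos_iff, norm_sub_rev]; exact hr0.trans_le hz.2.2
  have hneg : IsRationalOn K (closedV p r) fun z => -z := by
    simpa using (IsRationalOn.const (neg_mem (one_mem K))).mul IsRationalOn.id
  have hone : IsRationalOn K (closedV p r) fun z => 1 - z := by
    simpa [sub_eq_add_neg] using (IsRationalOn.const (one_mem K)).add hneg
  have hq : IsRationalOn K (closedV p r) fun z => frobQuotient p z - 1 := by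
    have h1 := ((IsRationalOn.const (one_mem K)).add (hneg.pow p)).mul
      ((hone.pow p).inv fun z hz => pow_ne_zero p (hz1 z hz))
    simpa [sub_eq_add_neg, frobQuotient, div_eq_mul_inv] using
      h1.add (IsRationalOn.const (neg_mem (one_mem K)))
  have hrat := (((IsRationalOn.const hc).mul (hneg.zpow hz0 i)).mul (hone.zpow hz1 j)).mul
    (IsRationalOn.sum (Finset.range N) fun k _ => (IsRationalOn.const (S := closedV p r)
      (K.algebraMap_mem (Ring.choose d k : ℤ_[p]))).mul (hq.pow k))
  obtain ⟨P, Q, hPQ⟩ := hrat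
  refine ⟨P, Q, fun z hz => ⟨(hPQ z hz).1, ?_⟩⟩
  rw [← (hPQ z hz).2]
  have ht := norm_frobQuotient_sub_one_le hr0 hr1.le hz.2.1 hz.2.2
  have h1z : ‖1 - z‖ ≤ r⁻¹ := by
    rw [sub_eq_add_neg]
    refine (IsUltrametricDist.norm_add_le_max _ _).trans (max_le ?_ ?_)
    · rw [norm_one]; exact (one_le_inv₀ hr0).mpr hr1.le
    · rw [norm_neg]; exact hz.2.1
  rw [rankOneFun, ← mul_sub, norm_mul, norm_mul, norm_mul]
  calc _ ≤ M * τ ^ N := by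
        rw [hM]
        gcongr
        · exact norm_zpow_le hr0 (by rw [norm_neg]; exact hz.1) (by rw [norm_neg]; exact hz.2.1) i
        · exact norm_zpow_le hr0 (by rw [norm_sub_rev]; exact hz.2.2) h1z j
        · exact (norm_padicPow_sub_sum_le (ht.trans_lt hτ1) d N).trans
            (pow_le_pow_left₀ (norm_nonneg _) ht N)
    _ ≤ (M + 1) * (ε / (M + 1)) := by gcongr; linarith
    _ = ε := by field_simp

theorem norm_frobQuotient_sub_one_lt {η : ℝ} (hη0 : 0 < η) (hη1 : η ≤ 1)
    (hη : (p : ℝ)⁻¹ * η⁻¹ ^ (2 * p) < 1) {z : ℂ_[p]} (hz : z ∈ openV p η) :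
    ‖frobQuotient p z - 1‖ < 1 :=
  (norm_frobQuotient_sub_one_le hη0 hη1 hz.2.1.le hz.2.2.le).trans_lt hη

theorem hasDerivAt_frobQuotient {z : ℂ_[p]} (hz1 : 1 - z ≠ 0) (hq : 1 + (-z) ^ p ≠ 0) :
    HasDerivAt (frobQuotient p)
      (frobQuotient p z * (p / (1 - z) - p * (-z) ^ (p - 1) / (1 + (-z) ^ p))) z := by
  have hneg : HasDerivAt (fun z : ℂ_[p] => -z) (-1) z := hasDerivAt_neg z
  have hnum : HasDerivAt (fun z : ℂ_[p] => 1 + (-z) ^ p) (p * (-z) ^ (p - 1) * (-1)) z :=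
    (hneg.pow p).const_add 1
  have hden : HasDerivAt (fun z : ℂ_[p] => (1 - z) ^ p) (p * (1 - z) ^ (p - 1) * (-1)) z := by
    have : HasDerivAt (fun z : ℂ_[p] => 1 - z) (-1) z := by
      simpa using (hasDerivAt_id z).const_sub 1
    exact this.pow p
  have h := hnum.div hden (pow_ne_zero p hz1)
  refine h.congr_deriv ?_
  have e : (1 - z) ^ p = (1 - z) ^ (p - 1) * (1 - z) := by
    rw [← pow_succ, Nat.sub_add_cancel hp.out.one_lt.le]
  have hz2 := pow_ne_zero (p - 1) hz1
  rw [frobQuotient, e]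
  generalize (1 - z) ^ (p - 1) = v at *
  generalize hA : 1 + (-z) ^ p = A at *
  generalize hB : 1 - z = B at *
  field_simp
  ring

theorem hasDerivAt_rankOneFun {z : ℂ_[p]} (hz0 : z ≠ 0) (hz1 : 1 - z ≠ 0)
    (hq : ‖frobQuotient p z - 1‖ < 1) (hq0 : 1 + (-z) ^ p ≠ 0) (c : ℂ_[p]) (i j : ℤ) (d : ℤ_[p]) :
    HasDerivAt (rankOneFun c i j d) (rankOneFun c i j d z *
      (i / z - j / (1 - z) +
        padicIntCast p d * (p / (1 - z) - p * (-z) ^ (p - 1) / (1 + (-z) ^ p)))) z := by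
  have hQ0 : frobQuotient p z ≠ 0 :=
    norm_pos_iff.mp (by rw [norm_eq_one_of_norm_sub_one_lt hq]; exact one_pos)
  have hnz : -z ≠ 0 := neg_ne_zero.mpr hz0
  have h1 : HasDerivAt (fun z : ℂ_[p] => (-z) ^ i) (i * (-z) ^ (i - 1) * (-1)) z :=
    HasDerivAt.comp (h := fun z : ℂ_[p] => -z) z (hasDerivAt_zpow i (-z) (Or.inl hnz))
      (hasDerivAt_neg z)
  have h2 : HasDerivAt (fun z : ℂ_[p] => (1 - z) ^ j) (j * (1 - z) ^ (j - 1) * (-1)) z :=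
    HasDerivAt.comp (h := fun z : ℂ_[p] => 1 - z) z (hasDerivAt_zpow j (1 - z) (Or.inl hz1))
      (by simpa using (hasDerivAt_id z).const_sub 1)
  have h3 : HasDerivAt (fun z : ℂ_[p] => padicPow (frobQuotient p z) d)
      (padicIntCast p d * padicPow (frobQuotient p z) d / frobQuotient p z *
        (frobQuotient p z * (p / (1 - z) - p * (-z) ^ (p - 1) / (1 + (-z) ^ p)))) z :=
    HasDerivAt.comp (h := frobQuotient p) z (hasDerivAt_padicPow hq d)
      (hasDerivAt_frobQuotient hz1 hq0)
  refine (((h1.const_mul c).mul h2).mul h3).congr_deriv ?_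
  simp only [Pi.mul_apply]
  rw [rankOneFun, zpow_sub_one₀ hnz, zpow_sub_one₀ hz1]
  generalize (p / (1 - z) - p * (-z) ^ (p - 1) / (1 + (-z) ^ p) : ℂ_[p]) = L
  generalize (-z) ^ i = A
  generalize (1 - z) ^ j = B at *
  generalize padicPow (frobQuotient p z) d = D
  generalize frobQuotient p z = Q at *
  rw [inv_neg]
  field_simp
  ring

theorem deriv_frobLift (z : ℂ_[p]) : deriv (frobLift p) z = p * (-z) ^ (p - 1) := by
  have h : HasDerivAt (frobLift p) (-(p * (-z) ^ (p - 1) * (-1))) z :=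
    ((hasDerivAt_neg z).pow p).neg
  rw [h.deriv]; ring

/-- Inverting the constant and negating all three exponents gives the inverse function.
Horizontality becomes a rational identity once the common factor `F` is taken out of the logarithmic
derivative and `α'`, `β'` are eliminated. -/
theorem isFrobeniusIntertwiner_rankOneFun {K : IntermediateField ℚ_[p] ℂ_[p]} {η : ℝ} (hη0 : 0 < η)
    (hη1 : η < 1) (hη : (p : ℝ)⁻¹ * η⁻¹ ^ (2 * p) < 1) {c : ℂ_[p]} (hc : c ∈ K) (hc0 : c ≠ 0)
    {α β α' β' : ℂ_[p]} {a b : ℤ} (ha : p * α - α' = a) (hb : p * β - β' = b) {d : ℤ_[p]}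
    (hd : padicIntCast p d = α - β + 1) :
    IsFrobeniusIntertwiner K (frobLift p) (hypN α β) (hypN α' β') η
      (rankOneFun c (b + 1 - p) (a - b + (p - 1)) d) := by
  have hne : ∀ z ∈ openV p η, z ≠ 0 ∧ 1 - z ≠ 0 ∧ ‖frobQuotient p z - 1‖ < 1 ∧
      1 + (-z) ^ p ≠ 0 := by
    intro z hz
    have h0 : z ≠ 0 := norm_pos_iff.mp (hη0.trans hz.1)
    have h1 : 1 - z ≠ 0 := by
      rw [← norm_pos_iff, norm_sub_rev]; exact hη0.trans hz.2.2
    have h2 := norm_frobQuotient_sub_one_lt hη0 hη1.le hη hz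
    refine ⟨h0, h1, h2, fun h => ?_⟩
    have := norm_eq_one_of_norm_sub_one_lt h2
    rw [frobQuotient, h, zero_div, norm_zero] at this
    exact zero_ne_one this
  refine ⟨isRigidAnalytic_rankOneFun hη0 hη hc _ _ _,
    ⟨rankOneFun c⁻¹ (-(b + 1 - p)) (-(a - b + (p - 1))) (-d),
      isRigidAnalytic_rankOneFun hη0 hη (inv_mem hc) _ _ _, fun z hz => ?_⟩, fun z hz => ?_,
    fun z hz => ?_⟩
  · obtain ⟨h0, h1, h2, -⟩ := hne z hz
    have h0' : -z ≠ 0 := neg_ne_zero.mpr h0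
    have hA := zpow_ne_zero (b + 1 - p) h0'
    have hB := zpow_ne_zero (a - b + (p - 1)) h1
    have hD := padicPow_ne_zero h2 d
    rw [rankOneFun, rankOneFun, padicPow_neg h2, zpow_neg, zpow_neg]
    generalize (-z) ^ (b + 1 - p) = A at *
    generalize (1 - z) ^ (a - b + (p - 1)) = B at *
    field_simp
  · obtain ⟨h0, -, -, h3⟩ := hne z hz
    refine ⟨?_, fun h => h3 ?_⟩
    · rw [frobLift]
      exact neg_ne_zero.mpr (pow_ne_zero p (neg_ne_zero.mpr h0))
    · rw [← one_sub_frobLift, h, sub_self]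
  · obtain ⟨h0, h1, h2, h3⟩ := hne z hz
    refine ⟨_, hasDerivAt_rankOneFun h0 h1 h2 h3 c _ _ d, ?_⟩
    have e : (-z) ^ p = -(z * (-z) ^ (p - 1)) := by
      have h : (-z) ^ p = (-z) ^ (p - 1) * -z := by
        rw [← pow_succ, Nat.sub_add_cancel hp.out.one_lt.le]
      rw [h]; ring
    have h0' : -z ≠ 0 := neg_ne_zero.mpr h0
    have hw : (-z) ^ (p - 1) ≠ 0 := pow_ne_zero _ h0'
    rw [deriv_frobLift, hypN, hypN, frobLift, hd]
    rw [e] at h3 ⊢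
    have ha' : α' = p * α - a := by linear_combination -ha
    have hb' : β' = p * β - b := by linear_combination -hb
    rw [ha', hb']
    push_cast
    generalize rankOneFun c (b + 1 - p) (a - b + (p - 1)) d z = F
    generalize (-z) ^ (p - 1) = w at *
    have h4 : z - 1 ≠ 0 := by
      intro h; apply h1; linear_combination -h
    have h5 : - -(z * w) - 1 ≠ 0 := by
      intro h; apply h3; linear_combination -h
    have e1 : (1 : ℂ_[p]) - z = -(z - 1) := by ring
    have e2 : 1 + -(z * w) = -(z * w - 1) := by ring
    rw [neg_neg] at h5 ⊢
    rw [e1, e2]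
    field_simp
    ring

/-- Since `1 - σ(z)` is `(1 - z) ^ p` times the one-unit, its power `-d` cancels the one-unit factor
and leaves a single power of `1 - z`. -/
theorem rankOneFun_mul_padicPow {z : ℂ_[p]} (hz : ‖z‖ < 1) (hq : ‖frobQuotient p z - 1‖ < 1)
    (c : ℂ_[p]) (i : ℤ) (n : ℕ) (d : ℤ_[p]) :
    rankOneFun c i n d z * padicPow (1 - frobLift p z) (-d) =
      c * (-z) ^ i * padicPow (1 - z) (-((p : ℤ_[p]) * d - (n : ℤ_[p]))) := by
  have h1 : ‖(1 - z) - 1‖ < 1 := by rwa [sub_sub_cancel_left, norm_neg]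
  have h10 : (1 - z) ^ p ≠ 0 := pow_ne_zero p
    (norm_pos_iff.mp (by rw [norm_eq_one_of_norm_sub_one_lt h1]; exact one_pos))
  have e : 1 - frobLift p z = (1 - z) ^ p * frobQuotient p z := by
    rw [one_sub_frobLift, frobQuotient, mul_div_cancel₀ _ h10]
  have e2 : -((p : ℤ_[p]) * d - (n : ℤ_[p])) = n + p * (-d) := by ring
  rw [e, mul_padicPow (norm_pow_sub_one_lt h1 p) hq, ← padicPow_mul_natCast h1, e2,
    padicPow_add h1, padicPow_natCast, rankOneFun, zpow_natCast]
  linear_combination (c * (-z) ^ i * (1 - z) ^ n * padicPow (1 - z) (p * (-d))) *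
    padicPow_mul_neg hq d

/-- Dehomogenization: the powers of `x` and `y` are those by which the prefactors `x ^ (-α) y ^ (β -
1)` change under Frobenius. -/
theorem zpow_mul_rankOneFun {x y : ℂ_[p]} (hx : x ≠ 0) (hy : y ≠ 0) (c : ℂ_[p]) {a b : ℤ} {n : ℕ}
    (hn : (n : ℤ) = a - b + (p - 1)) (d : ℤ_[p]) :
    x ^ a * y ^ ((p : ℤ) - 1 - b) * rankOneFun c (b + 1 - p) n d (-y / x) =
      c * (x + y) ^ n * padicPow ((x ^ p + y ^ p) / (x + y) ^ p) d := by
  have e1 : -(-y / x) = y / x := by ring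
  have e2 : 1 - -y / x = (x + y) / x := by field_simp; ring
  have e3 : frobQuotient p (-y / x) = (x ^ p + y ^ p) / (x + y) ^ p := by
    rw [frobQuotient, e1, e2, div_pow, div_pow]
    have := pow_ne_zero p hx
    field_simp
  have e4 : y ^ ((p : ℤ) - 1 - b) * y ^ (b + 1 - p) = 1 := by
    rw [← zpow_add₀ hy]; ring_nf; simp
  have e5 : x ^ a = x ^ (b + 1 - p) * x ^ n := by
    rw [← zpow_natCast, hn, ← zpow_add₀ hx]; congr 1; ring
  rw [rankOneFun, e1, e2, e3, zpow_natCast, div_zpow, div_pow, e5]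
  have h1 := zpow_ne_zero (b + 1 - p) hx
  have h2 := pow_ne_zero n hx
  generalize x ^ (b + 1 - p) = A at *
  generalize x ^ n = B at *
  generalize y ^ (b + 1 - p) = D at *
  field_simp
  linear_combination c * (x + y) ^ n * padicPow ((x ^ p + y ^ p) / (x + y) ^ p) d * e4

theorem norm_pow_add_pow_eq_one {x y : ℂ_[p]} (hx : ‖x‖ ≤ 1) (hy : ‖y‖ ≤ 1) (hxy : ‖x + y‖ = 1) :
    ‖x ^ p + y ^ p‖ = 1 := by
  have h1 : ‖x ^ p + y ^ p - (x + y) ^ p‖ < 1 := by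
    have h := norm_add_pow_prime_sub_le hx hy
    rw [one_pow, mul_one] at h
    exact h.trans_lt (inv_lt_one_of_one_lt₀ (by exact_mod_cast hp.out.one_lt))
  have h2 : ‖(x + y) ^ p‖ = 1 := by rw [norm_pow, hxy, one_pow]
  have h3 := IsUltrametricDist.norm_add_eq_max_of_norm_ne_norm (x := x ^ p + y ^ p - (x + y) ^ p)
    (y := (x + y) ^ p) (by rw [h2]; exact h1.ne)
  rwa [sub_add_cancel, h2, max_eq_right h1.le] at h3

theorem exists_radius (p : ℕ) [hp : Fact p.Prime] :
    ∃ η : ℝ, 0 < η ∧ η < 1 ∧ (p : ℝ)⁻¹ * η⁻¹ ^ (2 * p) < 1 := by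
  have hp1 : (1 : ℝ) < p := by exact_mod_cast hp.out.one_lt
  have hp0 : (0 : ℝ) < (p : ℝ)⁻¹ := by positivity
  have h4 : 4 * p ≠ 0 := mul_ne_zero (by norm_num) hp.out.ne_zero
  -- With `η ^ (4 p) = 1 / p`, the quantity to bound is `p ^ (-1/2)`.
  set η : ℝ := ((p : ℝ)⁻¹) ^ (((4 * p : ℕ) : ℝ)⁻¹) with hη
  have hη0 : 0 < η := Real.rpow_pos_of_pos hp0 _
  have hpow : η ^ (4 * p) = (p : ℝ)⁻¹ := Real.rpow_inv_natCast_pow hp0.le h4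
  have hη1 : η < 1 := Real.rpow_lt_one hp0.le (inv_lt_one_of_one_lt₀ hp1)
    (inv_pos.mpr (by exact_mod_cast Nat.pos_of_ne_zero h4))
  refine ⟨η, hη0, hη1, ?_⟩
  rw [inv_pow, ← div_eq_mul_inv, div_lt_one (by positivity), ← hpow]
  exact pow_lt_pow_right_of_lt_one₀ hη0 hη1 (by have := hp.out.pos; omega)

end Intertwiner
end

/-! ### Assembly of the main theorem -/

theorem mainTheorem5 (p : ℕ) [Fact p.Prime] (ϖ : ℂ_[p]) (hϖ : ϖ ^ (p - 1) = -(p : ℂ_[p]))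
    (α β α' β' : ℚ)
    (hα : 0 ≤ α ∧ α < 1) (hβ : 0 ≤ β ∧ β < 1) (hα' : 0 ≤ α' ∧ α' < 1) (hβ' : 0 ≤ β' ∧ β' < 1)
    (hαp : ‖(α : ℚ_[p])‖ ≤ 1) (hβp : ‖(β : ℚ_[p])‖ ≤ 1) (hne : α ≠ β)
    (a b : ℤ) (ha : (p : ℚ) * α - α' = a) (hb : (p : ℚ) * β - β' = b)
    -- the parameters of the two GKZ systems, the shift between them, and the scalar
    (δ δ' γ : ℂ_[p]) (T μ : ℤ)
    (hδ : δ = (α : ℂ_[p]) - (β : ℂ_[p]) + 1) (hδ' : δ' = (α' : ℂ_[p]) - (β' : ℂ_[p]) + 1)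
    (hT : (T : ℚ) = p * (α - β + 1) - (α' - β' + 1))
    (hμ : (μ : ℚ) = p * (α - β) - (α' - β'))
    (hγ : γ = rankOneScalar p ϖ α β α' β' μ) :
    -- the cases in the scalar are exhaustive, and the shift is a nonnegative integer
    α' ≠ β' ∧ 0 ≤ T ∧
    -- the scalar is Dwork's symbol `γ_p(α' - β' + 1, α - β + 1)`
    HasSum (dworkGammaTerm p ϖ T δ) γ ∧
    -- the GKZ modules have rank one, with basis the class of `1`
    (∀ x y : ℂ_[p], ‖x‖ ≤ 1 → ‖y‖ ≤ 1 → ‖x + y‖ = 1 →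
      OneIsBasis ϖ δ (x ^ p + y ^ p) ∧ OneIsBasis ϖ δ' (x + y)) ∧
    -- specialized at `x = 1`, `y = 0`, the intertwiner is multiplication by the scalar
    IsDworkMatrix ϖ δ δ' T.toNat 1 0 γ ∧
    -- on the `z`-line, with `z = -y / x`:
    ∃ (η : ℝ) (F : ℂ_[p] → ℂ_[p]), 0 < η ∧ η < 1 ∧
      -- `F` is a Frobenius intertwiner over `ℚ_p(ϖ)` of the hypergeometric connections
      IsFrobeniusIntertwiner (IntermediateField.adjoin ℚ_[p] {ϖ}) (frobLift p)
        (hypN (α : ℂ_[p]) (β : ℂ_[p])) (hypN (α' : ℂ_[p]) (β' : ℂ_[p])) η F ∧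
      -- it is the one constructed by Dwork, under `Φ(x, y) = x ^ (-α) * y ^ (β - 1) * f (-y / x)`
      (∀ x y : ℂ_[p], ‖x‖ = 1 → ‖y‖ = 1 → ‖x + y‖ = 1 →
        IsDworkMatrix ϖ δ δ' T.toNat x y (x ^ a * y ^ ((p : ℤ) - 1 - b) * F (-y / x))) ∧
      -- and in the bases of formal solutions at `0` it is multiplication by the scalar
      ∀ z : ℂ_[p], η < ‖z‖ → ‖z‖ < 1 → ∃ u u' : ℂ_[p],
        HasSum (hypTerm δ (frobLift p z)) u ∧ HasSum (hypTerm δ' z) u' ∧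
        F z * u = γ * (-z) ^ (b + 1 - (p : ℤ)) * u' := by
  have hp := ‹Fact p.Prime›
  have hp1 := hp.out.one_lt
  have hpq : (1 : ℚ) < p := by exact_mod_cast hp1
  have hαβ0 : ‖((α - β : ℚ) : ℚ_[p])‖ ≤ 1 := by
    rw [Rat.cast_sub, sub_eq_add_neg]
    exact (IsUltrametricDist.norm_add_le_max _ _).trans (max_le hαp (by rwa [norm_neg]))
  have hd0 : ‖((α - β + 1 : ℚ) : ℚ_[p])‖ ≤ 1 := by
    rw [Rat.cast_add, Rat.cast_one]
    exact (IsUltrametricDist.norm_add_le_max _ _).trans (max_le hαβ0 norm_one.le)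
  have habs : |α - β| < 1 := abs_lt.mpr ⟨by linarith, by linarith⟩
  -- If `α' = β'`, then `p (α - β) = a - b` is an integer, which forces `α = β`.
  have hne' : α' ≠ β' := fun h => hne (sub_eq_zero.mp
    (eq_zero_of_prime_mul_eq_intCast hαβ0 habs (m := a - b) (by
      push_cast; rw [← ha, ← hb, h]; ring)))
  -- The integers `a` and `b` lie in `[0, p)`, so `0 ≤ T ≤ 2 p - 2`, the range covered by the
  -- evaluation of the symbol.
  have ha0 : 0 ≤ a := by
    have h : (-1 : ℚ) < a := by rw [← ha]; nlinarith
    have : -1 < a := by exact_mod_cast h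
    omega
  have hb0 : 0 ≤ b := by
    have h : (-1 : ℚ) < b := by rw [← hb]; nlinarith
    have : -1 < b := by exact_mod_cast h
    omega
  have hap : a < p := by
    have h : (a : ℚ) < p := by rw [← ha]; nlinarith
    exact_mod_cast h
  have hbp : b < p := by
    have h : (b : ℚ) < p := by rw [← hb]; nlinarith
    exact_mod_cast h
  have hμab : μ = a - b := by
    have h : (μ : ℚ) = (a : ℚ) - b := by rw [hμ, ← ha, ← hb]; ring
    exact_mod_cast h
  have hTμ : T = μ + (p - 1) := by
    have h : (T : ℚ) = (μ : ℚ) + (p - 1) := by rw [hT, hμ]; ring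
    exact_mod_cast h
  have hT0 : 0 ≤ T := by omega
  obtain ⟨d, hd⟩ : ∃ d : ℤ_[p], padicIntCast p d = (α : ℂ_[p]) - (β : ℂ_[p]) + 1 :=
    ⟨_, (padicIntCast_ratToPadicInt hd0).trans (by push_cast; ring)⟩
  obtain ⟨n, rfl⟩ := Int.eq_ofNat_of_zero_le hT0
  have haC : (p : ℂ_[p]) * α - α' = a := by exact_mod_cast congrArg (Rat.cast : ℚ → ℂ_[p]) ha
  have hbC : (p : ℂ_[p]) * β - β' = b := by exact_mod_cast congrArg (Rat.cast : ℚ → ℂ_[p]) hb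
  have hnC : (n : ℂ_[p]) = a - b + (p - 1) := by
    rw [hμab] at hTμ
    exact_mod_cast congrArg (Int.cast : ℤ → ℂ_[p]) hTμ
  have hd' : padicIntCast p ((p : ℤ_[p]) * d - (n : ℤ_[p])) = δ' := by
    rw [map_sub, map_mul, map_natCast, map_natCast, hd, hδ', hnC, ← haC, ← hbC]; ring
  -- `δ` is not a positive integer because `0 < |α - β| < 1`; this keeps `(δ)_i` finite for negative
  -- `i`.
  have hδm : ∀ m : ℕ, padicIntCast p d ≠ m + 1 := by
    intro m h
    rw [hd] at h
    have h1 : (α : ℂ_[p]) - β = m := by linear_combination h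
    have h2 : α - β = m := by exact_mod_cast h1
    rw [h2] at habs
    have h3 : (m : ℤ) = 0 := by
      rw [← Int.abs_lt_one_iff]; exact_mod_cast habs
    rw [show m = 0 by exact_mod_cast h3, Nat.cast_zero] at h2
    exact hne (sub_eq_zero.mp h2)
  have hsum : HasSum (dworkGammaTerm p ϖ n (padicIntCast p d)) γ := by
    rw [hγ]
    exact hasSum_rankOneScalar hϖ hα' hβ' hne hne' hd (by omega) hTμ hμ
  have hTd : (n : ℂ_[p]) + padicIntCast p ((p : ℤ_[p]) * d - (n : ℤ_[p])) =
      p * padicIntCast p d := by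
    rw [map_sub, map_mul, map_natCast, map_natCast]; ring
  have hγ0 := (exists_dworkOp_eq_X_pow_mul hϖ hδm hTd hsum).1
  have hmat : ∀ {x y : ℂ_[p]}, ‖x‖ ≤ 1 → ‖y‖ ≤ 1 → ‖x + y‖ = 1 → _ := fun hx hy hxy =>
    isDworkMatrix hϖ hδm hTd hsum hx hy hxy
  rw [hδ, ← hd, ← hd', Int.toNat_natCast]
  refine ⟨hne', hT0, hsum, fun x y hx hy hxy =>
    ⟨oneIsBasis hϖ (norm_pow_add_pow_eq_one hx hy hxy) d, oneIsBasis hϖ hxy _⟩, ?_, ?_⟩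
  -- At `(1, 0)` both `x + y` and the one-unit are `1`, so only `γ` remains.
  · have h := hmat (x := 1) (y := 0) (by simp) (by simp) (by simp)
    simpa only [add_zero, one_pow, zero_pow hp.out.ne_zero, div_one, mul_one,
      padicPow_one_left] using h
  · obtain ⟨η, hη0, hη1, hη⟩ := exists_radius p
    have hnab : (n : ℤ) = a - b + (p - 1) := hTμ.trans (by rw [hμab])
    refine ⟨η, rankOneFun γ (b + 1 - p) n d, hη0, hη1, ?_, ?_, ?_⟩
    · rw [hnab]
      exact isFrobeniusIntertwiner_rankOneFun hη0 hη1 hη (hγ ▸ rankOneScalar_mem _ _ _ _ _ _) hγ0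
        haC hbC hd
    · intro x y hx hy hxy
      rw [zpow_mul_rankOneFun (norm_pos_iff.mp (hx ▸ one_pos)) (norm_pos_iff.mp (hy ▸ one_pos))
        _ hnab]
      exact hmat hx.le hy.le hxy
    · intro z hηz hz
      have hz1 : ‖z - 1‖ = 1 := by
        rw [norm_sub_rev]
        exact norm_eq_one_of_norm_sub_one_lt (by rwa [sub_sub_cancel_left, norm_neg])
      have hzV : z ∈ openV p η :=
        ⟨hηz, hz.trans ((one_lt_inv₀ hη0).mpr hη1), by rw [hz1]; exact hη1⟩
      have hσ : ‖frobLift p z‖ < 1 := by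
        rw [frobLift, norm_neg, norm_pow, norm_neg]
        exact pow_lt_one₀ (norm_nonneg _) hz hp.out.ne_zero
      exact ⟨_, _, hasSum_hypTerm hσ d, hasSum_hypTerm hz _,
        rankOneFun_mul_padicPow hz (norm_frobQuotient_sub_one_lt hη0 hη1.le hη hzV) _ _ _ _⟩
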